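/- Let $k\ge 3$, $d_1,\dots,d_k\ge 1$, $m=d_1+\cdots+d_k$, let $W_i^*=\mathbb R^2$, and let $\pi_1,\pi_2\in\mathbb R$ with $\pi_2\neq 0$. Positions in $\bigotimes_i (W_i^*)^{\otimes d_i}$ are labelled by pairs $(i,r)$, $1\le r\le d_i$, and $ins_i$ places a tensor of $(W_i^*)^{\otimes d_i}$ into the positions $(i,1),\dots,(i,d_i)$. Consider the decomposable Segre–Veronese factorization structure, i.e. the inclusion $\varphi$ of $$\mathfrak h=\sum_{i=1}^{k} ins_i\bigl(S^{d_i}W_i^*\otimes\langle\Gamma_i\rangle\bigr)\subset\bigotimes_{i=1}^k (W_i^*)^{\otimes d_i},\qquad \Gamma_i=(1,0)^{\otimes(m-d_i)}\ (i<k),\quad \Gamma_k=(\pi_1,\pi_2)^{\otimes d_1}\otimes(1,0)^{\otimes(m-d_1-d_k)} .$$ For coordinates $x=(x_{ir})$ let $\langle\mu,v\rangle$ be the pairing of $v\in\mathfrak h$ with $\bigotimes_{i,r}(1,x_{ir})$, $\langle\hat{\mathbf x}_i,\Gamma_i\rangle$ the pairing of $\Gamma_i$ with $\bigotimes_{j\ne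 i}\bigotimes_{s}(1,x_{js})$, $\Delta_{ir}=\prod_{s\ne r}(x_{ir}-x_{is})$, and $\psi_{ir}(s)=ins_i((s,-1)^{\otimes d_i}\otimes\Gamma_i)\in\mathfrak h$. Let $\beta\in\mathfrak h$, $\mu_\beta=\mu/\langle\mu,\beta\rangle$, and let $A_{ir}$ be functions of one variable. Let $U\subset\mathbb R^m$ be open such that $\langle\mu,\beta\rangle$, $\Delta_{ir}$, $\langle\hat{\mathbf x}_i,\Gamma_i\rangle$ and $A_{ir}(x_{ir})$ vanish nowhere on $U$. The separable geometry $(g_\beta,J_\beta)$ on $U\times\mathfrak t$, $\mathfrak t=\mathfrak h/\langle\beta\rangle$, with coordinates $(x,t)$, is $$g_\beta=\sum_{i,r}\Bigl(\frac{\Delta_{ir}\langle\hat{\mathbf x}_i,\Gamma_i\rangle}{A_{ir}(x_{ir})\langle\mu,\beta\rangle}dx_{ir}^2+\frac{A_{ir}(x_{ir})\langle\mu,\beta\rangle}{\Delta_{ir}\langle\hat{\mathbf x}_i,\Gamma_i\rangle}\langle\partial_{x_{ir}}\mu_\beta,dt\rangle^2\Bigr),$$ $$J_\beta dx_{ir}=\frac{A_{ir}(x_{ir})\langle\mu,\beta\rangle}{\Delta_{ir}\langle\hat{\mathbf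 x}_i,\Gamma_i\rangle}\langle\partial_{x_{ir}}\mu_\beta,dt\rangle,\qquad J_\beta dt=\sum_{i,r}\frac{\psi_{ir}(x_{ir})\bmod\beta}{A_{ir}(x_{ir})}dx_{ir}.$$ It is called extremal if the scalar curvature $s$ of $g_\beta$ is a Killing potential, i.e. $s$ is smooth and $J_\beta\,\mathrm{grad}\,s$ is a Killing vector field of $g_\beta$. Let $\Upsilon_1,\dots,\Upsilon_k$ be real polynomials, $\Upsilon_p(x)=\sum_j\gamma_p^jx^j$. Below, $\iint f\,dx\,dx$ stands for any second antiderivative of $f$ on the range of the respective coordinate on $U$ (the constants of integration may depend on $p$ and $q$). Assume that $$A_{pq}(x_{pq})=\iint\Upsilon_p(x_{pq})\,dx_{pq}dx_{pq},\qquad p=2,\dots,k,\ q=1,\dots,d_p,$$ and that one of the following holds. 1. $\varphi(\beta)\in\mathrm{span}\{(1,0)^{\otimes m}\}$; $$A_{1q}(x_{1q})=\frac{1}{(\pi_1+\pi_2x_{1q})^{d_k}}\iint\Upsilon_1(x_{1q})(\pi_1+\pi_2x_{1q})^{d_k-1}dx_{1q}dx_{1q},\quad q=1,\dots,d_1;$$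 $\deg\Upsilon_1\le d_1+1$, $\deg\Upsilon_p\le d_p$ for $2\le p\le k-1$, $\deg\Upsilon_k\le d_k-1$; and $\gamma_k^{d_k-1}=-(-\pi_2)^{d_1-1}\Upsilon_1(-\pi_1/\pi_2)$. 2. $\varphi(\beta)\in\mathrm{span}\{(\pi_1,\pi_2)^{\otimes d_1}\otimes(1,0)^{\otimes(m-d_1)}\}$; $$A_{1q}(x_{1q})=(\pi_1+\pi_2x_{1q})^{m+1-d_k}\iint\Upsilon_1(x_{1q})(\pi_1+\pi_2x_{1q})^{-m+d_k-4}dx_{1q}dx_{1q},\quad q=1,\dots,d_1;$$ $\deg\Upsilon_1\le d_1+2$, $\deg\Upsilon_p\le d_p-1$ for $2\le p\le k$; $\Upsilon_1(-\pi_1/\pi_2)=0$; and $\frac{\gamma_1^{d_1+2}}{\pi_2^3}+\sum_{i=2}^{k-1}\gamma_i^{d_i-1}=0$. 3. $\varphi(\beta)\in\mathrm{span}\{(a,b)^{\otimes d_1}\otimes(1,0)^{\otimes(m-d_1)}\}$ for some $a,b\in\mathbb R$ with $b\ne0$ and $\langle(a,b)\rangle\ne\langle(\pi_1,\pi_2)\rangle$;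 $$A_{1q}(x_{1q})=\frac{(a+bx_{1q})^{m+1}}{(\pi_1+\pi_2x_{1q})^{d_k}}\iint\Upsilon_1(x_{1q})\frac{(\pi_1+\pi_2x_{1q})^{d_k-1}}{(a+bx_{1q})^{m+3}}dx_{1q}dx_{1q},\quad q=1,\dots,d_1;$$ $\deg\Upsilon_1\le d_1+2$, $\deg\Upsilon_p\le d_p-1$ for $2\le p\le k$; $\gamma_k^{d_k-1}(a-b\pi_1/\pi_2)^2=-(-\pi_2)^{d_1-1}\Upsilon_1(-\pi_1/\pi_2)$; and $\frac{\gamma_1^{d_1+2}}{\pi_2b^2}+\sum_{i=2}^{k-1}\gamma_i^{d_i-1}=0$. Then the separable geometry $(g_\beta,J_\beta)$ is extremal. -/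

import Mathlib

open scoped TensorProduct ContDiff

noncomputable section

/-! ## Riemannian notions in a coordinate chart -/

namespace Chart

variable {ι : Type} [Fintype ι] [DecidableEq ι]

/-- The partial derivative `∂f/∂zᵢ`. -/
def pderiv (i : ι) (f : (ι → ℝ) → ℝ) (z : ι → ℝ) : ℝ :=
  fderiv ℝ f z (Pi.single i 1)

/-- The Christoffel symbols `Γᵏᵢⱼ` of the Levi-Civita connection of the metric `g = (g_ij)`. -/
def christoffel (g : (ι → ℝ) → Matrix ι ι ℝ) (k i j : ι) (z : ι → ℝ) : ℝ :=
  (1 / 2) * ∑ l, (g z)⁻¹ k l *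
    (pderiv i (fun w => g w j l) z + pderiv j (fun w => g w i l) z
      - pderiv l (fun w => g w i j) z)

/-- The Ricci tensor `Ric_jk` of `g`. -/
def ricci (g : (ι → ℝ) → Matrix ι ι ℝ) (j k : ι) (z : ι → ℝ) : ℝ :=
  ∑ i, (pderiv i (christoffel g i j k) z - pderiv j (christoffel g i i k) z)
    + ∑ i, ∑ p, (christoffel g i i p z * christoffel g p j k z
        - christoffel g i j p z * christoffel g p i k z)

/-- The scalar curvature of `g`. -/
def scalarCurvature (g : (ι → ℝ) → Matrix ι ι ℝ) (z : ι → ℝ) : ℝ :=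
  ∑ j, ∑ k, (g z)⁻¹ j k * ricci g j k z

/-- The gradient vector field of `f` with respect to `g`. -/
def gradient (g : (ι → ℝ) → Matrix ι ι ℝ) (f : (ι → ℝ) → ℝ) (z : ι → ℝ) : ι → ℝ :=
  (g z)⁻¹.mulVec (fun j => pderiv j f z)

/-- The component `(L_X g)_ij` of the Lie derivative of `g` along the vector field `X`. -/
def lieDerivMetric (g : (ι → ℝ) → Matrix ι ι ℝ) (X : (ι → ℝ) → ι → ℝ) (i j : ι)
    (z : ι → ℝ) : ℝ :=
  ∑ k, (X z k * pderiv k (fun w => g w i j) z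
    + g z k j * pderiv i (fun w => X w k) z
    + g z i k * pderiv j (fun w => X w k) z)

/-- `f` is a Killing potential on `Ω` for `(g, J)`: `f` is smooth and `J grad f` is a Killing
vector field.  `J z` is the matrix of the endomorphism `J` of the tangent space at `z`. -/
def IsKillingPotentialOn (g J : (ι → ℝ) → Matrix ι ι ℝ) (Ω : Set (ι → ℝ))
    (f : (ι → ℝ) → ℝ) : Prop :=
  ContDiffOn ℝ ∞ f Ω ∧
    ∀ z ∈ Ω, ∀ i j, lieDerivMetric g (fun w => (J w).mulVec (gradient g f w)) i j z = 0

/-- `(g, J)` is extremal on `Ω`: its scalar curvature is a Killing potential. -/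
def IsExtremalOn (g J : (ι → ℝ) → Matrix ι ι ℝ) (Ω : Set (ι → ℝ)) : Prop :=
  IsKillingPotentialOn g J Ω (scalarCurvature g)

end Chart

/-! ## Segre-Veronese factorization structures and their separable geometries -/

namespace SegreVeronese

/-- Tensor powers of the (dual of the) plane; `![u, v]` is the element `(u, v)` of the plane. -/
abbrev Tensor (ι : Type) : Type := ⨂[ℝ] _ : ι, (Fin 2 → ℝ)

/-- The pairing `⟨⨂_p (1, x_p), T⟩` of a tensor `T` with `⨂_p (1, x_p)`. -/
def pairing {ι : Type} [Fintype ι] (x : ι → ℝ) : Tensor ι →ₗ[ℝ] ℝ :=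
  PiTensorProduct.lift
    ((MultilinearMap.mkPiAlgebra ℝ ι ℝ).compLinearMap
      (fun p => LinearMap.proj (R := ℝ) (φ := fun _ : Fin 2 => ℝ) 0
        + x p • LinearMap.proj (R := ℝ) (φ := fun _ : Fin 2 => ℝ) 1))

theorem pairing_tprod {ι : Type} [Fintype ι] (x : ι → ℝ) (v : ι → Fin 2 → ℝ) :
    pairing x (PiTensorProduct.tprod ℝ v) = ∏ p, (v p 0 + x p * v p 1) := by
  simp [pairing]

/-- The subspace of symmetric tensors. -/
def symTensor (ι : Type) : Submodule ℝ (Tensor ι) :=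
  ⨅ σ : Equiv.Perm ι, LinearMap.eqLocus
    (PiTensorProduct.reindex ℝ (fun _ : ι => Fin 2 → ℝ) σ).toLinearMap LinearMap.id

theorem tprod_const_mem_symTensor (ι : Type) (w : Fin 2 → ℝ) :
    PiTensorProduct.tprod ℝ (fun _ : ι => w) ∈ symTensor ι := by
  simp only [symTensor, Submodule.mem_iInf, LinearMap.mem_eqLocus]
  intro σ
  exact PiTensorProduct.reindex_tprod (R := ℝ) (s := fun _ : ι => Fin 2 → ℝ) σ (fun _ => w)

variable {k : ℕ}

/-- The slots `(i, r)`, `r = 1, …, dᵢ`, of the partition `m = d₁ + ⋯ + d_k`. -/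
abbrev Slot (d : Fin k → ℕ) : Type := Σ i : Fin k, Fin (d i)

variable {d : Fin k → ℕ}

/-- `ins i G S` places `S` in the grouped `i`-slots and `G` in the remaining slots. -/
def ins (i : Fin k) (G : Tensor {q : Slot d // ¬ q.1 = i}) :
    Tensor {q : Slot d // q.1 = i} →ₗ[ℝ] Tensor (Slot d) :=
  (PiTensorProduct.reindex ℝ (fun _ => Fin 2 → ℝ)
      (Equiv.sumCompl (fun q : Slot d => q.1 = i))).toLinearMap ∘ₗ
    (PiTensorProduct.tmulEquiv ℝ (Fin 2 → ℝ)).toLinearMap ∘ₗ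
      (TensorProduct.mk ℝ _ _).flip G

/-- The space `𝔥 = ∑ᵢ insᵢ (S^{dᵢ} Wᵢ* ⊗ ⟨Γᵢ⟩)`, included in `⨂ᵢ (Wᵢ*)^{⊗ dᵢ}`. -/
def structureSpace (Γ : ∀ i : Fin k, Tensor {q : Slot d // ¬ q.1 = i}) :
    Submodule ℝ (Tensor (Slot d)) :=
  ⨆ i, (symTensor {q : Slot d // q.1 = i}).map (ins i (Γ i))

variable (Γ : ∀ i : Fin k, Tensor {q : Slot d // ¬ q.1 = i})

/-- The factorization curve `ψ_{ir}(s) = insᵢ ((s, -1)^{⊗ dᵢ} ⊗ Γᵢ)`. -/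
def curve (p : Slot d) (s : ℝ) : structureSpace Γ :=
  ⟨ins p.1 (Γ p.1) (PiTensorProduct.tprod ℝ fun _ => ![s, -1]),
    Submodule.mem_iSup_of_mem p.1
      (Submodule.mem_map_of_mem (tprod_const_mem_symTensor _ _))⟩

/-- `Δ_{ir} = ∏_{s ≠ r} (x_{ir} - x_{is})`. -/
def vandermonde (x : Slot d → ℝ) (p : Slot d) : ℝ :=
  ∏ q : Slot d with q.1 = p.1 ∧ q ≠ p, (x p - x q)

/-- `⟨x̂ᵢ, Γᵢ⟩`. -/
def hatPairing (x : Slot d → ℝ) (i : Fin k) : ℝ :=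
  pairing (fun q : {q : Slot d // ¬ q.1 = i} => x q) (Γ i)

/-- `⟨∂μ_β/∂x_{ir}, v⟩` for `v ∈ 𝔥`, where `μ_β = μ / ⟨μ, β⟩`.  It depends only on the class of
`v` in `𝔱 = 𝔥 / ⟨β⟩`. -/
def dMomentum (β : structureSpace Γ) (p : Slot d) (v : structureSpace Γ) (x : Slot d → ℝ) : ℝ :=
  Chart.pderiv p
    (fun y => pairing y (v : Tensor (Slot d)) / pairing y (β : Tensor (Slot d))) x

/-- `A_{ir}(x_{ir}) ⟨μ, β⟩ / (Δ_{ir} ⟨x̂ᵢ, Γᵢ⟩)`. -/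
def profile (β : structureSpace Γ) (A : Slot d → ℝ → ℝ) (x : Slot d → ℝ) (p : Slot d) : ℝ :=
  A p (x p) * pairing x (β : Tensor (Slot d)) / (vandermonde x p * hatPairing Γ x p.1)

/-- The metric `g_β` of the separable geometry, in the coordinates `z = (x, t)`.
Here `B` is a basis of `𝔥` with `B none = β`; the classes of the `B (some a)` form a basis of
`𝔱 = 𝔥 / ⟨β⟩`, and `t_a` are the components of the angular coordinate `t` in this basis. Thus
`g_β = ∑_p (1 / profile_p) dx_p² + ∑_p profile_p ⟨∂_p μ_β, dt⟩²`. -/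
def metric (β : structureSpace Γ) (B : Module.Basis (Option (Slot d)) ℝ (structureSpace Γ))
    (A : Slot d → ℝ → ℝ) (z : Slot d ⊕ Slot d → ℝ) : Matrix (Slot d ⊕ Slot d) (Slot d ⊕ Slot d) ℝ :=
  let x : Slot d → ℝ := fun p => z (Sum.inl p)
  Matrix.fromBlocks
    (Matrix.diagonal fun p =>
      vandermonde x p * hatPairing Γ x p.1 / (A p (x p) * pairing x (β : Tensor (Slot d))))
    0 0
    (Matrix.of fun a b => ∑ p, profile Γ β A x p *
      dMomentum Γ β p (B (some a)) x * dMomentum Γ β p (B (some b)) x)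

/-- The complex structure `J_β`, as a matrix acting on tangent vectors:
`J ∂_{x_p} = - (1 / A_p) ⟨ψ_p mod β, ∂_t⟩` and `J ∂_{t_a} = - ∑_p profile_p ⟨∂_p μ_β, B_a⟩ ∂_{x_p}`.
With `(J θ)(X) = - θ (J X)` on 1-forms this is
`J dx_p = profile_p ⟨∂_p μ_β, dt⟩` and `J dt = ∑_p ((ψ_p mod β) / A_p) dx_p`. -/
def complexStructure (β : structureSpace Γ)
    (B : Module.Basis (Option (Slot d)) ℝ (structureSpace Γ))
    (A : Slot d → ℝ → ℝ) (z : Slot d ⊕ Slot d → ℝ) : Matrix (Slot d ⊕ Slot d) (Slot d ⊕ Slot d) ℝ :=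
  let x : Slot d → ℝ := fun p => z (Sum.inl p)
  Matrix.fromBlocks
    0
    (Matrix.of fun p a => - (profile Γ β A x p * dMomentum Γ β p (B (some a)) x))
    (Matrix.of fun a p => - (B.repr (curve Γ p (x p)) (some a) / A p (x p)))
    0

/-- The separable geometry is defined over the set `U` of values of `x`: none of the quantities
`Δ_{ir}`, `⟨x̂ᵢ, Γᵢ⟩`, `A_{ir}(x_{ir})`, `⟨μ, β⟩` vanishes there. -/
def IsRegularOn (β : structureSpace Γ) (A : Slot d → ℝ → ℝ) (U : Set (Slot d → ℝ)) : Prop :=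
  ∀ x ∈ U, pairing x (β : Tensor (Slot d)) ≠ 0 ∧
    ∀ p : Slot d, vandermonde x p ≠ 0 ∧ hatPairing Γ x p.1 ≠ 0 ∧ A p (x p) ≠ 0

/-- The separable geometry `(g_β, J_β)` over `U` is extremal. -/
def IsExtremalGeometry (β : structureSpace Γ)
    (B : Module.Basis (Option (Slot d)) ℝ (structureSpace Γ))
    (A : Slot d → ℝ → ℝ) (U : Set (Slot d → ℝ)) : Prop :=
  Chart.IsExtremalOn (metric Γ β B A) (complexStructure Γ β B A)
    {z | (fun p => z (Sum.inl p)) ∈ U}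

/-- The defining tensors `Γᵢ = (1,0)^{⊗ (m - dᵢ)}` for `i` not the last group, and
`Γ_k = (π₁,π₂)^{⊗ d₁} ⊗ (1,0)^{⊗ (m - d₁ - d_k)}`, of the decomposable Segre-Veronese
factorization structure with two intersection points, with `k = n + 3` groups; group `1` is
`(0 : Fin (n + 3))` and group `k` is `Fin.last (n + 2)`. -/
def twoPointTensors {n : ℕ} (d : Fin (n + 3) → ℕ) (π₁ π₂ : ℝ) (i : Fin (n + 3)) :
    Tensor {q : Slot d // ¬ q.1 = i} :=
  PiTensorProduct.tprod ℝ fun q =>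
    if i = Fin.last (n + 2) ∧ q.1.1 = 0 then ![π₁, π₂] else ![1, 0]

/-- The tensor `(a,b)^{⊗ d₁} ⊗ (1,0)^{⊗ (m - d₁)}`. -/
def firstGroupTensor {n : ℕ} (d : Fin (n + 3) → ℕ) (a b : ℝ) : Tensor (Slot d) :=
  PiTensorProduct.tprod ℝ fun q => if q.1 = 0 then ![a, b] else ![1, 0]

/-- The range of values of the coordinate `x_p` on `U`. -/
def coordRange (U : Set (Slot d → ℝ)) (p : Slot d) : Set ℝ := (fun x => x p) '' U

end SegreVeronese

/-- `F = ∫∫ f` on `S`: `F` is some second antiderivative of `f` (the two constants of integration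
are arbitrary). -/
def IsDoubleIntegralOn (F f : ℝ → ℝ) (S : Set ℝ) : Prop :=
  ∃ G : ℝ → ℝ, ∀ s ∈ S, HasDerivAt F (G s) s ∧ HasDerivAt G (f s) s

end

open SegreVeronese

/-! Write ℓ(s) = π₁ + π₂ s, h = ⟨μ,β⟩, b_p = ∂_p log h. Every ⟨μ,v⟩ with v ∈ 𝔥 is affine in each
coordinate, and all of them solve one linear second-order system ∂_p∂_q f = c_qp ∂_q f + c_pq ∂_p f
(`mixed_pderiv`), whose coefficients are the logarithmic derivatives of Δ_q⟨x̂,Γ⟩. Dividing by h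
gives closed first-order equations for the coefficients of g_β; these are collected in
`Chart.IsSeparable` and proved in `isSeparable`.

From these equations alone the scalar curvature of ∑ P_p⁻¹ dx_p² + ∑ P_p (∑ D_pa dt_a)² is computed
through the Levi-Civita connection. As expected of a Kähler metric, the quadratic terms cancel and
only the logarithmic derivative of the volume of the fibres survives
(`IsSeparable.scalarCurvature_eq`). With W_p = A_p ℓ^{d_k} on the first group and W_p = A_p
elsewhere, s becomes -∑ h/(Δ⟨x̂,Γ⟩w) times W'' - 2(m+1) b_p W' + (m+1)(m+2) b_p² W, where w = W/A
(`scalarCurvature_metric`).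

In all three cases h = c ∏ λ(x_{1r}) with λ(s) = a + bs (λ = 1 in case 1, λ = ℓ in case 2).
Substituting W = λ^{m+1} F turns the second-order operator into λ^{m+1} F'', which is why the A_{1q}
are given as weighted double integrals. Hence s = -h ∑ `curvatureTerm`, a sum of the values
Υ_p(x_{pq}) over Vandermonde-type denominators (`exists_weighted_antiderivatives`).

The functions ⟨μ,v⟩/h are Killing potentials: their Hamiltonian fields are the constant fields v mod
β on the torus fibres (`isExtremalGeometry_of_pairing`). It remains to show that -h² ∑
`curvatureTerm` equals ⟨μ,v⟩ for some v ∈ 𝔥, which is Lagrange interpolation. The last group sums to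
γ_k^{d_k-1}/∏ℓ(x_{1r}). The partial fractions of this product move it into the first group, where
the condition on γ_k makes the combined numerator divisible by ℓ. If λ is constant, each remaining
group gives an affine function of ∑_r x_{ir}. If b ≠ 0, two divisions by λ leave a constant, a
multiple of 1/∏λ and a multiple of ∑_r∏_{s≠r}λ/(∏λ)². The constant cancels against the middle groups
by the last hypothesis, and the other two, multiplied by h², are momenta
(`exists_pairing_eq_of_constant`, `exists_pairing_eq_of_product`). -/

set_option linter.unusedSectionVars false

noncomputable section

/-! ### Calculus of partial derivatives. -/

namespace Chart

section Calculus

variable {ι : Type} [Fintype ι] [DecidableEq ι]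

theorem pderiv_congr {i : ι} {f g : (ι → ℝ) → ℝ} {x : ι → ℝ} (h : f =ᶠ[nhds x] g) :
    pderiv i f x = pderiv i g x := by
  rw [pderiv, pderiv, h.fderiv_eq]

theorem pderiv_congr_on {U : Set (ι → ℝ)} (hU : IsOpen U) {i : ι} {f g : (ι → ℝ) → ℝ}
    {x : ι → ℝ} (hx : x ∈ U) (h : ∀ y ∈ U, f y = g y) : pderiv i f x = pderiv i g x :=
  pderiv_congr (Filter.eventually_of_mem (hU.mem_nhds hx) h)

theorem pderiv_fun_const (i : ι) (c : ℝ) (x : ι → ℝ) : pderiv i (fun _ => c) x = 0 := by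
  simp [pderiv]

theorem pderiv_fun_add {i : ι} {f g : (ι → ℝ) → ℝ} {x : ι → ℝ} (hf : DifferentiableAt ℝ f x)
    (hg : DifferentiableAt ℝ g x) :
    pderiv i (fun y => f y + g y) x = pderiv i f x + pderiv i g x := by
  simp [pderiv, fderiv_fun_add hf hg]

theorem pderiv_fun_sub {i : ι} {f g : (ι → ℝ) → ℝ} {x : ι → ℝ} (hf : DifferentiableAt ℝ f x)
    (hg : DifferentiableAt ℝ g x) :
    pderiv i (fun y => f y - g y) x = pderiv i f x - pderiv i g x := by
  simp [pderiv, fderiv_fun_sub hf hg]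

theorem pderiv_fun_neg (i : ι) (f : (ι → ℝ) → ℝ) (x : ι → ℝ) :
    pderiv i (fun y => -f y) x = -pderiv i f x := by
  simp [pderiv, fderiv_fun_neg]

theorem pderiv_fun_mul {i : ι} {f g : (ι → ℝ) → ℝ} {x : ι → ℝ} (hf : DifferentiableAt ℝ f x)
    (hg : DifferentiableAt ℝ g x) :
    pderiv i (fun y => f y * g y) x = pderiv i f x * g x + f x * pderiv i g x := by
  simp [pderiv, fderiv_fun_mul hf hg]
  ring

theorem pderiv_fun_const_mul {i : ι} (c : ℝ) {f : (ι → ℝ) → ℝ} {x : ι → ℝ}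
    (hf : DifferentiableAt ℝ f x) :
    pderiv i (fun y => c * f y) x = c * pderiv i f x := by
  simp [pderiv, fderiv_const_mul hf c]

theorem differentiableAt_fun_div {f g : (ι → ℝ) → ℝ} {x : ι → ℝ} (hf : DifferentiableAt ℝ f x)
    (hg : DifferentiableAt ℝ g x) (h0 : g x ≠ 0) : DifferentiableAt ℝ (fun y => f y / g y) x := by
  simpa only [div_eq_mul_inv] using hf.fun_mul (hg.fun_inv h0)

theorem pderiv_fun_div {i : ι} {f g : (ι → ℝ) → ℝ} {x : ι → ℝ} (hf : DifferentiableAt ℝ f x)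
    (hg : DifferentiableAt ℝ g x) (h0 : g x ≠ 0) :
    pderiv i (fun y => f y / g y) x = (pderiv i f x * g x - f x * pderiv i g x) / g x ^ 2 := by
  have h := pderiv_fun_mul (i := i) (differentiableAt_fun_div hf hg h0) hg
  have h1 : pderiv i (fun y => f y / g y * g y) x = pderiv i f x := by
    refine pderiv_congr ?_
    filter_upwards [hg.continuousAt.eventually_ne h0] with y hy
    field_simp
  rw [h1] at h
  rw [h]
  field_simp
  ring

theorem pderiv_fun_sum {κ : Type*} {i : ι} {s : Finset κ} {f : κ → (ι → ℝ) → ℝ} {x : ι → ℝ}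
    (hf : ∀ j ∈ s, DifferentiableAt ℝ (f j) x) :
    pderiv i (fun y => ∑ j ∈ s, f j y) x = ∑ j ∈ s, pderiv i (f j) x := by
  simp [pderiv, fderiv_fun_sum hf]

theorem pderiv_ite (i : ι) (c : Prop) [Decidable c] (f g : (ι → ℝ) → ℝ) (x : ι → ℝ) :
    pderiv i (fun y => if c then f y else g y) x
      = if c then pderiv i f x else pderiv i g x := by
  split_ifs <;> rfl

theorem pderiv_eq_of_hasDerivAt_update {i : ι} {f : (ι → ℝ) → ℝ} {x : ι → ℝ} {c : ℝ}
    (hf : DifferentiableAt ℝ f x)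
    (h : HasDerivAt (fun s => f (Function.update x i s)) c (x i)) : pderiv i f x = c := by
  have h1 : HasDerivAt (fun s => Function.update x i s) (Pi.single i (1 : ℝ)) (x i) :=
    hasDerivAt_update x i (x i)
  have h2 : HasFDerivAt f (fderiv ℝ f x) (Function.update x i (x i)) := by
    rw [Function.update_eq_self]
    exact hf.hasFDerivAt
  exact (h2.comp_hasDerivAt (x i) h1).unique h

theorem pderiv_comp_coord {i : ι} {f : ℝ → ℝ} {f' : ℝ} {x : ι → ℝ} (q : ι)
    (h : HasDerivAt f f' (x q)) :
    pderiv i (fun y => f (y q)) x = if i = q then f' else 0 := by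
  have h1 : HasFDerivAt (fun y : ι → ℝ => y q) (ContinuousLinearMap.proj (R := ℝ) q) x :=
    hasFDerivAt_apply q x
  have h2 := h.comp_hasFDerivAt x h1
  rw [pderiv]
  have h3 : fderiv ℝ (fun y : ι → ℝ => f (y q)) x = _ := h2.fderiv
  rw [h3]
  by_cases hq : i = q
  · subst hq; simp
  · simp [hq, Ne.symm hq]

theorem pderiv_coord (i q : ι) (x : ι → ℝ) :
    pderiv i (fun y => y q) x = if i = q then 1 else 0 :=
  pderiv_comp_coord (f := fun s => s) q (hasDerivAt_id _)

/-- The product rule for the entries of a product of matrices. -/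
theorem pderiv_matrix_mul {κ : Type*} [Fintype κ] {i : ι} {M N : (ι → ℝ) → Matrix κ κ ℝ}
    {M' N' : Matrix κ κ ℝ} {x : ι → ℝ}
    (hM : ∀ a b, DifferentiableAt ℝ (fun y => M y a b) x)
    (hN : ∀ a b, DifferentiableAt ℝ (fun y => N y a b) x)
    (hM' : ∀ a b, pderiv i (fun y => M y a b) x = M' a b)
    (hN' : ∀ a b, pderiv i (fun y => N y a b) x = N' a b) (a b : κ) :
    pderiv i (fun y => (M y * N y) a b) x = (M' * N x + M x * N') a b := by
  simp only [Matrix.mul_apply, Matrix.add_apply, ← Finset.sum_add_distrib]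
  rw [pderiv_fun_sum (fun j _ => (hM a j).fun_mul (hN j b))]
  refine Finset.sum_congr rfl fun j _ => ?_
  rw [pderiv_fun_mul (hM a j) (hN j b), hM', hN']

theorem differentiableAt_matrix_mul {κ : Type*} [Fintype κ] {M N : (ι → ℝ) → Matrix κ κ ℝ}
    {x : ι → ℝ} (hM : ∀ a b, DifferentiableAt ℝ (fun y => M y a b) x)
    (hN : ∀ a b, DifferentiableAt ℝ (fun y => N y a b) x) (a b : κ) :
    DifferentiableAt ℝ (fun y => (M y * N y) a b) x := by
  simp only [Matrix.mul_apply]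
  exact DifferentiableAt.fun_sum fun j _ => (hM a j).fun_mul (hN j b)

end Calculus

section Product

variable {S : Type} [Fintype S] [DecidableEq S]

/-- No differentiability is assumed: `f` is differentiable exactly when its pullback along the
projection is, because the projection has an affine section through `z`. Where neither is, both
sides are the default value 0. -/
theorem pderiv_inl (p : S) (f : (S → ℝ) → ℝ) (z : S ⊕ S → ℝ) :
    pderiv (Sum.inl p) (fun w : S ⊕ S → ℝ => f (fun q => w (Sum.inl q))) z
      = pderiv p f (fun q => z (Sum.inl q)) := by
  set L : (S ⊕ S → ℝ) →L[ℝ] (S → ℝ) :=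
    ContinuousLinearMap.pi fun q => ContinuousLinearMap.proj (R := ℝ) (Sum.inl q) with hL
  by_cases hf : DifferentiableAt ℝ f (L z)
  · have h := hf.hasFDerivAt.comp z L.hasFDerivAt
    have h1 : fderiv ℝ (fun w : S ⊕ S → ℝ => f (fun q => w (Sum.inl q))) z = _ := h.fderiv
    rw [pderiv, h1]
    change fderiv ℝ f (L z) (L (Pi.single (Sum.inl p) 1)) = fderiv ℝ f (L z) (Pi.single p 1)
    congr 1
    ext q
    simp [hL, Pi.single_apply]
  · have h2 : ¬ DifferentiableAt ℝ (fun w : S ⊕ S → ℝ => f (fun q => w (Sum.inl q))) z := by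
      intro hd
      apply hf
      have h3 : DifferentiableAt ℝ
          (fun y : S → ℝ => (Sum.elim y (fun q => z (Sum.inr q)) : S ⊕ S → ℝ)) (L z) := by
        rw [differentiableAt_pi]
        rintro (q | q)
        · exact differentiableAt_apply q _
        · exact differentiableAt_const _
      have hz : (Sum.elim (L z) (fun q => z (Sum.inr q)) : S ⊕ S → ℝ) = z := by
        ext (q | q) <;> rfl
      have h4 := DifferentiableAt.comp (L z) (by rw [hz]; exact hd) h3
      exact h4
    rw [pderiv, pderiv, fderiv_zero_of_not_differentiableAt h2]
    rw [show (fun q => z (Sum.inl q)) = L z from rfl, fderiv_zero_of_not_differentiableAt hf]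
    simp

theorem pderiv_inr (p : S) (f : (S → ℝ) → ℝ) (z : S ⊕ S → ℝ) :
    pderiv (Sum.inr p) (fun w : S ⊕ S → ℝ => f (fun q => w (Sum.inl q))) z = 0 := by
  by_cases hf : DifferentiableAt ℝ (fun w : S ⊕ S → ℝ => f (fun q => w (Sum.inl q))) z
  · refine pderiv_eq_of_hasDerivAt_update hf ?_
    simpa using hasDerivAt_const (z (Sum.inr p)) (f fun q => z (Sum.inl q))
  · rw [pderiv, fderiv_zero_of_not_differentiableAt hf]
    simp

end Product

end Chart

/-! ### Christoffel symbols of block metrics independent of the fibre coordinates. -/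

namespace Chart

section Block

variable {S : Type} [Fintype S] [DecidableEq S]

/-- A metric on `S ⊕ S → ℝ` depending only on the first half of the coordinates, diagonal in
that half and with no mixed terms. -/
def blockMetric (e : S → (S → ℝ) → ℝ) (h : (S → ℝ) → Matrix S S ℝ) (z : S ⊕ S → ℝ) :
    Matrix (S ⊕ S) (S ⊕ S) ℝ :=
  Matrix.fromBlocks (Matrix.diagonal fun p => e p fun q => z (Sum.inl q)) 0 0
    (h fun q => z (Sum.inl q))

variable (e : S → (S → ℝ) → ℝ) (h : (S → ℝ) → Matrix S S ℝ)

theorem blockMetric_inv {z : S ⊕ S → ℝ} {k : Matrix S S ℝ}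
    (he : ∀ p, e p (fun q => z (Sum.inl q)) ≠ 0) (hk : h (fun q => z (Sum.inl q)) * k = 1) :
    (blockMetric e h z)⁻¹
      = Matrix.fromBlocks (Matrix.diagonal fun p => (e p fun q => z (Sum.inl q))⁻¹) 0 0 k := by
  apply Matrix.inv_eq_right_inv
  rw [blockMetric, Matrix.fromBlocks_multiply]
  simp [hk, Matrix.diagonal_mul_diagonal, he]

theorem pderiv_blockMetric (i j k : S ⊕ S) (z : S ⊕ S → ℝ) :
    pderiv i (fun w => blockMetric e h w j k) z =
      Sum.elim
        (fun i => Sum.elim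
          (fun j => Sum.elim
            (fun k => if j = k then pderiv i (e j) (fun q => z (Sum.inl q)) else 0)
            (fun _ => 0) k)
          (fun j => Sum.elim (fun _ => 0)
            (fun k => pderiv i (fun y => h y j k) (fun q => z (Sum.inl q))) k) j)
        (fun _ => 0) i := by
  rcases i with i | i <;> rcases j with j | j <;> rcases k with k | k <;>
    simp only [blockMetric, Matrix.fromBlocks_apply₁₁, Matrix.fromBlocks_apply₁₂,
      Matrix.fromBlocks_apply₂₁, Matrix.fromBlocks_apply₂₂, Matrix.zero_apply, Sum.elim_inl,
      Sum.elim_inr, pderiv_fun_const, Matrix.diagonal_apply, pderiv_ite]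
  · rw [pderiv_inl i (e j)]
  · rw [pderiv_inl i (fun y => h y j k)]
  · rw [pderiv_inr i (e j), ite_self]
  · rw [pderiv_inr i (fun y => h y j k)]

section Christoffel

variable {e h} {z : S ⊕ S → ℝ} {k : Matrix S S ℝ}
  (he : ∀ p, e p (fun q => z (Sum.inl q)) ≠ 0) (hk : h (fun q => z (Sum.inl q)) * k = 1)

include he hk

/-- The three letters of each name give the type of the upper index and of the two lower ones (`l`
base, `r` fibre). The metric is invariant under t ↦ -t, so the symbols with an odd number of fibre
indices vanish. -/
theorem christoffel_lll (a i j : S) :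
    christoffel (blockMetric e h) (Sum.inl a) (Sum.inl i) (Sum.inl j) z =
      (1 / 2) * ((e a fun q => z (Sum.inl q))⁻¹ *
        ((if j = a then pderiv i (e j) (fun q => z (Sum.inl q)) else 0)
          + (if i = a then pderiv j (e i) (fun q => z (Sum.inl q)) else 0)
          - (if i = j then pderiv a (e i) (fun q => z (Sum.inl q)) else 0))) := by
  rw [christoffel, blockMetric_inv e h he hk]
  simp [pderiv_blockMetric, Fintype.sum_sum_type, Matrix.diagonal_apply]

theorem christoffel_lrr (a i j : S) :
    christoffel (blockMetric e h) (Sum.inl a) (Sum.inr i) (Sum.inr j) z =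
      (1 / 2) * ((e a fun q => z (Sum.inl q))⁻¹ *
        (-pderiv a (fun y => h y i j) (fun q => z (Sum.inl q)))) := by
  rw [christoffel, blockMetric_inv e h he hk]
  simp [pderiv_blockMetric, Fintype.sum_sum_type, Matrix.diagonal_apply]

theorem christoffel_rlr (a i j : S) :
    christoffel (blockMetric e h) (Sum.inr a) (Sum.inl i) (Sum.inr j) z =
      (1 / 2) * ∑ l, k a l * pderiv i (fun y => h y j l) (fun q => z (Sum.inl q)) := by
  rw [christoffel, blockMetric_inv e h he hk]
  simp [pderiv_blockMetric, Fintype.sum_sum_type]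

theorem christoffel_rrl (a i j : S) :
    christoffel (blockMetric e h) (Sum.inr a) (Sum.inr j) (Sum.inl i) z =
      (1 / 2) * ∑ l, k a l * pderiv i (fun y => h y j l) (fun q => z (Sum.inl q)) := by
  rw [christoffel, blockMetric_inv e h he hk]
  simp [pderiv_blockMetric, Fintype.sum_sum_type]

theorem christoffel_llr (a i j : S) :
    christoffel (blockMetric e h) (Sum.inl a) (Sum.inl i) (Sum.inr j) z = 0 := by
  rw [christoffel, blockMetric_inv e h he hk]
  simp [pderiv_blockMetric, Fintype.sum_sum_type]

theorem christoffel_lrl (a i j : S) :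
    christoffel (blockMetric e h) (Sum.inl a) (Sum.inr i) (Sum.inl j) z = 0 := by
  rw [christoffel, blockMetric_inv e h he hk]
  simp [pderiv_blockMetric, Fintype.sum_sum_type]

theorem christoffel_rll (a i j : S) :
    christoffel (blockMetric e h) (Sum.inr a) (Sum.inl i) (Sum.inl j) z = 0 := by
  rw [christoffel, blockMetric_inv e h he hk]
  simp [pderiv_blockMetric, Fintype.sum_sum_type]

theorem christoffel_rrr (a i j : S) :
    christoffel (blockMetric e h) (Sum.inr a) (Sum.inr i) (Sum.inr j) z = 0 := by
  rw [christoffel, blockMetric_inv e h he hk]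
  simp [pderiv_blockMetric, Fintype.sum_sum_type]

end Christoffel

end Block

end Chart

/-! ### Ricci and scalar curvature of block metrics. -/

namespace Chart

section BlockRicci

variable {S : Type} [Fintype S] [DecidableEq S]

/-- The Christoffel symbols of the diagonal block of `blockMetric e h`. -/
def baseSymbol (e : S → (S → ℝ) → ℝ) (a i j : S) (x : S → ℝ) : ℝ :=
  (1 / 2) * ((e a x)⁻¹ * ((if j = a then pderiv i (e j) x else 0)
    + (if i = a then pderiv j (e i) x else 0) - (if i = j then pderiv a (e i) x else 0)))

/-- The mixed Christoffel symbols of `blockMetric e h` with an upper base index. -/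
def vertSymbol (e : S → (S → ℝ) → ℝ) (h : (S → ℝ) → Matrix S S ℝ) (a i j : S) (x : S → ℝ) : ℝ :=
  (1 / 2) * ((e a x)⁻¹ * (-pderiv a (fun y => h y i j) x))

/-- The mixed Christoffel symbols of `blockMetric e h` with an upper fibre index, where `k`
is the inverse of `h`. -/
def mixSymbol (h k : (S → ℝ) → Matrix S S ℝ) (a i j : S) (x : S → ℝ) : ℝ :=
  (1 / 2) * ∑ l, k x a l * pderiv i (fun y => h y j l) x

/-- The derivative of the logarithm of the volume density of `blockMetric e h`. -/
def traceSymbol (e : S → (S → ℝ) → ℝ) (h k : (S → ℝ) → Matrix S S ℝ) (q : S) (x : S → ℝ) : ℝ :=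
  ∑ r, baseSymbol e r r q x + ∑ b, mixSymbol h k b q b x

variable {e : S → (S → ℝ) → ℝ} {h k : (S → ℝ) → Matrix S S ℝ} {U : Set (S → ℝ)}

theorem isOpen_preimage_base (hU : IsOpen U) :
    IsOpen {z : S ⊕ S → ℝ | (fun q => z (Sum.inl q)) ∈ U} :=
  hU.preimage (continuous_pi fun q => continuous_apply (Sum.inl q))

theorem pderiv_inl_congr (hU : IsOpen U) {f : (S ⊕ S → ℝ) → ℝ} {F : (S → ℝ) → ℝ}
    (hf : ∀ w : S ⊕ S → ℝ, (fun q => w (Sum.inl q)) ∈ U → f w = F fun q => w (Sum.inl q))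
    {z : S ⊕ S → ℝ} (hz : (fun q => z (Sum.inl q)) ∈ U) (p : S) :
    pderiv (Sum.inl p) f z = pderiv p F fun q => z (Sum.inl q) := by
  rw [← pderiv_inl]
  exact pderiv_congr_on (isOpen_preimage_base hU) hz hf

theorem pderiv_inr_congr (hU : IsOpen U) {f : (S ⊕ S → ℝ) → ℝ} {F : (S → ℝ) → ℝ}
    (hf : ∀ w : S ⊕ S → ℝ, (fun q => w (Sum.inl q)) ∈ U → f w = F fun q => w (Sum.inl q))
    {z : S ⊕ S → ℝ} (hz : (fun q => z (Sum.inl q)) ∈ U) (p : S) :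
    pderiv (Sum.inr p) f z = 0 := by
  rw [← pderiv_inr p F z]
  exact pderiv_congr_on (isOpen_preimage_base hU) hz hf

variable (hU : IsOpen U) (he : ∀ x ∈ U, ∀ p, e p x ≠ 0) (hk : ∀ x ∈ U, h x * k x = 1)

include hU he hk

/-- Only the diagonal entries of the base block are needed, since the base metric is diagonal and
the scalar curvature is a trace. -/
theorem ricci_blockMetric_ll {z : S ⊕ S → ℝ} {x : S → ℝ} (hz : (fun q => z (Sum.inl q)) = x)
    (hx : x ∈ U) (p : S) :
    ricci (blockMetric e h) (Sum.inl p) (Sum.inl p) z =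
      ∑ q, pderiv q (baseSymbol e q p p) x - ∑ q, pderiv p (baseSymbol e q q p) x
      - ∑ a, pderiv p (mixSymbol h k a p a) x
      + ∑ q, traceSymbol e h k q x * baseSymbol e q p p x
      - ∑ q, ∑ r, baseSymbol e q p r x * baseSymbol e r q p x
      - ∑ a, ∑ c, mixSymbol h k a p c x * mixSymbol h k c p a x := by
  subst hz
  -- Symbols that are going to be differentiated must be known on the whole open set, not only at
  -- `z`.
  have e1 : ∀ a i j : S, ∀ w : S ⊕ S → ℝ, (fun q => w (Sum.inl q)) ∈ U →
      christoffel (blockMetric e h) (Sum.inl a) (Sum.inl i) (Sum.inl j) w =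
        baseSymbol e a i j fun q => w (Sum.inl q) :=
    fun a i j w hw => christoffel_lll (he _ hw) (hk _ hw) a i j
  have e2 : ∀ a i j : S, ∀ w : S ⊕ S → ℝ, (fun q => w (Sum.inl q)) ∈ U →
      christoffel (blockMetric e h) (Sum.inr a) (Sum.inl i) (Sum.inr j) w =
        mixSymbol h k a i j fun q => w (Sum.inl q) :=
    fun a i j w hw => christoffel_rlr (he _ hw) (hk _ hw) a i j
  have e3 : ∀ a i j : S, ∀ w : S ⊕ S → ℝ, (fun q => w (Sum.inl q)) ∈ U →
      christoffel (blockMetric e h) (Sum.inr a) (Sum.inr j) (Sum.inl i) w =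
        mixSymbol h k a i j fun q => w (Sum.inl q) :=
    fun a i j w hw => christoffel_rrl (he _ hw) (hk _ hw) a i j
  have e4 : ∀ a i j : S, ∀ w : S ⊕ S → ℝ, (fun q => w (Sum.inl q)) ∈ U →
      christoffel (blockMetric e h) (Sum.inr a) (Sum.inl i) (Sum.inl j) w =
        0 :=
    fun a i j w hw => christoffel_rll (he _ hw) (hk _ hw) a i j
  have h5 : ∀ a i j, christoffel (blockMetric e h) (Sum.inl a) (Sum.inl i) (Sum.inr j) z = 0 :=
    christoffel_llr (he _ hx) (hk _ hx)
  have h6 : ∀ a i j, christoffel (blockMetric e h) (Sum.inl a) (Sum.inr i) (Sum.inl j) z = 0 :=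
    christoffel_lrl (he _ hx) (hk _ hx)
  have h9 : ∀ i j, pderiv (Sum.inr j)
      (christoffel (blockMetric e h) (Sum.inr i) (Sum.inl p) (Sum.inl p)) z = 0 :=
    fun i j => pderiv_inr_congr hU (F := fun _ => 0) (e4 i p p) hx j
  simp only [ricci, Fintype.sum_sum_type, pderiv_inl_congr hU (e1 _ _ _) hx,
    pderiv_inl_congr hU (e3 _ _ _) hx, h9, e1 _ _ _ z hx,
    e2 _ _ _ z hx, e3 _ _ _ z hx, e4 _ _ _ z hx, h5, h6, traceSymbol, add_mul, Finset.sum_mul,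
    Finset.sum_add_distrib, Finset.sum_sub_distrib, mul_zero, Finset.sum_const_zero,
    add_zero, zero_add]
  rw [Finset.sum_comm (f := fun q r => baseSymbol e r r q _ * baseSymbol e q p p _),
    Finset.sum_comm (f := fun q r => mixSymbol h k r q r _ * baseSymbol e q p p _)]
  ring

theorem ricci_blockMetric_rr {z : S ⊕ S → ℝ} {x : S → ℝ} (hz : (fun q => z (Sum.inl q)) = x)
    (hx : x ∈ U) (a c : S) :
    ricci (blockMetric e h) (Sum.inr a) (Sum.inr c) z =
      ∑ q, (pderiv q (vertSymbol e h q a c) x + traceSymbol e h k q x * vertSymbol e h q a c x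
        - ∑ b, vertSymbol e h q a b x * mixSymbol h k b q c x
        - ∑ b, mixSymbol h k b q a x * vertSymbol e h q b c x) := by
  subst hz
  have e1 : ∀ a i j : S, ∀ w : S ⊕ S → ℝ, (fun q => w (Sum.inl q)) ∈ U →
      christoffel (blockMetric e h) (Sum.inl a) (Sum.inr i) (Sum.inr j) w =
        vertSymbol e h a i j fun q => w (Sum.inl q) :=
    fun a i j w hw => christoffel_lrr (he _ hw) (hk _ hw) a i j
  have e3 : ∀ a i j : S, ∀ w : S ⊕ S → ℝ, (fun q => w (Sum.inl q)) ∈ U →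
      christoffel (blockMetric e h) (Sum.inr a) (Sum.inr j) (Sum.inl i) w =
        mixSymbol h k a i j fun q => w (Sum.inl q) :=
    fun a i j w hw => christoffel_rrl (he _ hw) (hk _ hw) a i j
  have e4 : ∀ a i j : S, ∀ w : S ⊕ S → ℝ, (fun q => w (Sum.inl q)) ∈ U →
      christoffel (blockMetric e h) (Sum.inl a) (Sum.inl i) (Sum.inr j) w =
        0 :=
    fun a i j w hw => christoffel_llr (he _ hw) (hk _ hw) a i j
  have e7 : ∀ a i j : S, ∀ w : S ⊕ S → ℝ, (fun q => w (Sum.inl q)) ∈ U →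
      christoffel (blockMetric e h) (Sum.inr a) (Sum.inr i) (Sum.inr j) w =
        0 :=
    fun a i j w hw => christoffel_rrr (he _ hw) (hk _ hw) a i j
  have h2 : ∀ a i j, christoffel (blockMetric e h) (Sum.inr a) (Sum.inl i) (Sum.inr j) z =
      mixSymbol h k a i j fun q => z (Sum.inl q) :=
    christoffel_rlr (he _ hx) (hk _ hx)
  have h6 : ∀ a i j, christoffel (blockMetric e h) (Sum.inl a) (Sum.inl i) (Sum.inl j) z =
      baseSymbol e a i j fun q => z (Sum.inl q) :=
    christoffel_lll (he _ hx) (hk _ hx)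
  have h8 : ∀ a i j, christoffel (blockMetric e h) (Sum.inl a) (Sum.inr i) (Sum.inl j) z = 0 :=
    christoffel_lrl (he _ hx) (hk _ hx)
  have h9 : ∀ i j, pderiv (Sum.inr j)
      (christoffel (blockMetric e h) (Sum.inl i) (Sum.inl i) (Sum.inr c)) z = 0 :=
    fun i j => pderiv_inr_congr hU (F := fun _ => 0) (e4 i i c) hx j
  have h10 : ∀ i b j, pderiv (Sum.inr j)
      (christoffel (blockMetric e h) (Sum.inr i) (Sum.inr b) (Sum.inr c)) z = 0 :=
    fun i b j => pderiv_inr_congr hU (F := fun _ => 0) (e7 i b c) hx j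
  simp only [ricci, Fintype.sum_sum_type, pderiv_inl_congr hU (e1 _ _ _) hx, h9, h10,
    e1 _ _ _ z hx, h2, e3 _ _ _ z hx, e4 _ _ _ z hx, h6, h8, e7 _ _ _ z hx, traceSymbol,
    add_mul, Finset.sum_mul,
    Finset.sum_add_distrib, Finset.sum_sub_distrib, mul_zero, Finset.sum_const_zero,
    add_zero, zero_add, sub_zero]
  rw [Finset.sum_comm (f := fun q r => baseSymbol e r r q _ * vertSymbol e h q a c _),
    Finset.sum_comm (f := fun q r => mixSymbol h k r q r _ * vertSymbol e h q a c _),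
    Finset.sum_comm (f := fun q b => mixSymbol h k b q a _ * vertSymbol e h q b c _)]
  ring

theorem scalarCurvature_blockMetric {z : S ⊕ S → ℝ} {x : S → ℝ}
    (hz : (fun q => z (Sum.inl q)) = x) (hx : x ∈ U) :
    scalarCurvature (blockMetric e h) z =
      ∑ p, (e p x)⁻¹ * ricci (blockMetric e h) (Sum.inl p) (Sum.inl p) z
      + ∑ a, ∑ c, k x a c * ricci (blockMetric e h) (Sum.inr a) (Sum.inr c) z := by
  subst hz
  rw [scalarCurvature, blockMetric_inv e h (he _ hx) (hk _ hx)]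
  simp [Fintype.sum_sum_type, Matrix.diagonal_apply]

end BlockRicci

end Chart

/-! ### Structure equations of separable Kähler metrics. -/

namespace Chart

section Separable

open scoped Matrix

variable {S : Type} [Fintype S] [DecidableEq S]

/-- The structure equations of a separable Kähler metric
`∑ P_p⁻¹ dx_p² + ∑ P_p (∑ D_pa dt_a)²`: `D` has inverse `E`, `u q p` is the logarithmic derivative
of `P q` in the direction `p` and `b p` that of the conformal factor. -/
structure IsSeparable (U : Set (S → ℝ)) (P : S → (S → ℝ) → ℝ) (D E : (S → ℝ) → Matrix S S ℝ)
    (u : S → S → (S → ℝ) → ℝ) (b : S → (S → ℝ) → ℝ) : Prop where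
  isOpen : IsOpen U
  ne_zero : ∀ x ∈ U, ∀ q, P q x ≠ 0
  diff_P : ∀ x ∈ U, ∀ q, DifferentiableAt ℝ (P q) x
  diff_D : ∀ x ∈ U, ∀ q a, DifferentiableAt ℝ (fun y => D y q a) x
  diff_E : ∀ x ∈ U, ∀ a q, DifferentiableAt ℝ (fun y => E y a q) x
  diff_u : ∀ x ∈ U, ∀ q p, DifferentiableAt ℝ (u q p) x
  diff_b : ∀ x ∈ U, ∀ p, DifferentiableAt ℝ (b p) x
  mul_eq_one : ∀ x ∈ U, D x * E x = 1
  pderiv_P : ∀ x ∈ U, ∀ p q, pderiv p (P q) x = P q x * u q p x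
  -- The two equations for `D` are what the system for the functions ⟨μ,v⟩ becomes for the gradients
  -- of ⟨μ,v⟩/⟨μ,β⟩: the mixed derivatives give the first, affineness in each coordinate the second.
  -- The Riccati equations for `u` and `b` have the same origin.
  pderiv_D_of_ne : ∀ x ∈ U, ∀ p q a, q ≠ p →
    pderiv p (fun y => D y q a) x = -u q p x * D x q a - u p q x * D x p a
  pderiv_D_self : ∀ x ∈ U, ∀ p a, pderiv p (fun y => D y p a) x = -2 * b p x * D x p a
  pderiv_u : ∀ x ∈ U, ∀ p q, q ≠ p → pderiv p (u q p) x = u q p x ^ 2 - 2 * u q p x * b p x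
  pderiv_b : ∀ x ∈ U, ∀ p, pderiv p (b p) x = -b p x ^ 2

/-- The matrix `K` with `∂_p D = K D`. -/
def connMatrix (u : S → S → (S → ℝ) → ℝ) (b : S → (S → ℝ) → ℝ) (p : S) (x : S → ℝ) :
    Matrix S S ℝ :=
  Matrix.of fun q r => -(if q = r then u q p x else 0) - (if r = p then u p q x else 0)
    + (if q = p ∧ r = p then 2 * (u p p x - b p x) else 0)

/-- The matrix `X` with `∂_p (Dᵀ P D) = Dᵀ X D`. -/
def strainMatrix (P : S → (S → ℝ) → ℝ) (u : S → S → (S → ℝ) → ℝ) (b : S → (S → ℝ) → ℝ) (p : S)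
    (x : S → ℝ) : Matrix S S ℝ :=
  (connMatrix u b p x)ᵀ * Matrix.diagonal (fun q => P q x)
    + Matrix.diagonal (fun q => P q x * u q p x)
    + Matrix.diagonal (fun q => P q x) * connMatrix u b p x

/-- The fibre part `Dᵀ P D` of the metric. -/
def fibreMetric (P : S → (S → ℝ) → ℝ) (D : (S → ℝ) → Matrix S S ℝ) (x : S → ℝ) : Matrix S S ℝ :=
  (D x)ᵀ * Matrix.diagonal (fun q => P q x) * D x

/-- The inverse `E P⁻¹ Eᵀ` of the fibre part of the metric. -/
def fibreInverse (P : S → (S → ℝ) → ℝ) (E : (S → ℝ) → Matrix S S ℝ) (x : S → ℝ) : Matrix S S ℝ :=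
  E x * Matrix.diagonal (fun q => (P q x)⁻¹) * (E x)ᵀ

/-- The logarithmic derivative of the determinant of the fibre part of the metric. -/
def logDetDeriv (u : S → S → (S → ℝ) → ℝ) (b : S → (S → ℝ) → ℝ) (p : S) (x : S → ℝ) : ℝ :=
  2 * u p p x - ∑ q, u q p x - 4 * b p x

theorem strainMatrix_apply (P : S → (S → ℝ) → ℝ) (u : S → S → (S → ℝ) → ℝ) (b : S → (S → ℝ) → ℝ)
    (p : S) (x : S → ℝ) (q r : S) : strainMatrix P u b p x q r =
      connMatrix u b p x r q * P r x + (if q = r then P q x * u q p x else 0)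
      + P q x * connMatrix u b p x q r := by
  simp [strainMatrix, Matrix.diagonal_apply]

theorem strainMatrix_transpose (P : S → (S → ℝ) → ℝ) (u : S → S → (S → ℝ) → ℝ)
    (b : S → (S → ℝ) → ℝ) (p : S) (x : S → ℝ) :
    (strainMatrix P u b p x)ᵀ = strainMatrix P u b p x := by
  simp only [strainMatrix, Matrix.transpose_add, Matrix.transpose_mul, Matrix.transpose_transpose,
    Matrix.diagonal_transpose]
  abel

theorem sum_connMatrix (u : S → S → (S → ℝ) → ℝ) (b : S → (S → ℝ) → ℝ)
    (p : S) (x : S → ℝ) :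
    ∑ q, (2 * connMatrix u b p x q q + u q p x) = logDetDeriv u b p x := by
  simp only [connMatrix, Matrix.of_apply, if_true, and_self, logDetDeriv]
  rw [Finset.sum_add_distrib, ← Finset.mul_sum, Finset.sum_add_distrib, Finset.sum_sub_distrib]
  simp
  ring

variable {U : Set (S → ℝ)} {P : S → (S → ℝ) → ℝ} {D E : (S → ℝ) → Matrix S S ℝ}
  {u : S → S → (S → ℝ) → ℝ} {b : S → (S → ℝ) → ℝ}

namespace IsSeparable

theorem diff_connMatrix (H : IsSeparable U P D E u b) {x : S → ℝ} (hx : x ∈ U) (p q r : S) :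
    DifferentiableAt ℝ (fun y => connMatrix u b p y q r) x := by
  have h1 := H.diff_u x hx
  have h2 := H.diff_b x hx
  simp only [connMatrix, Matrix.of_apply]
  split_ifs <;> fun_prop

theorem diff_strainMatrix (H : IsSeparable U P D E u b) {x : S → ℝ} (hx : x ∈ U) (p q r : S) :
    DifferentiableAt ℝ (fun y => strainMatrix P u b p y q r) x := by
  have h1 := H.diff_u x hx
  have h2 := H.diff_P x hx
  have h3 := fun p q r => H.diff_connMatrix hx p q r
  simp only [strainMatrix_apply]
  split_ifs <;> fun_prop

theorem diff_logDetDeriv (H : IsSeparable U P D E u b) {x : S → ℝ} (hx : x ∈ U) (p : S) :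
    DifferentiableAt ℝ (logDetDeriv u b p) x := by
  have h1 := H.diff_u x hx
  have h2 := H.diff_b x hx
  unfold logDetDeriv
  fun_prop

/-- The last summand of `connMatrix` corrects the entry (p, p): the off-diagonal rule would give -2
u_pp there, whereas the diagonal equation demands -2 b_p. -/
theorem pderiv_D (H : IsSeparable U P D E u b) {x : S → ℝ} (hx : x ∈ U) (p q a : S) :
    pderiv p (fun y => D y q a) x = (connMatrix u b p x * D x) q a := by
  have h : (connMatrix u b p x * D x) q a = -u q p x * D x q a - u p q x * D x p a
      + if q = p then 2 * (u p p x - b p x) * D x p a else 0 := by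
    simp only [Matrix.mul_apply, connMatrix, Matrix.of_apply, add_mul, sub_mul, neg_mul,
      Finset.sum_add_distrib, Finset.sum_sub_distrib, Finset.sum_neg_distrib, ite_mul, zero_mul]
    by_cases hq : q = p <;> simp [hq]
  rw [h]
  by_cases hq : q = p
  · subst hq
    rw [H.pderiv_D_self x hx, if_pos rfl]
    ring
  · rw [H.pderiv_D_of_ne x hx p q a hq, if_neg hq, add_zero]

/-- Because ∂_p D = K D, the form Dᵀ Y D is stable under differentiation. All derivatives of the
fibre metric stay of this form, and `D` itself never has to be known explicitly. -/
theorem pderiv_conj (H : IsSeparable U P D E u b) {x : S → ℝ} (hx : x ∈ U) (p : S)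
    {Y : (S → ℝ) → Matrix S S ℝ} {Y' : Matrix S S ℝ}
    (hY : ∀ q r, DifferentiableAt ℝ (fun y => Y y q r) x)
    (hY' : ∀ q r, pderiv p (fun y => Y y q r) x = Y' q r) (a c : S) :
    pderiv p (fun y => ((D y)ᵀ * Y y * D y) a c) x =
      ((D x)ᵀ * ((connMatrix u b p x)ᵀ * Y x + Y' + Y x * connMatrix u b p x) * D x) a c := by
  have hDT : ∀ a q, DifferentiableAt ℝ (fun y => (D y)ᵀ a q) x := fun a q => H.diff_D x hx q a
  have hDT' : ∀ a q, pderiv p (fun y => (D y)ᵀ a q) x = (connMatrix u b p x * D x)ᵀ a q :=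
    fun a q => H.pderiv_D hx p q a
  have h1 := pderiv_matrix_mul (i := p) hDT hY hDT' hY'
  rw [pderiv_matrix_mul (M := fun y => (D y)ᵀ * Y y) (differentiableAt_matrix_mul hDT hY)
    (H.diff_D x hx) h1 (H.pderiv_D hx p)]
  simp only [Matrix.transpose_mul]
  noncomm_ring

theorem diff_conj (H : IsSeparable U P D E u b) {x : S → ℝ} (hx : x ∈ U)
    {Y : (S → ℝ) → Matrix S S ℝ}
    (hY : ∀ q r, DifferentiableAt ℝ (fun y => Y y q r) x) (a c : S) :
    DifferentiableAt ℝ (fun y => ((D y)ᵀ * Y y * D y) a c) x :=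
  differentiableAt_matrix_mul (M := fun y => (D y)ᵀ * Y y)
    (differentiableAt_matrix_mul (fun a q => H.diff_D x hx q a) hY) (H.diff_D x hx) a c

theorem pderiv_fibreMetric (H : IsSeparable U P D E u b) {x : S → ℝ} (hx : x ∈ U) (p a c : S) :
    pderiv p (fun y => fibreMetric P D y a c) x =
      ((D x)ᵀ * strainMatrix P u b p x * D x) a c := by
  have h2 := H.diff_P x hx
  simp only [fibreMetric]
  rw [H.pderiv_conj hx p (Y := fun y => Matrix.diagonal fun q => P q y)
    (Y' := Matrix.diagonal (fun q => P q x * u q p x)), strainMatrix]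
  · intro q r
    simp only [Matrix.diagonal_apply]
    split_ifs <;> fun_prop
  · intro q r
    simp only [Matrix.diagonal_apply, pderiv_ite, pderiv_fun_const]
    rw [← H.pderiv_P x hx]

theorem fibreMetric_mul_fibreInverse (H : IsSeparable U P D E u b) {x : S → ℝ} (hx : x ∈ U) :
    fibreMetric P D x * fibreInverse P E x = 1 := by
  have h1 := H.mul_eq_one x hx
  have h2 : (D x)ᵀ * (E x)ᵀ = 1 := by
    rw [← Matrix.transpose_mul, mul_eq_one_comm.1 h1, Matrix.transpose_one]
  have h3 : Matrix.diagonal (fun q => P q x) * Matrix.diagonal (fun q => (P q x)⁻¹) = 1 := by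
    rw [Matrix.diagonal_mul_diagonal, ← Matrix.diagonal_one]
    congr 1
    funext q
    exact mul_inv_cancel₀ (H.ne_zero x hx q)
  calc fibreMetric P D x * fibreInverse P E x
      = (D x)ᵀ * (Matrix.diagonal (fun q => P q x) * ((D x * E x)
        * Matrix.diagonal (fun q => (P q x)⁻¹))) * (E x)ᵀ := by
        simp only [fibreMetric, fibreInverse, Matrix.mul_assoc]
    _ = 1 := by rw [h1, Matrix.one_mul, h3, Matrix.mul_one, h2]

/-- In a trace against the inverse metric `D` and `E` cancel, so fibre traces do not depend on the
basis of 𝔱. -/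
theorem sum_fibreInverse_conj (H : IsSeparable U P D E u b) {x : S → ℝ} (hx : x ∈ U)
    (Y : Matrix S S ℝ) :
    ∑ a, ∑ c, fibreInverse P E x a c * ((D x)ᵀ * Y * D x) a c = ∑ q, Y q q / P q x := by
  have h1 := H.mul_eq_one x hx
  have h2 : (E x)ᵀ * (D x)ᵀ = 1 := by rw [← Matrix.transpose_mul, h1, Matrix.transpose_one]
  calc ∑ a, ∑ c, fibreInverse P E x a c * ((D x)ᵀ * Y * D x) a c
      = (fibreInverse P E x * ((D x)ᵀ * Y * D x)ᵀ).trace := by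
        simp only [Matrix.trace, Matrix.diag_apply, Matrix.mul_apply (M := fibreInverse P E x),
          Matrix.transpose_apply]
    _ = (E x * (Matrix.diagonal (fun q => (P q x)⁻¹) * (((E x)ᵀ * (D x)ᵀ) * (Yᵀ * D x)))).trace := by
        simp only [fibreInverse, Matrix.transpose_mul, Matrix.transpose_transpose, Matrix.mul_assoc]
    _ = (Matrix.diagonal (fun q => (P q x)⁻¹) * Yᵀ * (D x * E x)).trace := by
        rw [h2, Matrix.one_mul, Matrix.trace_mul_comm]
        simp only [Matrix.mul_assoc]
    _ = ∑ q, Y q q / P q x := by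
        rw [h1, Matrix.mul_one]
        simp [Matrix.trace, div_eq_inv_mul]

/-- Jacobi's formula ∂ log det = tr (h⁻¹ ∂h) for the fibre metric h; this justifies the name
`logDetDeriv`. -/
theorem sum_strainMatrix_div (H : IsSeparable U P D E u b) {x : S → ℝ} (hx : x ∈ U) (p : S) :
    ∑ q, strainMatrix P u b p x q q / P q x = logDetDeriv u b p x := by
  rw [← sum_connMatrix]
  refine Finset.sum_congr rfl fun q _ => ?_
  have := H.ne_zero x hx q
  rw [strainMatrix_apply, if_pos rfl]
  field_simp
  ring

end IsSeparable

end Separable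

end Chart

/-! ### Christoffel symbols and their traces for separable metrics. -/

namespace Chart

section SeparableCurvature

open scoped Matrix

variable {S : Type} [Fintype S] [DecidableEq S]
variable {U : Set (S → ℝ)} {P : S → (S → ℝ) → ℝ} {D E : (S → ℝ) → Matrix S S ℝ}
  {u : S → S → (S → ℝ) → ℝ} {b : S → (S → ℝ) → ℝ}

namespace IsSeparable

theorem baseSymbol_eq (H : IsSeparable U P D E u b) {x : S → ℝ} (hx : x ∈ U) (a i j : S) :
    baseSymbol (fun q y => (P q y)⁻¹) a i j x =
      (if i = j then P a x * u i a x / P i x else 0) / 2 - (if j = a then u a i x else 0) / 2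
        - (if i = a then u a j x else 0) / 2 := by
  have h1 : ∀ i q, pderiv i (fun y => (P q y)⁻¹) x = -(u q i x / P q x) := by
    intro i q
    have h0 := H.ne_zero x hx q
    have h := pderiv_fun_div (i := i) (differentiableAt_const (1 : ℝ)) (H.diff_P x hx q) h0
    simp only [one_div, pderiv_fun_const, H.pderiv_P x hx] at h
    rw [h]
    field_simp
    ring
  simp only [baseSymbol, h1, inv_inv]
  have ha := H.ne_zero x hx a
  split_ifs <;> subst_vars <;> field_simp <;> ring

theorem vertSymbol_eq (H : IsSeparable U P D E u b) {x : S → ℝ} (hx : x ∈ U) (q a c : S) :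
    vertSymbol (fun q y => (P q y)⁻¹) (fibreMetric P D) q a c x =
      -(1 / 2) * (P q x * ((D x)ᵀ * strainMatrix P u b q x * D x) a c) := by
  rw [vertSymbol, H.pderiv_fibreMetric hx, inv_inv]
  ring

theorem mixSymbol_eq (H : IsSeparable U P D E u b) {x : S → ℝ} (hx : x ∈ U) (a i j : S) :
    mixSymbol (fibreMetric P D) (fibreInverse P E) a i j x =
      ((1 / 2 : ℝ) • (E x * Matrix.diagonal (fun q => (P q x)⁻¹) * strainMatrix P u b i x * D x))
        a j := by
  have h1 := H.mul_eq_one x hx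
  have h2 : (E x)ᵀ * (D x)ᵀ = 1 := by rw [← Matrix.transpose_mul, h1, Matrix.transpose_one]
  have h3 : fibreInverse P E x * ((D x)ᵀ * strainMatrix P u b i x * D x)ᵀ
      = E x * Matrix.diagonal (fun q => (P q x)⁻¹) * strainMatrix P u b i x * D x := by
    calc _ = E x * (Matrix.diagonal (fun q => (P q x)⁻¹) *
          (((E x)ᵀ * (D x)ᵀ) * ((strainMatrix P u b i x)ᵀ * D x))) := by
          simp only [fibreInverse, Matrix.transpose_mul, Matrix.transpose_transpose,
            Matrix.mul_assoc]
      _ = _ := by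
          rw [h2, Matrix.one_mul, strainMatrix_transpose]
          simp only [Matrix.mul_assoc]
  rw [← h3, mixSymbol]
  simp only [H.pderiv_fibreMetric hx, Matrix.smul_apply, Matrix.mul_apply (M := fibreInverse P E x),
    smul_eq_mul, Matrix.transpose_apply]

theorem sum_mixSymbol (H : IsSeparable U P D E u b) {x : S → ℝ} (hx : x ∈ U) (q : S) :
    ∑ a, mixSymbol (fibreMetric P D) (fibreInverse P E) a q a x = logDetDeriv u b q x / 2 := by
  rw [← H.sum_strainMatrix_div hx q, ← H.sum_fibreInverse_conj hx, Finset.sum_div]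
  refine Finset.sum_congr rfl fun a _ => ?_
  simp only [mixSymbol, H.pderiv_fibreMetric hx]
  ring

theorem traceSymbol_eq (H : IsSeparable U P D E u b) {x : S → ℝ} (hx : x ∈ U) (q : S) :
    traceSymbol (fun q y => (P q y)⁻¹) (fibreMetric P D) (fibreInverse P E) q x =
      u q q x - ∑ r, u r q x - 2 * b q x := by
  rw [traceSymbol, H.sum_mixSymbol hx, logDetDeriv]
  have h : ∀ r, baseSymbol (fun q y => (P q y)⁻¹) r r q x = -(1 / 2) * u r q x := by
    intro r
    have h0 := H.ne_zero x hx r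
    rw [H.baseSymbol_eq hx]
    by_cases hr : r = q
    · subst hr
      simp only [if_true]
      field_simp
      ring
    · simp only [if_neg hr, if_neg (Ne.symm hr), if_true]
      ring
  simp only [h, ← Finset.mul_sum]
  ring

/-- The trace of the square of `P⁻¹ X`. -/
def strainSq (P : S → (S → ℝ) → ℝ) (u : S → S → (S → ℝ) → ℝ) (b : S → (S → ℝ) → ℝ) (p : S)
    (x : S → ℝ) : ℝ :=
  ∑ q, ∑ r, strainMatrix P u b p x q r ^ 2 / (P q x * P r x)

theorem strainMatrix_symm (p q r : S) (x : S → ℝ) :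
    strainMatrix P u b p x q r = strainMatrix P u b p x r q :=
  congr_fun (congr_fun (strainMatrix_transpose P u b p x) r) q

theorem sum_mixSymbol_mul (H : IsSeparable U P D E u b) {x : S → ℝ} (hx : x ∈ U) (p : S) :
    ∑ a, ∑ c, mixSymbol (fibreMetric P D) (fibreInverse P E) a p c x
      * mixSymbol (fibreMetric P D) (fibreInverse P E) c p a x = strainSq P u b p x / 4 := by
  have h1 := H.mul_eq_one x hx
  simp only [H.mixSymbol_eq hx]
  set X := strainMatrix P u b p x with hX
  set Q := Matrix.diagonal (fun q => (P q x)⁻¹) with hQ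
  calc _ = (((1 / 2 : ℝ) • (E x * Q * X * D x)) * ((1 / 2 : ℝ) • (E x * Q * X * D x))).trace := by
        simp only [Matrix.trace, Matrix.diag_apply,
          Matrix.mul_apply (M := (1 / 2 : ℝ) • (E x * Q * X * D x))]
    _ = (1 / 4) * (E x * (Q * X * (D x * E x) * Q * X * D x)).trace := by
        rw [Matrix.smul_mul, Matrix.mul_smul, smul_smul, Matrix.trace_smul, smul_eq_mul]
        norm_num [Matrix.mul_assoc]
    _ = (1 / 4) * (Q * X * (Q * X)).trace := by
        rw [Matrix.trace_mul_comm, h1, Matrix.mul_one, Matrix.mul_assoc _ (D x), h1, Matrix.mul_one]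
        simp only [Matrix.mul_assoc]
    _ = strainSq P u b p x / 4 := by
        have hQX : ∀ q r, (Q * X) q r = (P q x)⁻¹ * X q r := fun q r => by
          rw [hQ, Matrix.diagonal_mul]
        simp only [Matrix.trace, Matrix.diag_apply, strainSq, Matrix.mul_apply (M := Q * X),
          Finset.mul_sum, Finset.sum_div, hQX, ← hX]
        refine Finset.sum_congr rfl fun q _ => Finset.sum_congr rfl fun r _ => ?_
        rw [show X r q = X q r from strainMatrix_symm p r q x]
        have h2 := H.ne_zero x hx q
        have h3 := H.ne_zero x hx r
        field_simp

/-- `∑ (∂X + KᵀX + XK)_qq / P_q = ∂ (∑ X_qq / P_q) + tr (P⁻¹X)²`. -/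
theorem sum_deriv_strainMatrix (H : IsSeparable U P D E u b) {x : S → ℝ} (hx : x ∈ U) (p : S) :
    ∑ q, ((connMatrix u b p x)ᵀ * strainMatrix P u b p x
      + Matrix.of (fun q r => pderiv p (fun y => strainMatrix P u b p y q r) x)
      + strainMatrix P u b p x * connMatrix u b p x) q q / P q x =
      pderiv p (logDetDeriv u b p) x + strainSq P u b p x := by
  set X := strainMatrix P u b p x with hX
  set K := connMatrix u b p x with hK
  have hK' := H.diff_connMatrix hx p
  have hu := H.diff_u x hx
  have hP := H.diff_P x hx
  have hdiag : ∀ q, pderiv p (fun y => strainMatrix P u b p y q q) x =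
      u q p x * X q q + P q x * pderiv p (fun y => 2 * connMatrix u b p y q q + u q p y) x := by
    intro q
    have h1 : (fun y => strainMatrix P u b p y q q) =
        fun y => P q y * (2 * connMatrix u b p y q q + u q p y) := by
      funext y
      rw [strainMatrix_apply, if_pos rfl]
      ring
    rw [h1, pderiv_fun_mul (hP q) (by fun_prop), H.pderiv_P x hx, hX, congr_fun h1 x]
    ring
  have hm : pderiv p (logDetDeriv u b p) x =
      ∑ q, pderiv p (fun y => 2 * connMatrix u b p y q q + u q p y) x := by
    rw [← pderiv_fun_sum (fun q _ => by fun_prop)]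
    congr 1
    funext y
    rw [sum_connMatrix]
  -- One of the two factors X_qr of each square is expanded by the definition of X. The two terms
  -- containing K have equal sums because X is symmetric.
  have hS : strainSq P u b p x = ∑ q, ∑ r, (K r q * X q r / P q x)
      + ∑ q, ∑ r, (K r q * X q r / P q x) + ∑ q, u q p x * X q q / P q x := by
    have e1 : ∑ q, ∑ r, K r q * X q r / P q x = ∑ q, ∑ r, K q r * X q r / P r x := by
      rw [Finset.sum_comm]
      refine Finset.sum_congr rfl fun q _ => Finset.sum_congr rfl fun r _ => ?_
      rw [show X r q = X q r from strainMatrix_symm p r q x]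
    have e2 : ∑ q, u q p x * X q q / P q x =
        ∑ q, ∑ r, (if q = r then P q x * u q p x else 0) * X q r / (P q x * P r x) := by
      refine Finset.sum_congr rfl fun q _ => ?_
      rw [Finset.sum_eq_single q]
      · have := H.ne_zero x hx q
        rw [if_pos rfl]
        field_simp
      · intro r _ hr
        simp [Ne.symm hr]
      · simp
    nth_rewrite 2 [e1]
    rw [e2, strainSq, ← Finset.sum_add_distrib, ← Finset.sum_add_distrib]
    refine Finset.sum_congr rfl fun q _ => ?_
    rw [← Finset.sum_add_distrib, ← Finset.sum_add_distrib]
    refine Finset.sum_congr rfl fun r _ => ?_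
    have h2 := H.ne_zero x hx q
    have h3 := H.ne_zero x hx r
    have h4 : X q r = K r q * P r x + (if q = r then P q x * u q p x else 0) + P q x * K q r :=
      strainMatrix_apply P u b p x q r
    rw [← hX, pow_two]
    nth_rewrite 1 [h4]
    field_simp
    ring
  rw [hm, hS, ← Finset.sum_add_distrib, ← Finset.sum_add_distrib, ← Finset.sum_add_distrib]
  refine Finset.sum_congr rfl fun q _ => ?_
  have h2 := H.ne_zero x hx q
  rw [Matrix.add_apply, Matrix.add_apply, Matrix.of_apply, hdiag, Matrix.mul_apply,
    Matrix.mul_apply, ← Finset.sum_div]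
  have e3 : ∑ j, Kᵀ q j * X j q = ∑ j, K j q * X q j :=
    Finset.sum_congr rfl fun j _ => by
      rw [show X j q = X q j from strainMatrix_symm p j q x, Matrix.transpose_apply]
  have e4 : ∑ j, X q j * K j q = ∑ j, K j q * X q j :=
    Finset.sum_congr rfl fun j _ => mul_comm _ _
  rw [e3, e4]
  field_simp
  ring

end IsSeparable

end SeparableCurvature

end Chart

/-! ### Fibre trace of the Ricci tensor and quadratic sums of Christoffel symbols. -/

namespace Chart

section SeparableScalar

open scoped Matrix

variable {S : Type} [Fintype S] [DecidableEq S]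
variable {U : Set (S → ℝ)} {P : S → (S → ℝ) → ℝ} {D E : (S → ℝ) → Matrix S S ℝ}
  {u : S → S → (S → ℝ) → ℝ} {b : S → (S → ℝ) → ℝ}

namespace IsSeparable

/-- The trace of (P⁻¹X)² appears twice with opposite signs: once from differentiating Dᵀ X D, and
once from the two products of a vertical and a mixed symbol. Only the logarithmic derivative of the
determinant is left. -/
theorem sum_ricci_fibre (H : IsSeparable U P D E u b) {z : S ⊕ S → ℝ} {x : S → ℝ}
    (hz : (fun q => z (Sum.inl q)) = x) (hx : x ∈ U) :
    ∑ a, ∑ c, fibreInverse P E x a c *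
        ricci (blockMetric (fun q y => (P q y)⁻¹) (fibreMetric P D)) (Sum.inr a) (Sum.inr c) z =
      -(1 / 2) * ∑ q, P q x * (pderiv q (logDetDeriv u b q) x
        + (2 * u q q x - ∑ r, u r q x - 2 * b q x) * logDetDeriv u b q x) := by
  have h1 := H.mul_eq_one x hx
  have h2 : (E x)ᵀ * (D x)ᵀ = 1 := by rw [← Matrix.transpose_mul, h1, Matrix.transpose_one]
  have hR := fun a c => ricci_blockMetric_rr (e := fun q y => (P q y)⁻¹) (h := fibreMetric P D)
    (k := fibreInverse P E) H.isOpen (fun x hx p => inv_ne_zero (H.ne_zero x hx p))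
    (fun x hx => H.fibreMetric_mul_fibreInverse hx) hz hx a c
  have hX := fun p q r => H.diff_strainMatrix hx p q r
  have hP := H.diff_P x hx
  have hder : ∀ q a c,
      pderiv q (vertSymbol (fun q y => (P q y)⁻¹) (fibreMetric P D) q a c) x =
      -(1 / 2) * (P q x * u q q x * ((D x)ᵀ * strainMatrix P u b q x * D x) a c
        + P q x * ((D x)ᵀ * ((connMatrix u b q x)ᵀ * strainMatrix P u b q x
      + Matrix.of (fun s r => pderiv q (fun y => strainMatrix P u b q y s r) x)
      + strainMatrix P u b q x * connMatrix u b q x) * D x) a c) := by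
    intro q a c
    rw [pderiv_congr_on H.isOpen hx fun y hy => H.vertSymbol_eq hy q a c]
    have hd := H.diff_conj hx (hX q) a c
    rw [pderiv_fun_const_mul _ ((hP q).fun_mul hd), pderiv_fun_mul (hP q) hd, H.pderiv_P x hx,
      H.pderiv_conj hx q (hX q) 
        (Y' := Matrix.of fun s r => pderiv q (fun y => strainMatrix P u b q y s r) x)
        (fun _ _ => rfl)]
  have hq1 : ∀ q a c, ∑ d, vertSymbol (fun q y => (P q y)⁻¹) (fibreMetric P D) q a d x
      * mixSymbol (fibreMetric P D) (fibreInverse P E) d q c x = -(1 / 4) * (P q x *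
        ((D x)ᵀ * (strainMatrix P u b q x * Matrix.diagonal (fun r => (P r x)⁻¹)
          * strainMatrix P u b q x) * D x) a c) := by
    intro q a c
    set X := strainMatrix P u b q x
    have : (D x)ᵀ * (X * Matrix.diagonal (fun r => (P r x)⁻¹) * X) * D x
        = ((D x)ᵀ * X * D x) * (E x * Matrix.diagonal (fun q => (P q x)⁻¹) * X * D x) := by
      calc _ = (D x)ᵀ * X * ((D x * E x) * (Matrix.diagonal (fun r => (P r x)⁻¹) * X * D x)) := by
            rw [h1, Matrix.one_mul]
            simp only [Matrix.mul_assoc]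
        _ = _ := by simp only [Matrix.mul_assoc]
    rw [this, Matrix.mul_apply (M := (D x)ᵀ * X * D x), Finset.mul_sum, Finset.mul_sum]
    refine Finset.sum_congr rfl fun d _ => ?_
    rw [H.vertSymbol_eq hx, H.mixSymbol_eq hx, Matrix.smul_apply, smul_eq_mul]
    ring
  have hq2 : ∀ q a c, ∑ d, mixSymbol (fibreMetric P D) (fibreInverse P E) d q a x
      * vertSymbol (fun q y => (P q y)⁻¹) (fibreMetric P D) q d c x = -(1 / 4) * (P q x *
        ((D x)ᵀ * (strainMatrix P u b q x * Matrix.diagonal (fun r => (P r x)⁻¹)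
          * strainMatrix P u b q x) * D x) a c) := by
    intro q a c
    have hXT : (strainMatrix P u b q x)ᵀ = strainMatrix P u b q x := strainMatrix_transpose ..
    set X := strainMatrix P u b q x
    have : (D x)ᵀ * (X * Matrix.diagonal (fun r => (P r x)⁻¹) * X) * D x
        = (E x * Matrix.diagonal (fun q => (P q x)⁻¹) * X * D x)ᵀ * ((D x)ᵀ * X * D x) := by
      calc _ = (D x)ᵀ * X * (Matrix.diagonal (fun r => (P r x)⁻¹) *
              (((E x)ᵀ * (D x)ᵀ) * (X * D x))) := by
            rw [h2, Matrix.one_mul]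
            simp only [Matrix.mul_assoc]
        _ = _ := by
            simp only [Matrix.transpose_mul, Matrix.diagonal_transpose, hXT, Matrix.mul_assoc]
    rw [this, Matrix.mul_apply (N := (D x)ᵀ * X * D x), Finset.mul_sum, Finset.mul_sum]
    refine Finset.sum_congr rfl fun d _ => ?_
    rw [H.vertSymbol_eq hx, H.mixSymbol_eq hx, Matrix.smul_apply, smul_eq_mul,
      Matrix.transpose_apply]
    ring
  have hsq : ∀ q, ∑ s, (strainMatrix P u b q x * Matrix.diagonal (fun r => (P r x)⁻¹)
          * strainMatrix P u b q x) s s / P s x = strainSq P u b q x := by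
    intro q
    refine Finset.sum_congr rfl fun s _ => ?_
    rw [Matrix.mul_apply, Finset.sum_div]
    refine Finset.sum_congr rfl fun r _ => ?_
    rw [Matrix.mul_diagonal, strainMatrix_symm q r s]
    have h3 := H.ne_zero x hx s
    have h4 := H.ne_zero x hx r
    field_simp
  have hsum : ∀ q, ∑ a, ∑ c, fibreInverse P E x a c *
      (pderiv q (vertSymbol (fun q y => (P q y)⁻¹) (fibreMetric P D) q a c) x
        + traceSymbol (fun q y => (P q y)⁻¹) (fibreMetric P D) (fibreInverse P E) q x
          * vertSymbol (fun q y => (P q y)⁻¹) (fibreMetric P D) q a c x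
        - ∑ d, vertSymbol (fun q y => (P q y)⁻¹) (fibreMetric P D) q a d x
          * mixSymbol (fibreMetric P D) (fibreInverse P E) d q c x
        - ∑ d, mixSymbol (fibreMetric P D) (fibreInverse P E) d q a x
          * vertSymbol (fun q y => (P q y)⁻¹) (fibreMetric P D) q d c x) =
      -(1 / 2) * (P q x * (pderiv q (logDetDeriv u b q) x
        + (2 * u q q x - ∑ r, u r q x - 2 * b q x) * logDetDeriv u b q x)) := by
    intro q
    have t1 := H.sum_fibreInverse_conj hx (strainMatrix P u b q x)
    have t2 := H.sum_fibreInverse_conj hx ((connMatrix u b q x)ᵀ * strainMatrix P u b q x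
      + Matrix.of (fun s r => pderiv q (fun y => strainMatrix P u b q y s r) x)
      + strainMatrix P u b q x * connMatrix u b q x)
    have t3 := H.sum_fibreInverse_conj hx (strainMatrix P u b q x
      * Matrix.diagonal (fun r => (P r x)⁻¹) * strainMatrix P u b q x)
    rw [H.sum_strainMatrix_div hx] at t1
    rw [H.sum_deriv_strainMatrix hx] at t2
    rw [hsq] at t3
    simp only [hder, hq1, hq2]
    simp only [H.vertSymbol_eq hx, H.traceSymbol_eq hx]
    generalize (D x)ᵀ * strainMatrix P u b q x * D x = M1 at t1 ⊢
    generalize (D x)ᵀ * ((connMatrix u b q x)ᵀ * strainMatrix P u b q x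
      + Matrix.of (fun s r => pderiv q (fun y => strainMatrix P u b q y s r) x)
      + strainMatrix P u b q x * connMatrix u b q x) * D x = M2 at t2 ⊢
    generalize (D x)ᵀ * (strainMatrix P u b q x
      * Matrix.diagonal (fun r => (P r x)⁻¹) * strainMatrix P u b q x) * D x = M3 at t3 ⊢
    have key : ∀ α γ δ : ℝ, ∑ a, ∑ c, fibreInverse P E x a c *
        (α * M1 a c + γ * M2 a c + δ * M3 a c) =
        α * ∑ a, ∑ c, fibreInverse P E x a c * M1 a c
        + γ * ∑ a, ∑ c, fibreInverse P E x a c * M2 a c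
        + δ * ∑ a, ∑ c, fibreInverse P E x a c * M3 a c := by
      intro α γ δ
      simp only [Finset.mul_sum, ← Finset.sum_add_distrib]
      refine Finset.sum_congr rfl fun a _ => Finset.sum_congr rfl fun c _ => ?_
      ring
    -- The coefficients γ and δ chosen below are opposite, so that `strainSq` drops out.
    rw [t1, t2, t3] at key
    have key' := key (-(1 / 2) * (P q x * u q q x)
        - (1 / 2) * ((u q q x - ∑ r, u r q x - 2 * b q x) * P q x)) (-(1 / 2) * P q x)
        ((1 / 2) * P q x)
    refine Eq.trans ?_ (key'.trans ?_)
    · refine Finset.sum_congr rfl fun a _ => Finset.sum_congr rfl fun c _ => ?_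
      ring
    · ring
  have hswap : ∀ (k : Matrix S S ℝ) (f : S → S → S → ℝ),
      ∑ a, ∑ c, k a c * ∑ q, f q a c = ∑ q, ∑ a, ∑ c, k a c * f q a c := by
    intro k f
    simp only [Finset.mul_sum]
    rw [Finset.sum_comm]
    refine (Finset.sum_congr rfl fun c _ => Finset.sum_comm).trans ?_
    rw [Finset.sum_comm]
    exact Finset.sum_congr rfl fun q _ => Finset.sum_comm
  simp only [hR]
  rw [hswap, Finset.mul_sum]
  exact Finset.sum_congr rfl fun q _ => hsum q

theorem strainSq_eq (H : IsSeparable U P D E u b) {x : S → ℝ} (hx : x ∈ U) (p : S) :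
    strainSq P u b p x = ∑ q, u q p x ^ 2 + 2 * ∑ q, P q x * u p q x ^ 2 / P p x
      - 3 * u p p x ^ 2 + (u p p x - 4 * b p x) ^ 2 := by
  have h0 := fun q => H.ne_zero x hx q
  -- Nonzero entries occur only on the diagonal and in the row and the column of `p`. The three
  -- patterns overlap at (p, p), where each contributes u_pp², hence the correction -3 u_pp² next to
  -- the true value.
  have hterm : ∀ q r, strainMatrix P u b p x q r ^ 2 / (P q x * P r x) =
      (if q = r then u q p x ^ 2 else 0) + (if r = p then P q x * u p q x ^ 2 / P p x else 0)
      + (if q = p then P r x * u p r x ^ 2 / P p x else 0)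
      + (if q = p then if r = p then (u p p x - 4 * b p x) ^ 2 - 3 * u p p x ^ 2 else 0 else 0) := by
    intro q r
    rw [strainMatrix_apply]
    simp only [connMatrix, Matrix.of_apply]
    have hp := h0 p
    have hq := h0 q
    have hr := h0 r
    by_cases hqp : q = p
    · by_cases hrp : r = p
      · subst hqp hrp
        simp only [if_true, and_self]
        field_simp
        ring
      · have : ¬ q = r := fun h => hrp (h ▸ hqp)
        have h' : ¬ p = r := fun h => hrp h.symm
        subst hqp
        simp only [if_true, hrp, h', if_false, and_false, false_and]
        field_simp
        ring
    · by_cases hrp : r = p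
      · have h' : ¬ p = q := fun h => hqp h.symm
        subst hrp
        simp only [if_true, hqp, h', if_false, and_false, false_and]
        field_simp
        ring
      · by_cases hqr : q = r
        · subst hqr
          simp only [if_true, hqp, if_false, and_false]
          field_simp
          ring
        · have h' : ¬ r = q := fun h => hqr h.symm
          simp only [hqr, h', hqp, hrp, if_false, and_false]
          simp
  simp only [strainSq, hterm, Finset.sum_add_distrib]
  simp only [Finset.sum_ite_eq, Finset.sum_ite_eq', Finset.mem_univ, if_true]
  rw [Finset.sum_comm (f := fun q r => if q = p then P r x * u p r x ^ 2 / P p x else 0),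
    Finset.sum_comm (f := fun q r => if q = p then
      if r = p then (u p p x - 4 * b p x) ^ 2 - 3 * u p p x ^ 2 else 0 else 0)]
  simp only [Finset.sum_ite_eq', Finset.mem_univ, if_true]
  ring

theorem sum_baseSymbol_mul (H : IsSeparable U P D E u b) {x : S → ℝ} (hx : x ∈ U) (p : S) :
    ∑ q, ∑ r, baseSymbol (fun q y => (P q y)⁻¹) q p r x * baseSymbol (fun q y => (P q y)⁻¹) r q p x
      = -(1 / 2) * ∑ q, P q x * u p q x ^ 2 / P p x + (1 / 4) * ∑ q, u q p x ^ 2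
        + (1 / 2) * u p p x ^ 2 := by
  have h0 := fun q => H.ne_zero x hx q
  have hterm : ∀ q r, baseSymbol (fun q y => (P q y)⁻¹) q p r x
      * baseSymbol (fun q y => (P q y)⁻¹) r q p x =
      (1 / 4) * (if q = r then u q p x ^ 2 else 0)
      - (1 / 4) * (if r = p then P q x * u p q x ^ 2 / P p x else 0)
      - (1 / 4) * (if q = p then P r x * u p r x ^ 2 / P p x else 0)
      + (1 / 2) * (if q = p then if r = p then u p p x ^ 2 else 0 else 0) := by
    intro q r
    rw [H.baseSymbol_eq hx, H.baseSymbol_eq hx]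
    have hp := h0 p
    have hq := h0 q
    have hr := h0 r
    by_cases hqp : q = p
    · by_cases hrp : r = p
      · subst hqp hrp
        simp only [if_true]
        field_simp
        ring
      · have h' : ¬ p = r := fun h => hrp h.symm
        subst hqp
        simp only [if_true, hrp, h', if_false]
        field_simp
        ring
    · have h' : ¬ p = q := fun h => hqp h.symm
      by_cases hrp : r = p
      · subst hrp
        simp only [if_true, hqp, h', if_false]
        field_simp
        ring
      · have h'' : ¬ p = r := fun h => hrp h.symm
        by_cases hqr : q = r
        · subst hqr
          simp only [if_true, hqp, h', if_false]
          ring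
        · have h3 : ¬ r = q := fun h => hqr h.symm
          simp only [hqr, h', h'', h3, hqp, hrp, if_false]
          simp
  simp only [hterm, Finset.sum_add_distrib, Finset.sum_sub_distrib, ← Finset.mul_sum]
  simp only [Finset.sum_ite_eq, Finset.sum_ite_eq', Finset.mem_univ, if_true]
  rw [Finset.sum_comm (f := fun q r => if q = p then P r x * u p r x ^ 2 / P p x else 0),
    Finset.sum_comm (f := fun q r => if q = p then
      if r = p then u p p x ^ 2 else 0 else 0)]
  simp only [Finset.sum_ite_eq', Finset.mem_univ, if_true]
  ring

end IsSeparable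

end SeparableScalar

end Chart

/-! ### Base part of the Ricci tensor and the scalar curvature. -/

namespace Chart

section SeparableRicci

open scoped Matrix

variable {S : Type} [Fintype S] [DecidableEq S]
variable {U : Set (S → ℝ)} {P : S → (S → ℝ) → ℝ} {D E : (S → ℝ) → Matrix S S ℝ}
  {u : S → S → (S → ℝ) → ℝ} {b : S → (S → ℝ) → ℝ}

namespace IsSeparable

theorem pderiv_baseSymbol_diag (H : IsSeparable U P D E u b) {x : S → ℝ} (hx : x ∈ U) (p q : S) :
    pderiv q (baseSymbol (fun q y => (P q y)⁻¹) q p p) x =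
      (1 / 2) * (P q x * u p q x / P p x * (u q q x - 2 * b q x))
      + if q = p then -(1 / 2) * (u p p x * (u p p x - 2 * b p x)) - (1 / 2) * pderiv p (u p p) x
        else 0 := by
  have h0 := fun q => H.ne_zero x hx q
  have hu := H.diff_u x hx
  have hP := H.diff_P x hx
  by_cases hqp : q = p
  · subst hqp
    have h1 : ∀ y ∈ U, baseSymbol (fun q y => (P q y)⁻¹) q q q y = -(1 / 2) * u q q y := by
      intro y hy
      have := H.ne_zero y hy q
      rw [H.baseSymbol_eq hy]
      simp only [if_true]
      field_simp
      ring
    rw [pderiv_congr_on H.isOpen hx h1, pderiv_fun_const_mul _ (hu q q), if_pos rfl]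
    have := h0 q
    field_simp
    ring
  · have h1 : ∀ y ∈ U, baseSymbol (fun q y => (P q y)⁻¹) q p p y =
        (1 / 2) * (P q y * u p q y / P p y) := by
      intro y hy
      have h' : ¬ p = q := fun h => hqp h.symm
      rw [H.baseSymbol_eq hy]
      simp only [if_true, h', if_false]
      ring
    rw [pderiv_congr_on H.isOpen hx h1, pderiv_fun_const_mul _
      (differentiableAt_fun_div ((hP q).fun_mul (hu p q)) (hP p) (h0 p)),
      pderiv_fun_div ((hP q).fun_mul (hu p q)) (hP p) (h0 p), pderiv_fun_mul (hP q) (hu p q),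
      H.pderiv_P x hx, H.pderiv_P x hx, H.pderiv_u x hx q p (Ne.symm hqp), if_neg hqp]
    have := h0 p
    field_simp
    ring

theorem pderiv_baseSymbol_trace (H : IsSeparable U P D E u b) {x : S → ℝ} (hx : x ∈ U) (p q : S) :
    pderiv p (baseSymbol (fun q y => (P q y)⁻¹) q q p) x = -(1 / 2) * pderiv p (u q p) x := by
  have h1 : ∀ y ∈ U, baseSymbol (fun q y => (P q y)⁻¹) q q p y = -(1 / 2) * u q p y := by
    intro y hy
    have h0 := H.ne_zero y hy q
    rw [H.baseSymbol_eq hy]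
    by_cases hq : q = p
    · subst hq
      simp only [if_true]
      field_simp
      ring
    · simp only [if_neg hq, if_neg (Ne.symm hq), if_true]
      ring
  rw [pderiv_congr_on H.isOpen hx h1, pderiv_fun_const_mul _ (H.diff_u x hx q p)]

/-- The derivative of u_pp in its own direction is the one term not governed by a Riccati equation.
In the application it carries the second derivative of A_p, so it is kept as an unknown. -/
theorem sum_pderiv_u (H : IsSeparable U P D E u b) {x : S → ℝ} (hx : x ∈ U) (p : S) :
    ∑ q, pderiv p (u q p) x = ∑ q, u q p x ^ 2 - 2 * b p x * ∑ q, u q p x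
      + (pderiv p (u p p) x - u p p x ^ 2 + 2 * u p p x * b p x) := by
  have h : ∀ q, pderiv p (u q p) x = u q p x ^ 2 - 2 * b p x * u q p x
      + if q = p then pderiv p (u p p) x - u p p x ^ 2 + 2 * u p p x * b p x else 0 := by
    intro q
    by_cases hq : q = p
    · subst hq
      rw [if_pos rfl]
      ring
    · rw [if_neg hq, H.pderiv_u x hx p q hq]
      ring
  rw [Finset.sum_congr rfl fun q _ => h q, Finset.sum_add_distrib, Finset.sum_sub_distrib,
    ← Finset.mul_sum]
  simp

theorem pderiv_logDetDeriv (H : IsSeparable U P D E u b) {x : S → ℝ} (hx : x ∈ U) (p : S) :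
    pderiv p (logDetDeriv u b p) x =
      2 * pderiv p (u p p) x - ∑ q, pderiv p (u q p) x + 4 * b p x ^ 2 := by
  have hu := H.diff_u x hx
  have hb := H.diff_b x hx
  unfold logDetDeriv
  rw [pderiv_fun_sub (by fun_prop) (by fun_prop), pderiv_fun_sub (by fun_prop) (by fun_prop),
    pderiv_fun_const_mul _ (hu p p), pderiv_fun_const_mul _ (hb p), H.pderiv_b x hx,
    pderiv_fun_sum fun q _ => hu q p]
  ring

theorem pderiv_mixSymbol_trace (H : IsSeparable U P D E u b) {x : S → ℝ} (hx : x ∈ U) (p : S) :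
    ∑ a, pderiv p (mixSymbol (fibreMetric P D) (fibreInverse P E) a p a) x =
      (1 / 2) * pderiv p (logDetDeriv u b p) x := by
  have hd : ∀ a, DifferentiableAt ℝ
      (mixSymbol (fibreMetric P D) (fibreInverse P E) a p a) x := by
    intro a
    have hE := H.diff_E x hx
    have hP := H.diff_P x hx
    have h0 := H.ne_zero x hx
    have h1 : DifferentiableAt ℝ (fun y =>
        ((1 / 2 : ℝ) • (E y * Matrix.diagonal (fun q => (P q y)⁻¹) * strainMatrix P u b p y * D y))
        a a) x := by
      simp only [Matrix.smul_apply]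
      refine DifferentiableAt.fun_const_smul (differentiableAt_matrix_mul
        (M := fun y => E y * Matrix.diagonal (fun q => (P q y)⁻¹) * strainMatrix P u b p y)
        (differentiableAt_matrix_mul (M := fun y => E y * Matrix.diagonal (fun q => (P q y)⁻¹))
        (differentiableAt_matrix_mul hE ?_) (H.diff_strainMatrix hx p)) (H.diff_D x hx) a a) _
      intro q r
      simp only [Matrix.diagonal_apply]
      split_ifs
      · exact (hP q).fun_inv (h0 q)
      · exact differentiableAt_const _
    refine h1.congr_of_eventuallyEq ?_
    filter_upwards [H.isOpen.mem_nhds hx] with y hy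
    exact H.mixSymbol_eq hy a p a
  rw [← pderiv_fun_sum fun a _ => hd a, ← pderiv_fun_const_mul _ (H.diff_logDetDeriv hx p)]
  refine pderiv_congr_on H.isOpen hx fun y hy => ?_
  rw [H.sum_mixSymbol hy]
  ring

/-- The sums of u_qp² and of P_q u_pq²/P_p cancel between the Christoffel products, `strainSq` and
`sum_pderiv_u`. With m_p = `logDetDeriv`, the terms after the derivative of m_p add up to -(u_pp -
b_p) m_p, so every surviving term contains m or its derivative. -/
theorem ricci_base (H : IsSeparable U P D E u b) {z : S ⊕ S → ℝ} {x : S → ℝ}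
    (hz : (fun q => z (Sum.inl q)) = x) (hx : x ∈ U) (p : S) :
    ricci (blockMetric (fun q y => (P q y)⁻¹) (fibreMetric P D)) (Sum.inl p) (Sum.inl p) z =
      (1 / 2) * ∑ q, P q x * u p q x / P p x * logDetDeriv u b q x
      - (1 / 2) * pderiv p (logDetDeriv u b p) x - 2 * u p p x ^ 2 + 6 * u p p x * b p x
      - b p x * ∑ q, u q p x + u p p x * ∑ q, u q p x - 4 * b p x ^ 2 := by
  have h0 := fun q => H.ne_zero x hx q
  rw [ricci_blockMetric_ll (e := fun q y => (P q y)⁻¹) (h := fibreMetric P D)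
    (k := fibreInverse P E) H.isOpen (fun x hx p => inv_ne_zero (H.ne_zero x hx p))
    (fun x hx => H.fibreMetric_mul_fibreInverse hx) hz hx p]
  rw [H.sum_baseSymbol_mul hx, H.sum_mixSymbol_mul hx, H.strainSq_eq hx,
    H.pderiv_mixSymbol_trace hx, Finset.sum_congr rfl fun q _ => H.pderiv_baseSymbol_trace hx p q,
    ← Finset.mul_sum, H.sum_pderiv_u hx,
    Finset.sum_congr rfl fun q _ => H.pderiv_baseSymbol_diag hx p q, Finset.sum_add_distrib,
    Finset.sum_ite_eq' Finset.univ p, if_pos (Finset.mem_univ p)]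
  have hT : ∀ q, traceSymbol (fun q y => (P q y)⁻¹) (fibreMetric P D) (fibreInverse P E) q x
      * baseSymbol (fun q y => (P q y)⁻¹) q p p x =
      (1 / 2) * (P q x * u p q x / P p x * (u q q x - ∑ r, u r q x - 2 * b q x))
      + if q = p then -(u p p x * (u p p x - ∑ r, u r p x - 2 * b p x)) else 0 := by
    intro q
    rw [H.traceSymbol_eq hx, H.baseSymbol_eq hx]
    by_cases hq : q = p
    · subst hq
      have := h0 q
      simp only [if_true]
      field_simp
      ring
    · simp only [if_neg hq, if_neg (Ne.symm hq), if_true]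
      ring
  rw [Finset.sum_congr rfl fun q _ => hT q, Finset.sum_add_distrib,
    Finset.sum_ite_eq' Finset.univ p, if_pos (Finset.mem_univ p)]
  have hC : ∑ q, P q x * u p q x / P p x * logDetDeriv u b q x =
      ∑ q, P q x * u p q x / P p x * (u q q x - 2 * b q x)
      + ∑ q, P q x * u p q x / P p x * (u q q x - ∑ r, u r q x - 2 * b q x) := by
    rw [← Finset.sum_add_distrib]
    refine Finset.sum_congr rfl fun q _ => ?_
    rw [logDetDeriv]
    ring
  rw [hC, ← Finset.mul_sum, ← Finset.mul_sum, H.pderiv_logDetDeriv hx, H.sum_pderiv_u hx]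
  ring

/-- The scalar curvature of a separable Kähler metric. -/
theorem scalarCurvature_eq (H : IsSeparable U P D E u b) {z : S ⊕ S → ℝ} {x : S → ℝ}
    (hz : (fun q => z (Sum.inl q)) = x) (hx : x ∈ U) :
    scalarCurvature (blockMetric (fun q y => (P q y)⁻¹) (fibreMetric P D)) z =
      -∑ p, P p x * (pderiv p (logDetDeriv u b p) x
        + (logDetDeriv u b p x + 2 * b p x) * logDetDeriv u b p x) := by
  have h0 := fun q => H.ne_zero x hx q
  rw [scalarCurvature_blockMetric (e := fun q y => (P q y)⁻¹) (h := fibreMetric P D)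
    (k := fibreInverse P E) H.isOpen (fun x hx p => inv_ne_zero (H.ne_zero x hx p))
    (fun x hx => H.fibreMetric_mul_fibreInverse hx) hz hx, H.sum_ricci_fibre hz hx]
  simp only [H.ricci_base hz hx, inv_inv]
  -- Interchanging the sums attaches the cross terms to m_q with the factor ∑_p u_pq, the sum that
  -- also occurs in the fibre trace. The comparison can then be made one index at a time.
  have hC : ∑ p, P p x * ∑ q, P q x * u p q x / P p x * logDetDeriv u b q x =
      ∑ q, P q x * logDetDeriv u b q x * ∑ p, u p q x := by
    simp only [Finset.mul_sum]
    rw [Finset.sum_comm]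
    refine Finset.sum_congr rfl fun q _ => Finset.sum_congr rfl fun p _ => ?_
    have := h0 p
    field_simp
  have hS : ∀ p, P p x * ((1 / 2) * ∑ q, P q x * u p q x / P p x * logDetDeriv u b q x
      - (1 / 2) * pderiv p (logDetDeriv u b p) x - 2 * u p p x ^ 2 + 6 * u p p x * b p x
      - b p x * ∑ q, u q p x + u p p x * ∑ q, u q p x - 4 * b p x ^ 2) =
      (1 / 2) * (P p x * ∑ q, P q x * u p q x / P p x * logDetDeriv u b q x)
      + P p x * (- (1 / 2) * pderiv p (logDetDeriv u b p) x - 2 * u p p x ^ 2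
      + 6 * u p p x * b p x - b p x * ∑ q, u q p x + u p p x * ∑ q, u q p x - 4 * b p x ^ 2) :=
    fun p => by ring
  rw [Finset.sum_congr rfl fun p _ => hS p, Finset.sum_add_distrib, ← Finset.mul_sum, hC,
    Finset.mul_sum, Finset.mul_sum, ← Finset.sum_add_distrib, ← Finset.sum_add_distrib,
    ← Finset.sum_neg_distrib]
  refine Finset.sum_congr rfl fun p _ => ?_
  simp only [logDetDeriv]
  ring

end IsSeparable

end SeparableRicci

end Chart

/-! ### The pairing as a multi-affine polynomial. -/

namespace SegreVeronese

open Chart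

section Pairing

variable {ι : Type} [Fintype ι]

theorem contDiff_pairing (T : Tensor ι) : ContDiff ℝ ∞ (fun x : ι → ℝ => pairing x T) := by
  induction T using PiTensorProduct.induction_on with
  | smul_tprod r v =>
    simp only [map_smul, pairing_tprod, smul_eq_mul]
    fun_prop
  | add a b ha hb =>
    simp only [map_add]
    exact ha.add hb

theorem differentiable_pairing (T : Tensor ι) : Differentiable ℝ (fun x : ι → ℝ => pairing x T) :=
  (contDiff_pairing T).differentiable (by simp)

theorem pairing_comp_perm (σ : Equiv.Perm ι) (x : ι → ℝ) {T : Tensor ι} (hT : T ∈ symTensor ι) :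
    pairing (fun p => x (σ p)) T = pairing x T := by
  have h1 : ∀ T : Tensor ι, pairing x (PiTensorProduct.reindex ℝ (fun _ : ι => Fin 2 → ℝ) σ T)
      = pairing (fun p => x (σ p)) T := by
    intro T
    induction T using PiTensorProduct.induction_on with
    | smul_tprod r v =>
      rw [map_smul, map_smul, map_smul, PiTensorProduct.reindex_tprod, pairing_tprod, pairing_tprod]
      congr 1
      refine (Fintype.prod_equiv σ _ _ fun p => ?_).symm
      simp
    | add a b ha hb => simp only [map_add, ha, hb]
  rw [symTensor, Submodule.mem_iInf] at hT
  have h2 := hT σ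
  rw [LinearMap.mem_eqLocus] at h2
  rw [← h1]
  exact congrArg _ h2

variable [DecidableEq ι]

/-- Each coordinate occurs in a single factor (1, x_p), so the pairing is affine in it. First
derivatives are therefore differences of values at 1 and 0, and pure second derivatives vanish. -/
theorem pairing_update (x : ι → ℝ) (p : ι) (s : ℝ) (T : Tensor ι) :
    pairing (Function.update x p s) T = pairing (Function.update x p 0) T
      + s * (pairing (Function.update x p 1) T - pairing (Function.update x p 0) T) := by
  induction T using PiTensorProduct.induction_on with
  | smul_tprod r v =>
    simp only [map_smul, pairing_tprod, smul_eq_mul]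
    have h : ∀ s, ∏ q, (v q 0 + Function.update x p s q * v q 1) =
        (v p 0 + s * v p 1) * ∏ q ∈ Finset.univ.erase p, (v q 0 + x q * v q 1) := by
      intro s
      rw [← Finset.mul_prod_erase _ _ (Finset.mem_univ p), Function.update_self]
      congr 1
      refine Finset.prod_congr rfl fun q hq => ?_
      rw [Function.update_of_ne (Finset.ne_of_mem_erase hq)]
    simp only [h]
    ring
  | add a b ha hb =>
    simp only [map_add]
    rw [ha, hb]
    ring

theorem hasDerivAt_pairing_update (x : ι → ℝ) (p : ι) (s : ℝ) (T : Tensor ι) :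
    HasDerivAt (fun s => pairing (Function.update x p s) T)
      (pairing (Function.update x p 1) T - pairing (Function.update x p 0) T) s := by
  have h : (fun s => pairing (Function.update x p s) T) = fun s =>
      pairing (Function.update x p 0) T
      + s * (pairing (Function.update x p 1) T - pairing (Function.update x p 0) T) :=
    funext fun s => pairing_update x p s T
  rw [h]
  simpa using ((hasDerivAt_id s).mul_const _).const_add (pairing (Function.update x p 0) T)

theorem pderiv_pairing (p : ι) (x : ι → ℝ) (T : Tensor ι) :
    pderiv p (fun y => pairing y T) x =
      pairing (Function.update x p 1) T - pairing (Function.update x p 0) T :=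
  pderiv_eq_of_hasDerivAt_update (differentiable_pairing T x) (hasDerivAt_pairing_update x p _ T)

theorem differentiable_pairing_update (p : ι) (s : ℝ) (T : Tensor ι) :
    Differentiable ℝ (fun y : ι → ℝ => pairing (Function.update y p s) T) := by
  have h1 : Differentiable ℝ (fun y : ι → ℝ => Function.update y p s) := by
    rw [differentiable_pi]
    intro q
    by_cases hq : q = p
    · subst hq
      simp
    · simp only [Function.update_of_ne hq]
      fun_prop
  exact (differentiable_pairing T).comp h1

theorem differentiable_pderiv_pairing (p : ι) (T : Tensor ι) :
    Differentiable ℝ (pderiv p (fun y => pairing y T)) := by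
  have h : pderiv p (fun y => pairing y T) = fun x =>
      pairing (Function.update x p 1) T - pairing (Function.update x p 0) T :=
    funext fun x => pderiv_pairing p x T
  rw [h]
  exact (differentiable_pairing_update p 1 T).sub (differentiable_pairing_update p 0 T)

theorem pderiv_pderiv_pairing_self (p : ι) (x : ι → ℝ) (T : Tensor ι) :
    pderiv p (pderiv p (fun y => pairing y T)) x = 0 := by
  refine pderiv_eq_of_hasDerivAt_update (differentiable_pderiv_pairing p T x) ?_
  simp only [pderiv_pairing, Function.update_idem]
  exact hasDerivAt_const _ _

theorem pderiv_pderiv_pairing {p q : ι} (hpq : p ≠ q) (x : ι → ℝ) (T : Tensor ι) :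
    pderiv p (pderiv q (fun y => pairing y T)) x =
      pairing (Function.update (Function.update x p 1) q 1) T
      - pairing (Function.update (Function.update x p 0) q 1) T
      - pairing (Function.update (Function.update x p 1) q 0) T
      + pairing (Function.update (Function.update x p 0) q 0) T := by
  refine pderiv_eq_of_hasDerivAt_update (differentiable_pderiv_pairing q T x) ?_
  simp only [pderiv_pairing, Function.update_comm hpq]
  refine ((hasDerivAt_pairing_update (Function.update x q 1) p (x p) T).sub
    (hasDerivAt_pairing_update (Function.update x q 0) p (x p) T)).congr_deriv ?_
  ring

end Pairing

section Ins

variable {k : ℕ} {d : Fin k → ℕ}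

theorem pairing_ins (i : Fin k) (G : Tensor {q : Slot d // ¬ q.1 = i})
    (T : Tensor {q : Slot d // q.1 = i}) (x : Slot d → ℝ) :
    pairing x (ins i G T) =
      pairing (fun q : {q : Slot d // q.1 = i} => x q) T
        * pairing (fun q : {q : Slot d // ¬ q.1 = i} => x q) G := by
  induction T using PiTensorProduct.induction_on with
  | smul_tprod r v =>
    -- This exhibits linearity in `G` as well, so that a second induction can reduce `G` to pure
    -- tensors.
    have hins : ∀ G, ins i G (PiTensorProduct.tprod ℝ v) =
        ((PiTensorProduct.reindex ℝ (fun _ => Fin 2 → ℝ)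
          (Equiv.sumCompl (fun q : Slot d => q.1 = i))).toLinearMap ∘ₗ
          (PiTensorProduct.tmulEquiv ℝ (Fin 2 → ℝ)).toLinearMap ∘ₗ
          TensorProduct.mk ℝ _ _ (PiTensorProduct.tprod ℝ v)) G := fun _ => rfl
    simp only [map_smul, smul_eq_mul]
    rw [mul_assoc]
    congr 1
    induction G using PiTensorProduct.induction_on with
    | smul_tprod t w =>
      rw [hins, map_smul, ← hins]
      simp only [map_smul, smul_eq_mul]
      rw [mul_left_comm]
      congr 1
      have h1 : ins i (PiTensorProduct.tprod ℝ w) (PiTensorProduct.tprod ℝ v) =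
          PiTensorProduct.reindex ℝ (fun _ => Fin 2 → ℝ)
          (Equiv.sumCompl (fun q : Slot d => q.1 = i)) (PiTensorProduct.tmulEquiv ℝ (Fin 2 → ℝ)
            (PiTensorProduct.tprod ℝ v ⊗ₜ[ℝ] PiTensorProduct.tprod ℝ w)) := rfl
      rw [h1, PiTensorProduct.tmulEquiv_apply, PiTensorProduct.reindex_tprod, pairing_tprod,
        pairing_tprod, pairing_tprod, ← Equiv.prod_comp (Equiv.sumCompl fun q : Slot d => q.1 = i),
        Fintype.prod_sum_type]
      have h2 : ∀ a : {q : Slot d // q.1 = i},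
          (Equiv.sumCompl fun q : Slot d => q.1 = i).symm (a : Slot d) = Sum.inl a :=
        fun a => (Equiv.symm_apply_eq _).2 rfl
      have h3 : ∀ a : {q : Slot d // ¬ q.1 = i},
          (Equiv.sumCompl fun q : Slot d => q.1 = i).symm (a : Slot d) = Sum.inr a :=
        fun a => (Equiv.symm_apply_eq _).2 rfl
      simp only [Equiv.sumCompl_apply_inl, Equiv.sumCompl_apply_inr, h2, h3, Sum.elim_inl,
        Sum.elim_inr]
    | add a b ha hb =>
      rw [hins, map_add, ← hins, ← hins]
      simp only [map_add, ha, hb, mul_add]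
  | add a b ha hb => simp only [map_add, ha, hb, add_mul]

end Ins

end SegreVeronese

/-! ### The second-order system satisfied by all momenta ⟨μ,v⟩. -/

namespace SegreVeronese

open Chart

section TwoPoint

variable {n : ℕ} {d : Fin (n + 3) → ℕ} (π₁ π₂ : ℝ)

theorem last_ne_zero' : Fin.last (n + 2) ≠ 0 := by
  simp [Fin.ext_iff]

theorem hatPairing_eq (x : Slot d → ℝ) (i : Fin (n + 3)) :
    hatPairing (twoPointTensors d π₁ π₂) x i =
      ∏ q : Slot d, if i = Fin.last (n + 2) ∧ q.1 = 0 then π₁ + π₂ * x q else 1 := by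
  rw [hatPairing, twoPointTensors, pairing_tprod]
  have h : ∀ q : {q : Slot d // ¬ q.1 = i},
      (if i = Fin.last (n + 2) ∧ q.1.1 = 0 then ![π₁, π₂] else ![1, 0] : Fin 2 → ℝ) 0
        + x q * (if i = Fin.last (n + 2) ∧ q.1.1 = 0 then ![π₁, π₂] else ![1, 0] : Fin 2 → ℝ) 1
      = if i = Fin.last (n + 2) ∧ q.1.1 = 0 then π₁ + π₂ * x q else 1 := by
    intro q
    split_ifs <;> simp [mul_comm]
  rw [Finset.prod_congr rfl fun q _ => h q]
  rw [← Finset.prod_subtype (Finset.univ.filter fun q : Slot d => ¬ q.1 = i)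
    (f := fun q => if i = Fin.last (n + 2) ∧ q.1 = 0 then π₁ + π₂ * x q else 1) (by simp)]
  refine Finset.prod_subset (Finset.subset_univ _) fun q _ hq => if_neg ?_
  rintro ⟨h1, h2⟩
  simp only [Finset.mem_filter, Finset.mem_univ, true_and, not_not] at hq
  exact last_ne_zero' (h1.symm.trans (hq.symm.trans h2))

theorem hatPairing_last (x : Slot d → ℝ) :
    hatPairing (twoPointTensors d π₁ π₂) x (Fin.last (n + 2)) =
      ∏ q : Slot d with q.1 = 0, (π₁ + π₂ * x q) := by
  rw [hatPairing_eq, Finset.prod_filter]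
  simp

theorem hatPairing_of_ne (x : Slot d → ℝ) {i : Fin (n + 3)} (hi : i ≠ Fin.last (n + 2)) :
    hatPairing (twoPointTensors d π₁ π₂) x i = 1 := by
  rw [hatPairing_eq]
  simp [hi]

theorem hatPairing_update (x : Slot d → ℝ) (p : Slot d) (i : Fin (n + 3)) :
    ∃ K, ∀ s, hatPairing (twoPointTensors d π₁ π₂) (Function.update x p s) i =
      (if i = Fin.last (n + 2) ∧ p.1 = 0 then π₁ + π₂ * s else 1) * K := by
  refine ⟨∏ q ∈ Finset.univ.erase p,
    if i = Fin.last (n + 2) ∧ q.1 = 0 then π₁ + π₂ * x q else 1, fun s => ?_⟩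
  rw [hatPairing_eq, ← Finset.mul_prod_erase _ _ (Finset.mem_univ p), Function.update_self]
  congr 1
  refine Finset.prod_congr rfl fun q hq => ?_
  rw [Function.update_of_ne (Finset.ne_of_mem_erase hq)]

theorem hatPairing_update_of_not (x : Slot d → ℝ) (p : Slot d) (i : Fin (n + 3)) (s : ℝ)
    (h : ¬ (i = Fin.last (n + 2) ∧ p.1 = 0)) :
    hatPairing (twoPointTensors d π₁ π₂) (Function.update x p s) i =
      hatPairing (twoPointTensors d π₁ π₂) x i := by
  obtain ⟨K, hK⟩ := hatPairing_update π₁ π₂ x p i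
  have hx := hK (x p)
  rw [Function.update_eq_self, if_neg h] at hx
  rw [hK, if_neg h, hx]

theorem pairing_restrict_update {k : ℕ} {d : Fin k → ℕ} {i : Fin k} {p : Slot d} (hp : p.1 ≠ i)
    (x : Slot d → ℝ) (s : ℝ) (S : Tensor {q : Slot d // q.1 = i}) :
    pairing (fun q : {q : Slot d // q.1 = i} => Function.update x p s q) S =
      pairing (fun q : {q : Slot d // q.1 = i} => x q) S := by
  congr 2
  funext q
  rw [Function.update_of_ne]
  rintro rfl
  exact hp q.2

theorem pairing_ins_update {i : Fin (n + 3)} {p : Slot d} (hp : p.1 ≠ i)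
    (h : ¬ (i = Fin.last (n + 2) ∧ p.1 = 0)) (x : Slot d → ℝ) (s : ℝ)
    (S : Tensor {q : Slot d // q.1 = i}) :
    pairing (Function.update x p s) (ins i (twoPointTensors d π₁ π₂ i) S) =
      pairing x (ins i (twoPointTensors d π₁ π₂ i) S) := by
  rw [pairing_ins, pairing_ins, pairing_restrict_update hp]
  congr 1
  exact hatPairing_update_of_not π₁ π₂ x p i s h

/-- An element of `𝔥` pairs symmetrically in the coordinates of each group. -/
theorem pairing_swap (v : structureSpace (twoPointTensors d π₁ π₂)) {p q : Slot d}
    (hpq : p.1 = q.1) (x : Slot d → ℝ) :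
    pairing (fun r => x (Equiv.swap p q r)) (v : Tensor (Slot d)) = pairing x (v : Tensor (Slot d)) := by
  obtain ⟨T, hT⟩ := v
  refine Submodule.iSup_induction _ (motive := fun T => pairing (fun r => x (Equiv.swap p q r)) T
    = pairing x T) hT ?_ (by simp) (fun a b ha hb => by simp only [map_add, ha, hb])
  rintro i _ ⟨S, hS, rfl⟩
  rw [pairing_ins, pairing_ins]
  have hfst : ∀ r, (Equiv.swap p q r).1 = r.1 := by
    intro r
    by_cases h1 : r = p
    · subst h1; rw [Equiv.swap_apply_left, hpq]
    · by_cases h2 : r = q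
      · subst h2; rw [Equiv.swap_apply_right, hpq]
      · rw [Equiv.swap_apply_of_ne_of_ne h1 h2]
  congr 1
  · exact pairing_comp_perm ((Equiv.swap p q).subtypePerm (p := fun r => r.1 = i)
      fun r => by rw [hfst]) (fun r => x r) hS
  · change hatPairing _ (fun r => x (Equiv.swap p q r)) i = hatPairing _ x i
    rw [hatPairing_eq, hatPairing_eq]
    refine Fintype.prod_equiv (Equiv.swap p q) _ _ fun r => ?_
    rw [hfst]

/-- The logarithmic derivative of `Δ_q ⟨x̂, Γ⟩` in the direction `p ≠ q`. -/
def crossDeriv (q p : Slot d) (x : Slot d → ℝ) : ℝ :=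
  if q.1 = p.1 then 1 / (x p - x q)
  else if q.1 = Fin.last (n + 2) ∧ p.1 = 0 then π₂ / (π₁ + π₂ * x p) else 0

/-- The pairing is affine in x_p and in x_q. The dependence of ∂_p on x_q is thus split into its
value at x_q = 0 and x_q times the mixed derivative. -/
theorem pderiv_pairing_left {ι : Type} [Fintype ι] [DecidableEq ι] {p q : ι} (hpq : p ≠ q)
    (x : ι → ℝ) (T : Tensor ι) :
    pderiv p (fun y => pairing y T) x =
      pairing (Function.update (Function.update x p 1) q 0) T
      - pairing (Function.update (Function.update x p 0) q 0) T
      + x q * pderiv p (pderiv q (fun y => pairing y T)) x := by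
  have h : ∀ s, pairing (Function.update x p s) T =
      pairing (Function.update (Function.update x p s) q 0) T
      + x q * (pairing (Function.update (Function.update x p s) q 1) T
        - pairing (Function.update (Function.update x p s) q 0) T) := by
    intro s
    rw [← pairing_update, ← Function.update_of_ne (Ne.symm hpq) s x, Function.update_eq_self]
  rw [pderiv_pairing, pderiv_pderiv_pairing hpq, h, h]
  ring

theorem pderiv_pairing_comm {ι : Type} [Fintype ι] [DecidableEq ι] (p q : ι)
    (x : ι → ℝ) (T : Tensor ι) :
    pderiv p (pderiv q (fun y => pairing y T)) x = pderiv q (pderiv p (fun y => pairing y T)) x := by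
  by_cases hpq : p = q
  · rw [hpq]
  · rw [pderiv_pderiv_pairing hpq, pderiv_pderiv_pairing (Ne.symm hpq)]
    simp only [Function.update_comm hpq]
    ring

/-- An Euler–Poisson–Darboux equation: as a function of x_p and x_q the momentum is symmetric and
affine in each, f = A + B(x_p + x_q) + C x_p x_q, so ∂_q f - ∂_p f = C (x_p - x_q). -/
theorem mixed_pderiv_same (v : structureSpace (twoPointTensors d π₁ π₂)) {p q : Slot d}
    (hpq : p ≠ q) (hfst : p.1 = q.1) (x : Slot d → ℝ) :
    (x p - x q) * pderiv p (pderiv q (fun y => pairing y (v : Tensor (Slot d)))) x =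
      pderiv q (fun y => pairing y (v : Tensor (Slot d))) x
      - pderiv p (fun y => pairing y (v : Tensor (Slot d))) x := by
  rw [pderiv_pairing_left hpq, pderiv_pairing_left (Ne.symm hpq), pderiv_pairing_comm q p]
  have h := pairing_swap π₁ π₂ v hfst (Function.update (Function.update x p 1) q 0)
  have h1 : (fun r => Function.update (Function.update x p 1) q 0 (Equiv.swap p q r)) =
      Function.update (Function.update x q 1) p 0 := by
    funext r
    by_cases h1 : r = p
    · subst h1
      simp
    · by_cases h2 : r = q
      · subst h2
        simp [Function.update_of_ne hpq, Function.update_of_ne (Ne.symm hpq)]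
      · simp [Equiv.swap_apply_of_ne_of_ne h1 h2, Function.update_of_ne h1,
          Function.update_of_ne h2]
  rw [h1] at h
  rw [h, Function.update_comm hpq 0 0]
  ring

/-- The i-th summand of 𝔥 involves only the coordinates of group i and, for the last group, those of
the first group through Γ_k. Thus no summand sees both coordinates unless the groups are the first
and the last. -/
theorem mixed_pderiv_zero (v : structureSpace (twoPointTensors d π₁ π₂)) {p q : Slot d}
    (hfst : p.1 ≠ q.1) (h1 : ¬ (q.1 = Fin.last (n + 2) ∧ p.1 = 0))
    (h2 : ¬ (p.1 = Fin.last (n + 2) ∧ q.1 = 0)) (x : Slot d → ℝ) :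
    pderiv p (pderiv q (fun y => pairing y (v : Tensor (Slot d)))) x = 0 := by
  have hpq : p ≠ q := fun h => hfst (h ▸ rfl)
  rw [pderiv_pderiv_pairing hpq]
  obtain ⟨T, hT⟩ := v
  refine Submodule.iSup_induction _ (motive := fun T =>
      pairing (Function.update (Function.update x p 1) q 1) T
      - pairing (Function.update (Function.update x p 0) q 1) T
      - pairing (Function.update (Function.update x p 1) q 0) T
      + pairing (Function.update (Function.update x p 0) q 0) T = 0) hT ?_ (by simp)
      (fun a b ha hb => by simp only [map_add]; linear_combination ha + hb)
  rintro i _ ⟨S, hS, rfl⟩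
  by_cases hp : p.1 ≠ i ∧ ¬ (i = Fin.last (n + 2) ∧ p.1 = 0)
  · simp only [Function.update_comm hpq, pairing_ins_update π₁ π₂ hp.1 hp.2]
    ring
  · have hq : q.1 ≠ i ∧ ¬ (i = Fin.last (n + 2) ∧ q.1 = 0) := by
      constructor
      · rintro rfl
        tauto
      · rintro ⟨rfl, h0⟩
        apply hp
        constructor
        · exact fun h => h2 ⟨h, h0⟩
        · exact fun h => hfst (h.2.trans h0.symm)
    simp only [pairing_ins_update π₁ π₂ hq.1 hq.2]
    ring

/-- Only the last summand of 𝔥 depends on x_q, and in it x_p occurs solely through the factor ℓ(x_p)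
of ⟨x̂,Γ_k⟩. Hence ∂_q f is ℓ(x_p) times a function independent of x_p. -/
theorem mixed_pderiv_zero_last (v : structureSpace (twoPointTensors d π₁ π₂)) {p q : Slot d}
    (hq : q.1 = Fin.last (n + 2)) (hp : p.1 = 0) (x : Slot d → ℝ) :
    (π₁ + π₂ * x p) * pderiv p (pderiv q (fun y => pairing y (v : Tensor (Slot d)))) x =
      π₂ * pderiv q (fun y => pairing y (v : Tensor (Slot d))) x := by
  have hpq : p ≠ q := by
    rintro rfl
    exact last_ne_zero' (hq.symm.trans hp)
  rw [pderiv_pairing_left (Ne.symm hpq), pderiv_pairing_comm q p]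
  suffices h : π₁ * pderiv p (pderiv q (fun y => pairing y (v : Tensor (Slot d)))) x =
      π₂ * (pairing (Function.update (Function.update x q 1) p 0) (v : Tensor (Slot d))
        - pairing (Function.update (Function.update x q 0) p 0) (v : Tensor (Slot d))) by
    linear_combination h
  rw [pderiv_pderiv_pairing hpq]
  obtain ⟨T, hT⟩ := v
  refine Submodule.iSup_induction _ (motive := fun T =>
      π₁ * (pairing (Function.update (Function.update x p 1) q 1) T
      - pairing (Function.update (Function.update x p 0) q 1) T
      - pairing (Function.update (Function.update x p 1) q 0) T
      + pairing (Function.update (Function.update x p 0) q 0) T) =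
      π₂ * (pairing (Function.update (Function.update x q 1) p 0) T
        - pairing (Function.update (Function.update x q 0) p 0) T)) hT ?_ (by simp)
      (fun a b ha hb => by simp only [map_add]; linear_combination ha + hb)
  rintro i _ ⟨S, hS, rfl⟩
  by_cases hi : i = Fin.last (n + 2)
  · subst hi
    have hN : ∀ s t, pairing (Function.update (Function.update x q t) p s)
        (ins _ (twoPointTensors d π₁ π₂ _) S) =
        pairing (fun r : {r : Slot d // r.1 = Fin.last (n + 2)} => Function.update x q t r) S
          * ((π₁ + π₂ * s) * (hatPairing_update π₁ π₂ x p (Fin.last (n + 2))).choose) := by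
      intro s t
      have h3 := (hatPairing_update π₁ π₂ x p (Fin.last (n + 2))).choose_spec s
      rw [if_pos ⟨rfl, hp⟩] at h3
      rw [← h3, pairing_ins, pairing_restrict_update (fun h => hpq (by
        exact absurd (h.symm.trans hp) last_ne_zero'))]
      congr 1
      rw [Function.update_comm (Ne.symm hpq)]
      refine hatPairing_update_of_not π₁ π₂ _ q _ t fun h => last_ne_zero' (hq.symm.trans h.2)
    simp only [Function.update_comm hpq, hN]
    ring
  · simp only [← Function.update_comm hpq]
    have hqi : q.1 ≠ i := fun h => hi (h.symm.trans hq)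
    simp only [pairing_ins_update π₁ π₂ hqi (fun h => hi h.1)]
    ring

/-- The coefficients do not depend on `v`. This uniformity lets the system pass to the quotients
⟨μ,v⟩/⟨μ,β⟩. -/
theorem mixed_pderiv (v : structureSpace (twoPointTensors d π₁ π₂)) {p q : Slot d}
    (hpq : p ≠ q) {x : Slot d → ℝ} (h1 : p.1 = q.1 → x p ≠ x q)
    (h2 : ∀ r : Slot d, r.1 = 0 → π₁ + π₂ * x r ≠ 0) :
    pderiv p (pderiv q (fun y => pairing y (v : Tensor (Slot d)))) x =
      crossDeriv π₁ π₂ q p x * pderiv q (fun y => pairing y (v : Tensor (Slot d))) x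
      + crossDeriv π₁ π₂ p q x * pderiv p (fun y => pairing y (v : Tensor (Slot d))) x := by
  by_cases hfst : p.1 = q.1
  · rw [crossDeriv, crossDeriv, if_pos hfst, if_pos hfst.symm]
    have h3 := mixed_pderiv_same π₁ π₂ v hpq hfst x
    have h4 : x p - x q ≠ 0 := sub_ne_zero.2 (h1 hfst)
    have h5 : x q - x p = -(x p - x q) := by ring
    rw [h5]
    field_simp
    linear_combination h3
  · rw [crossDeriv, crossDeriv, if_neg hfst, if_neg (Ne.symm hfst)]
    by_cases h3 : q.1 = Fin.last (n + 2) ∧ p.1 = 0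
    · have h4 : ¬ (p.1 = Fin.last (n + 2) ∧ q.1 = 0) :=
        fun h => last_ne_zero' (h.1.symm.trans h3.2)
      rw [if_pos h3, if_neg h4]
      have h5 := mixed_pderiv_zero_last π₁ π₂ v h3.1 h3.2 x
      have h6 := h2 p h3.2
      field_simp
      linear_combination h5
    · by_cases h4 : p.1 = Fin.last (n + 2) ∧ q.1 = 0
      · rw [if_neg h3, if_pos h4]
        have h5 := mixed_pderiv_zero_last π₁ π₂ v h4.1 h4.2 x
        rw [pderiv_pairing_comm] at h5
        have h6 := h2 q h4.2
        field_simp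
        linear_combination h5
      · rw [if_neg h3, if_neg h4, mixed_pderiv_zero π₁ π₂ v hfst h3 h4]
        ring

end TwoPoint

end SegreVeronese

/-! ### Logarithmic derivatives of the denominators, and the factorization curves. -/

namespace Chart

theorem differentiableAt_fun_prod {ι κ : Type} [Fintype ι] (s : Finset κ)
    {f : κ → (ι → ℝ) → ℝ} {x : ι → ℝ} (hf : ∀ j ∈ s, DifferentiableAt ℝ (f j) x) :
    DifferentiableAt ℝ (fun y => ∏ j ∈ s, f j y) x := by
  classical
  induction s using Finset.induction_on with
  | empty => simp
  | insert a s ha ih =>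
    simp only [Finset.prod_insert ha]
    exact (hf a (Finset.mem_insert_self a s)).fun_mul
      (ih fun j hj => hf j (Finset.mem_insert_of_mem hj))

theorem pderiv_fun_prod {ι κ : Type} [Fintype ι] [DecidableEq ι] {i : ι} (s : Finset κ)
    {f : κ → (ι → ℝ) → ℝ} {g : κ → ℝ} {x : ι → ℝ}
    (hf : ∀ j ∈ s, DifferentiableAt ℝ (f j) x) (hg : ∀ j ∈ s, pderiv i (f j) x = f j x * g j) :
    pderiv i (fun y => ∏ j ∈ s, f j y) x = (∏ j ∈ s, f j x) * ∑ j ∈ s, g j := by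
  classical
  induction s using Finset.induction_on with
  | empty => simp [pderiv_fun_const]
  | insert a s ha ih =>
    have h1 := ih (fun j hj => hf j (Finset.mem_insert_of_mem hj))
      (fun j hj => hg j (Finset.mem_insert_of_mem hj))
    simp only [Finset.prod_insert ha, Finset.sum_insert ha]
    rw [pderiv_fun_mul (hf a (Finset.mem_insert_self a s))
      (differentiableAt_fun_prod s fun j hj => hf j (Finset.mem_insert_of_mem hj)), h1,
      hg a (Finset.mem_insert_self a s)]
    ring

end Chart

namespace SegreVeronese

open Chart

section Denominator

variable {n : ℕ} {d : Fin (n + 3) → ℕ} (π₁ π₂ : ℝ)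

theorem differentiable_hatPairing (i : Fin (n + 3)) :
    Differentiable ℝ (fun x : Slot d → ℝ => hatPairing (twoPointTensors d π₁ π₂) x i) := by
  simp only [hatPairing_eq]
  refine fun x => differentiableAt_fun_prod _ fun q _ => ?_
  split_ifs <;> fun_prop

theorem pderiv_hatPairing (i : Fin (n + 3)) (p : Slot d) {x : Slot d → ℝ}
    (hp : p.1 = 0 → π₁ + π₂ * x p ≠ 0) :
    pderiv p (fun x : Slot d → ℝ => hatPairing (twoPointTensors d π₁ π₂) x i) x =
      hatPairing (twoPointTensors d π₁ π₂) x i *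
        if i = Fin.last (n + 2) ∧ p.1 = 0 then π₂ / (π₁ + π₂ * x p) else 0 := by
  simp only [hatPairing_eq]
  rw [pderiv_fun_prod Finset.univ (g := fun q => if q = p then
    if i = Fin.last (n + 2) ∧ p.1 = 0 then π₂ / (π₁ + π₂ * x p) else 0 else 0)]
  · simp
  · intro q _
    split_ifs <;> fun_prop
  · intro q _
    rw [pderiv_ite, pderiv_fun_const, pderiv_fun_add (by fun_prop) (by fun_prop), pderiv_fun_const,
      pderiv_fun_const_mul _ (by fun_prop), pderiv_coord]
    by_cases hq : q = p
    · subst hq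
      by_cases h : i = Fin.last (n + 2) ∧ q.1 = 0
      · have := hp h.2
        simp only [h, and_self, if_true]
        field_simp
        ring
      · simp only [h, if_true, if_false]
        ring
    · simp [hq, Ne.symm hq]

theorem differentiable_vandermonde {k : ℕ} {d : Fin k → ℕ} (q : Slot d) :
    Differentiable ℝ (fun x : Slot d → ℝ => vandermonde x q) := by
  unfold vandermonde
  fun_prop

theorem pderiv_vandermonde {k : ℕ} {d : Fin k → ℕ} (p q : Slot d) {x : Slot d → ℝ}
    (hq : vandermonde x q ≠ 0) :
    pderiv p (fun x : Slot d → ℝ => vandermonde x q) x = vandermonde x q *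
      ∑ r : Slot d with r.1 = q.1 ∧ r ≠ q,
        ((if p = q then 1 else 0) - (if p = r then 1 else 0)) / (x q - x r) := by
  unfold vandermonde at hq ⊢
  rw [pderiv_fun_prod _ (fun r _ => by fun_prop)]
  intro r hr
  rw [pderiv_fun_sub (by fun_prop) (by fun_prop), pderiv_coord, pderiv_coord]
  have h := Finset.prod_ne_zero_iff.1 hq r hr
  field_simp

/-- `Δ_q ⟨x̂, Γ⟩`. -/
def denom (q : Slot d) (x : Slot d → ℝ) : ℝ :=
  vandermonde x q * hatPairing (twoPointTensors d π₁ π₂) x q.1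

/-- The logarithmic derivative of `Δ_p ⟨x̂, Γ⟩` in the direction `p`. -/
def selfDeriv {k : ℕ} {d : Fin k → ℕ} (p : Slot d) (x : Slot d → ℝ) : ℝ :=
  ∑ r : Slot d with r.1 = p.1 ∧ r ≠ p, 1 / (x p - x r)

theorem differentiable_denom (q : Slot d) : Differentiable ℝ (denom π₁ π₂ q) :=
  (differentiable_vandermonde q).mul (differentiable_hatPairing π₁ π₂ q.1)

theorem pderiv_denom {p q : Slot d} (hpq : q ≠ p) {x : Slot d → ℝ} (hq : vandermonde x q ≠ 0)
    (hp : p.1 = 0 → π₁ + π₂ * x p ≠ 0) :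
    pderiv p (denom π₁ π₂ q) x = denom π₁ π₂ q x * crossDeriv π₁ π₂ q p x := by
  unfold denom
  rw [pderiv_fun_mul (differentiable_vandermonde q x) (differentiable_hatPairing π₁ π₂ q.1 x),
    pderiv_hatPairing π₁ π₂ _ _ hp, pderiv_vandermonde _ _ hq]
  have h : ∑ r : Slot d with r.1 = q.1 ∧ r ≠ q,
        ((if p = q then 1 else 0) - (if p = r then 1 else 0)) / (x q - x r) =
        if q.1 = p.1 then 1 / (x p - x q) else 0 := by
    rw [Finset.sum_filter, Finset.sum_eq_single p]
    · have h1 : x q - x p = -(x p - x q) := by ring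
      simp only [Ne.symm hpq, if_false, if_true, ne_eq, not_false_eq_true, and_true, eq_comm, h1]
      split_ifs
      · rw [div_neg, zero_sub, neg_div, neg_neg]
      · rfl
    · intro r _ hr
      simp [Ne.symm hr, Ne.symm hpq]
    · simp
  rw [h, crossDeriv]
  by_cases hfst : q.1 = p.1
  · have h1 : ¬ (q.1 = Fin.last (n + 2) ∧ p.1 = 0) :=
      fun h => last_ne_zero' (h.1.symm.trans (hfst.trans h.2))
    rw [if_pos hfst, if_neg h1, if_pos hfst]
    ring
  · rw [if_neg hfst, if_neg hfst]
    ring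

theorem pderiv_denom_self (p : Slot d) {x : Slot d → ℝ} (hq : vandermonde x p ≠ 0)
    (hp : p.1 = 0 → π₁ + π₂ * x p ≠ 0) :
    pderiv p (denom π₁ π₂ p) x = denom π₁ π₂ p x * selfDeriv p x := by
  unfold denom
  rw [pderiv_fun_mul (differentiable_vandermonde p x) (differentiable_hatPairing π₁ π₂ p.1 x),
    pderiv_hatPairing π₁ π₂ _ _ hp, pderiv_vandermonde _ _ hq,
    if_neg (c := p.1 = Fin.last (n + 2) ∧ p.1 = 0) fun h => last_ne_zero' (h.1.symm.trans h.2)]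
  have h : ∑ r : Slot d with r.1 = p.1 ∧ r ≠ p,
        ((if p = p then 1 else 0) - (if p = r then 1 else 0)) / (x p - x r) = selfDeriv p x := by
    refine Finset.sum_congr rfl fun r hr => ?_
    rw [if_pos rfl, if_neg (Ne.symm (Finset.mem_filter.1 hr).2.2), sub_zero]
  rw [h]
  ring

/-- Besides the Vandermonde part, each of the d_k slots of the last group has the factor ℓ(x_p) in
its denominator when `p` lies in the first group. This is the origin of the weight ℓ^{d_k}. -/
theorem sum_crossDeriv (p : Slot d) (x : Slot d → ℝ) :
    ∑ q ∈ Finset.univ.erase p, crossDeriv π₁ π₂ q p x = selfDeriv p x +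
      if p.1 = 0 then d (Fin.last (n + 2)) * (π₂ / (π₁ + π₂ * x p)) else 0 := by
  have h : ∀ q : Slot d, crossDeriv π₁ π₂ q p x =
      (if q.1 = p.1 then 1 / (x p - x q) else 0)
      + (if q.1 = Fin.last (n + 2) then if p.1 = 0 then π₂ / (π₁ + π₂ * x p) else 0 else 0) := by
    intro q
    rw [crossDeriv]
    by_cases h1 : q.1 = p.1
    · by_cases h2 : q.1 = Fin.last (n + 2)
      · have h3 : p.1 ≠ 0 := fun h => last_ne_zero' (h2.symm.trans (h1.trans h))
        simp [h1, h3]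
      · simp [h2]
    · rw [if_neg h1, if_neg h1, zero_add]
      by_cases h2 : q.1 = Fin.last (n + 2) <;> simp [h2]
  rw [Finset.sum_congr rfl fun q _ => h q, Finset.sum_add_distrib]
  congr 1
  · rw [selfDeriv, ← Finset.sum_filter]
    refine Finset.sum_congr ?_ fun _ _ => rfl
    ext q
    simp [and_comm]
  · by_cases hp : p.1 = 0
    · simp only [hp, if_true]
      have h1 : (Finset.univ.erase p).filter (fun q : Slot d => q.1 = Fin.last (n + 2)) =
          Finset.univ.filter (fun q : Slot d => q.1 = Fin.last (n + 2)) := by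
        ext q
        simp only [Finset.mem_filter, Finset.mem_erase, Finset.mem_univ, and_true, true_and,
          and_iff_right_iff_imp]
        rintro hq rfl
        exact last_ne_zero' (hq.symm.trans hp)
      have h2 : (Finset.univ.filter (fun q : Slot d => q.1 = Fin.last (n + 2))).card
          = d (Fin.last (n + 2)) := by
        rw [Finset.card_filter, Fintype.sum_sigma, Fintype.sum_eq_single (Fin.last (n + 2))]
        · simp
        · intro i hi
          simp [hi]
      rw [← Finset.sum_filter, h1, Finset.sum_const, h2, nsmul_eq_mul]
    · simp [hp]

theorem differentiableAt_crossDeriv {p q : Slot d} {x : Slot d → ℝ}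
    (h1 : q.1 = p.1 → x p ≠ x q) (hp : p.1 = 0 → π₁ + π₂ * x p ≠ 0) :
    DifferentiableAt ℝ (crossDeriv π₁ π₂ q p) x := by
  unfold crossDeriv
  split_ifs with h2 h3
  · exact differentiableAt_fun_div (by fun_prop) (by fun_prop) (sub_ne_zero.2 (h1 h2))
  · exact differentiableAt_fun_div (by fun_prop) (by fun_prop) (hp h3.2)
  · fun_prop

theorem pderiv_crossDeriv {p q : Slot d} (hpq : q ≠ p) {x : Slot d → ℝ}
    (h1 : q.1 = p.1 → x p ≠ x q) (hp : p.1 = 0 → π₁ + π₂ * x p ≠ 0) :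
    pderiv p (crossDeriv π₁ π₂ q p) x = -crossDeriv π₁ π₂ q p x ^ 2 := by
  unfold crossDeriv
  by_cases h2 : q.1 = p.1
  · have h3 := sub_ne_zero.2 (h1 h2)
    simp only [if_pos h2]
    rw [pderiv_fun_div (by fun_prop) (by fun_prop) h3, pderiv_fun_const,
      pderiv_fun_sub (by fun_prop) (by fun_prop), pderiv_coord, pderiv_coord, if_pos rfl,
      if_neg (Ne.symm hpq)]
    field_simp
    ring
  · simp only [if_neg h2]
    by_cases h3 : q.1 = Fin.last (n + 2) ∧ p.1 = 0
    · have h4 := hp h3.2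
      simp only [if_pos h3]
      rw [pderiv_fun_div (by fun_prop) (by fun_prop) h4, pderiv_fun_const,
        pderiv_fun_add (by fun_prop) (by fun_prop), pderiv_fun_const,
        pderiv_fun_const_mul _ (by fun_prop), pderiv_coord, if_pos rfl]
      field_simp
      ring
    · simp only [if_neg h3, pderiv_fun_const]
      ring

theorem differentiableAt_selfDeriv {k : ℕ} {d : Fin k → ℕ} {p : Slot d} {x : Slot d → ℝ}
    (h1 : ∀ r : Slot d, r.1 = p.1 → r ≠ p → x p ≠ x r) :
    DifferentiableAt ℝ (selfDeriv p) x := by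
  unfold selfDeriv
  refine DifferentiableAt.fun_sum fun r hr => ?_
  have h2 := (Finset.mem_filter.1 hr).2
  exact differentiableAt_fun_div (by fun_prop) (by fun_prop) (sub_ne_zero.2 (h1 r h2.1 h2.2))

theorem vandermonde_ne_zero_iff {k : ℕ} {d : Fin k → ℕ} {p : Slot d} {x : Slot d → ℝ} :
    vandermonde x p ≠ 0 ↔ ∀ r : Slot d, r.1 = p.1 → r ≠ p → x p ≠ x r := by
  rw [vandermonde, Finset.prod_ne_zero_iff]
  refine forall_congr' fun r => ?_
  rw [Finset.mem_filter, sub_ne_zero]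
  simp only [Finset.mem_univ, true_and, and_imp]

end Denominator

section Curve

variable {k : ℕ} {d : Fin k → ℕ} (Γ : ∀ i : Fin k, Tensor {q : Slot d // ¬ q.1 = i})

/-- The functional extends to the whole tensor space, and multilinear expansion of (s, -1) = s(1, 0)
+ (0, -1) in all slots gives a polynomial in `s`. This covers the coordinates of the curve in an
arbitrary basis. -/
theorem differentiable_linear_curve (φ : structureSpace Γ →ₗ[ℝ] ℝ) (q : Slot d) :
    Differentiable ℝ (fun s => φ (curve Γ q s)) := by
  obtain ⟨ψ, hψ⟩ := φ.exists_extend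
  set M : MultilinearMap ℝ (fun _ : {r : Slot d // r.1 = q.1} => Fin 2 → ℝ) ℝ :=
    (ψ ∘ₗ ins q.1 (Γ q.1)).compMultilinearMap (PiTensorProduct.tprod ℝ) with hM
  have h : (fun s => φ (curve Γ q s)) = fun s => M fun _ => ![s, -1] := by
    funext s
    rw [← hψ]
    rfl
  have hv : ∀ s : ℝ, (![s, -1] : Fin 2 → ℝ) = s • ![1, 0] + ![0, -1] := by
    intro s
    ext i
    fin_cases i <;> simp
  have h2 : ∀ s : ℝ, (M fun _ => ![s, -1]) =
      ∑ t : Finset {r : Slot d // r.1 = q.1},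
        s ^ t.card * M (t.piecewise (fun _ => ![1, 0]) (fun _ => ![0, -1])) := by
    intro s
    have h3 : (fun _ : {r : Slot d // r.1 = q.1} => (![s, -1] : Fin 2 → ℝ)) =
        (fun _ => s • ![1, 0]) + fun _ => ![0, -1] := funext fun _ => hv s
    rw [h3, M.map_add_univ]
    refine Finset.sum_congr rfl fun t _ => ?_
    have h4 := M.map_piecewise_smul (fun _ => s)
      (t.piecewise (fun _ => ![1, 0]) (fun _ => ![0, -1])) t
    rw [Finset.prod_const, smul_eq_mul] at h4
    rw [← h4]
    congr 1
    funext r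
    by_cases hr : r ∈ t <;> simp [hr]
  rw [h]
  simp only [h2]
  fun_prop

theorem pairing_curve (q : Slot d) (s : ℝ) (x : Slot d → ℝ) :
    pairing x (curve Γ q s : Tensor (Slot d)) =
      (∏ r : Slot d with r.1 = q.1, (s - x r)) * hatPairing Γ x q.1 := by
  rw [curve, pairing_ins, pairing_tprod, hatPairing]
  congr 1
  rw [Finset.prod_subtype (Finset.univ.filter fun r : Slot d => r.1 = q.1)
    (p := fun r => r.1 = q.1) (by simp)]
  refine Finset.prod_congr rfl fun r _ => ?_
  simp
  ring

end Curve

end SegreVeronese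

/-! ### The separable geometry satisfies the structure equations. -/

namespace SegreVeronese

open Chart

section Separable

variable {n : ℕ} {d : Fin (n + 3) → ℕ} {π₁ π₂ : ℝ}

/-- The logarithmic derivative of `⟨μ, β⟩`. -/
def logPairingDeriv (β : structureSpace (twoPointTensors d π₁ π₂)) (p : Slot d) (x : Slot d → ℝ) :
    ℝ :=
  pderiv p (fun y => pairing y (β : Tensor (Slot d))) x / pairing x (β : Tensor (Slot d))

/-- The logarithmic derivative in the direction `p` of the profile at `q`; here `y q` is the
logarithmic derivative of `A q`. -/
def profileLogDeriv (β : structureSpace (twoPointTensors d π₁ π₂)) (y : Slot d → ℝ → ℝ)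
    (q p : Slot d) (x : Slot d → ℝ) : ℝ :=
  logPairingDeriv β p x
    + if q = p then y p (x p) - selfDeriv p x else -crossDeriv π₁ π₂ q p x

/-- The Jacobian matrix of the momentum coordinates. -/
def momentumMatrix (β : structureSpace (twoPointTensors d π₁ π₂))
    (B : Module.Basis (Option (Slot d)) ℝ (structureSpace (twoPointTensors d π₁ π₂)))
    (x : Slot d → ℝ) : Matrix (Slot d) (Slot d) ℝ :=
  Matrix.of fun q a => dMomentum (twoPointTensors d π₁ π₂) β q (B (some a)) x

/-- The inverse of the Jacobian matrix of the momentum coordinates. -/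
def momentumInverse (β : structureSpace (twoPointTensors d π₁ π₂))
    (B : Module.Basis (Option (Slot d)) ℝ (structureSpace (twoPointTensors d π₁ π₂)))
    (x : Slot d → ℝ) : Matrix (Slot d) (Slot d) ℝ :=
  Matrix.of fun a q => -(B.repr (curve (twoPointTensors d π₁ π₂) q (x q)) (some a)
    * pairing x (β : Tensor (Slot d)) / denom π₁ π₂ q x)

variable {β : structureSpace (twoPointTensors d π₁ π₂)}

theorem dMomentum_eq {x : Slot d → ℝ} (hβ : pairing x (β : Tensor (Slot d)) ≠ 0) (p : Slot d)
    (v : structureSpace (twoPointTensors d π₁ π₂)) :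
    dMomentum (twoPointTensors d π₁ π₂) β p v x =
      (pderiv p (fun y => pairing y (v : Tensor (Slot d))) x * pairing x (β : Tensor (Slot d))
        - pairing x (v : Tensor (Slot d)) * pderiv p (fun y => pairing y (β : Tensor (Slot d))) x)
        / pairing x (β : Tensor (Slot d)) ^ 2 :=
  pderiv_fun_div (differentiable_pairing _ x) (differentiable_pairing _ x) hβ

/-- `v ↦ ⟨∂_p μ_β, v⟩` as a linear map. -/
theorem dMomentum_linear {x : Slot d → ℝ} (hβ : pairing x (β : Tensor (Slot d)) ≠ 0) (p : Slot d) :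
    ∃ L : structureSpace (twoPointTensors d π₁ π₂) →ₗ[ℝ] ℝ,
      ∀ v, L v = dMomentum (twoPointTensors d π₁ π₂) β p v x := by
  refine ⟨(pairing x (β : Tensor (Slot d)) ^ 2)⁻¹ • ((pairing x (β : Tensor (Slot d)) •
    (pairing (Function.update x p 1) - pairing (Function.update x p 0))
    - pderiv p (fun y => pairing y (β : Tensor (Slot d))) x • pairing x) ∘ₗ
      (structureSpace (twoPointTensors d π₁ π₂)).subtype), fun v => ?_⟩
  rw [dMomentum_eq hβ, pderiv_pairing p x (v : Tensor (Slot d))]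
  simp only [LinearMap.smul_apply, LinearMap.comp_apply, LinearMap.sub_apply, smul_eq_mul,
    Submodule.subtype_apply]
  field_simp

theorem dMomentum_self {x : Slot d → ℝ} (hβ : pairing x (β : Tensor (Slot d)) ≠ 0) (p : Slot d) :
    dMomentum (twoPointTensors d π₁ π₂) β p β x = 0 := by
  rw [dMomentum_eq hβ]
  ring

/-- The component along `β` drops out because ⟨μ_β, β⟩ is the constant 1. -/
theorem sum_dMomentum
    {B : Module.Basis (Option (Slot d)) ℝ (structureSpace (twoPointTensors d π₁ π₂))}
    (hB : B none = β) {x : Slot d → ℝ} (hβ : pairing x (β : Tensor (Slot d)) ≠ 0) (p : Slot d)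
    (v : structureSpace (twoPointTensors d π₁ π₂)) :
    ∑ a, dMomentum (twoPointTensors d π₁ π₂) β p (B (some a)) x * B.repr v (some a) =
      dMomentum (twoPointTensors d π₁ π₂) β p v x := by
  obtain ⟨L, hL⟩ := dMomentum_linear hβ p
  simp only [← hL]
  conv_rhs => rw [← B.sum_repr v, Fintype.sum_option, hB, map_add, map_smul, hL β,
    dMomentum_self hβ, smul_zero, zero_add, map_sum]
  refine Finset.sum_congr rfl fun a _ => ?_
  rw [map_smul, smul_eq_mul, mul_comm]

/-- At y = x the function ⟨μ(y), ψ_q(x_q)⟩ vanishes through its factor x_q - y_q, so only the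
derivative in direction `q` survives. The factorization curves thereby invert the Jacobian of the
momenta explicitly. -/
theorem dMomentum_curve {x : Slot d → ℝ} (hβ : pairing x (β : Tensor (Slot d)) ≠ 0)
    (p q : Slot d) :
    dMomentum (twoPointTensors d π₁ π₂) β p (curve (twoPointTensors d π₁ π₂) q (x q)) x =
      if p = q then -(denom π₁ π₂ q x / pairing x (β : Tensor (Slot d))) else 0 := by
  have h1 : ∀ y : Slot d → ℝ,
      pairing y (curve (twoPointTensors d π₁ π₂) q (x q) : Tensor (Slot d)) = (x q - y q) *
      ((∏ r : Slot d with r.1 = q.1 ∧ r ≠ q, (x q - y r))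
        * hatPairing (twoPointTensors d π₁ π₂) y q.1) := by
    intro y
    rw [pairing_curve, ← mul_assoc]
    congr 1
    have h2 : Finset.univ.filter (fun r : Slot d => r.1 = q.1) =
        insert q (Finset.univ.filter fun r : Slot d => r.1 = q.1 ∧ r ≠ q) := by
      ext r
      by_cases hr : r = q <;> simp [hr]
    rw [h2, Finset.prod_insert (by simp)]
  rw [dMomentum_eq hβ, h1 x, sub_self, zero_mul, zero_mul, sub_zero]
  have hd : DifferentiableAt ℝ (fun y : Slot d → ℝ =>
      (∏ r : Slot d with r.1 = q.1 ∧ r ≠ q, (x q - y r))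
        * hatPairing (twoPointTensors d π₁ π₂) y q.1) x :=
    (differentiableAt_fun_prod _ fun r _ => by fun_prop).fun_mul
      (differentiable_hatPairing π₁ π₂ q.1 x)
  simp only [h1]
  rw [pderiv_fun_mul (by fun_prop) hd, pderiv_fun_sub (by fun_prop) (by fun_prop),
    pderiv_fun_const, pderiv_coord, sub_self, zero_mul, add_zero, denom, vandermonde]
  split_ifs with h
  · field_simp
    ring
  · simp

variable {A : Slot d → ℝ → ℝ} {U : Set (Slot d → ℝ)} {y : Slot d → ℝ → ℝ}

theorem differentiableAt_logPairingDeriv {x : Slot d → ℝ}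
    (hβ : pairing x (β : Tensor (Slot d)) ≠ 0) (p : Slot d) :
    DifferentiableAt ℝ (logPairingDeriv β p) x :=
  differentiableAt_fun_div (differentiable_pderiv_pairing p _ x) (differentiable_pairing _ x) hβ

theorem pderiv_logPairingDeriv {x : Slot d → ℝ}
    (hβ : pairing x (β : Tensor (Slot d)) ≠ 0) (p : Slot d) :
    pderiv p (logPairingDeriv β p) x = -logPairingDeriv β p x ^ 2 := by
  unfold logPairingDeriv
  rw [pderiv_fun_div (differentiable_pderiv_pairing p _ x) (differentiable_pairing _ x) hβ,
    pderiv_pderiv_pairing_self]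
  field_simp
  ring

/-- The structure equations of the separable geometry. -/
theorem isSeparable
    {B : Module.Basis (Option (Slot d)) ℝ (structureSpace (twoPointTensors d π₁ π₂))}
    (hB : B none = β) (hU : IsOpen U) (hreg : IsRegularOn (twoPointTensors d π₁ π₂) β A U)
    (hℓ : ∀ x ∈ U, ∀ r : Slot d, r.1 = 0 → π₁ + π₂ * x r ≠ 0)
    (hA : ∀ x ∈ U, ∀ p, HasDerivAt (A p) (A p (x p) * y p (x p)) (x p))
    (hy : ∀ x ∈ U, ∀ p, DifferentiableAt ℝ (y p) (x p)) :
    IsSeparable U (fun q x => profile (twoPointTensors d π₁ π₂) β A x q) (momentumMatrix β B)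
      (momentumInverse β B) (profileLogDeriv β y) (logPairingDeriv β) := by
  have hβ : ∀ x ∈ U, pairing x (β : Tensor (Slot d)) ≠ 0 := fun x hx => (hreg x hx).1
  have hden : ∀ x ∈ U, ∀ q, denom π₁ π₂ q x ≠ 0 := fun x hx q =>
    mul_ne_zero ((hreg x hx).2 q).1 ((hreg x hx).2 q).2.1
  have hne : ∀ x ∈ U, ∀ p r : Slot d, r.1 = p.1 → r ≠ p → x p ≠ x r := fun x hx p =>
    vandermonde_ne_zero_iff.1 ((hreg x hx).2 p).1
  have hAx : ∀ x ∈ U, ∀ q, DifferentiableAt ℝ (fun z : Slot d → ℝ => A q (z q)) x :=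
    fun x hx q => DifferentiableAt.comp (f := fun z : Slot d → ℝ => z q) x
      (hA x hx q).differentiableAt (differentiableAt_apply q x)
  have hPnum : ∀ x ∈ U, ∀ q, DifferentiableAt ℝ
      (fun z : Slot d → ℝ => A q (z q) * pairing z (β : Tensor (Slot d))) x :=
    fun x hx q => (hAx x hx q).fun_mul (differentiable_pairing _ x)
  have hD : ∀ z ∈ U, ∀ q a, momentumMatrix β B z q a =
      (pderiv q (fun y => pairing y (B (some a) : Tensor (Slot d))) z
        * pairing z (β : Tensor (Slot d)) - pairing z (B (some a) : Tensor (Slot d))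
        * pderiv q (fun y => pairing y (β : Tensor (Slot d))) z)
        / pairing z (β : Tensor (Slot d)) ^ 2 :=
    fun z hz q a => dMomentum_eq (hβ z hz) q _
  have hDnum : ∀ x, ∀ q a, DifferentiableAt ℝ (fun z =>
      pderiv q (fun y => pairing y (B (some a) : Tensor (Slot d))) z
        * pairing z (β : Tensor (Slot d)) - pairing z (B (some a) : Tensor (Slot d))
        * pderiv q (fun y => pairing y (β : Tensor (Slot d))) z) x := fun x q a =>
    ((differentiable_pderiv_pairing q _ x).fun_mul (differentiable_pairing _ x)).fun_sub
      ((differentiable_pairing _ x).fun_mul (differentiable_pderiv_pairing q _ x))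
  have hDden : ∀ x : Slot d → ℝ, DifferentiableAt ℝ
      (fun z => pairing z (β : Tensor (Slot d)) ^ 2) x :=
    fun x => (differentiable_pairing _ x).fun_pow 2
  have hpD : ∀ x ∈ U, ∀ p q a, pderiv p (fun z => momentumMatrix β B z q a) x =
      (((pderiv p (pderiv q fun y => pairing y (B (some a) : Tensor (Slot d))) x
        * pairing x (β : Tensor (Slot d))
        + pderiv q (fun y => pairing y (B (some a) : Tensor (Slot d))) x
          * pderiv p (fun y => pairing y (β : Tensor (Slot d))) x)
        - (pderiv p (fun y => pairing y (B (some a) : Tensor (Slot d))) x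
        * pderiv q (fun y => pairing y (β : Tensor (Slot d))) x
        + pairing x (B (some a) : Tensor (Slot d))
          * pderiv p (pderiv q fun y => pairing y (β : Tensor (Slot d))) x))
          * pairing x (β : Tensor (Slot d)) ^ 2
        - (pderiv q (fun y => pairing y (B (some a) : Tensor (Slot d))) x
        * pairing x (β : Tensor (Slot d)) - pairing x (B (some a) : Tensor (Slot d))
        * pderiv q (fun y => pairing y (β : Tensor (Slot d))) x)
        * (2 * pairing x (β : Tensor (Slot d))
          * pderiv p (fun y => pairing y (β : Tensor (Slot d))) x))
        / (pairing x (β : Tensor (Slot d)) ^ 2) ^ 2 := by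
    intro x hx p q a
    rw [pderiv_congr_on hU hx fun z hz => hD z hz q a,
      pderiv_fun_div (hDnum x q a) (hDden x) (pow_ne_zero 2 (hβ x hx)),
      pderiv_fun_sub
        ((differentiable_pderiv_pairing q _ x).fun_mul (differentiable_pairing _ x))
        ((differentiable_pairing _ x).fun_mul (differentiable_pderiv_pairing q _ x)),
      pderiv_fun_mul (differentiable_pderiv_pairing q _ x) (differentiable_pairing _ x),
      pderiv_fun_mul (differentiable_pairing _ x) (differentiable_pderiv_pairing q _ x)]
    have h2 : pderiv p (fun z => pairing z (β : Tensor (Slot d)) ^ 2) x =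
        2 * pairing x (β : Tensor (Slot d))
          * pderiv p (fun y => pairing y (β : Tensor (Slot d))) x := by
      simp only [pow_two]
      rw [pderiv_fun_mul (differentiable_pairing _ x) (differentiable_pairing _ x)]
      ring
    rw [h2]
  refine
    { isOpen := hU
      ne_zero := fun x hx q => div_ne_zero (mul_ne_zero ((hreg x hx).2 q).2.2 (hβ x hx))
        (hden x hx q)
      diff_P := fun x hx q => differentiableAt_fun_div (hPnum x hx q)
        (differentiable_denom π₁ π₂ q x) (hden x hx q)
      diff_D := fun x hx q a => ?_
      diff_E := fun x hx a q => ?_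
      diff_u := fun x hx q p => ?_
      diff_b := fun x hx p => differentiableAt_logPairingDeriv (hβ x hx) p
      mul_eq_one := fun x hx => ?_
      pderiv_P := fun x hx p q => ?_
      pderiv_D_of_ne := fun x hx p q a hqp => ?_
      pderiv_D_self := fun x hx p a => ?_
      pderiv_u := fun x hx p q hqp => ?_
      pderiv_b := fun x hx p => pderiv_logPairingDeriv (hβ x hx) p }
  · refine (differentiableAt_fun_div (hDnum x q a) (hDden x)
      (pow_ne_zero 2 (hβ x hx))).congr_of_eventuallyEq ?_
    filter_upwards [hU.mem_nhds hx] with z hz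
    exact hD z hz q a
  · have h1 : Differentiable ℝ fun s =>
        B.repr (curve (twoPointTensors d π₁ π₂) q s) (some a) :=
      differentiable_linear_curve (twoPointTensors d π₁ π₂) (B.coord (some a)) q
    have h2 : DifferentiableAt ℝ (fun z : Slot d → ℝ =>
        B.repr (curve (twoPointTensors d π₁ π₂) q (z q)) (some a)) x :=
      DifferentiableAt.comp (f := fun z : Slot d → ℝ => z q) x (h1 (x q))
        (differentiableAt_apply q x)
    exact (differentiableAt_fun_div (h2.fun_mul (differentiable_pairing _ x))
      (differentiable_denom π₁ π₂ q x) (hden x hx q)).fun_neg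
  · unfold profileLogDeriv
    refine (differentiableAt_logPairingDeriv (hβ x hx) p).fun_add ?_
    split_ifs with h
    · refine DifferentiableAt.fun_sub ?_ (differentiableAt_selfDeriv (hne x hx p))
      exact DifferentiableAt.comp (f := fun z : Slot d → ℝ => z p) x (hy x hx p)
        (differentiableAt_apply p x)
    · exact (differentiableAt_crossDeriv π₁ π₂ (fun h' => hne x hx p q h' h) (hℓ x hx p)).fun_neg
  · ext p q
    rw [Matrix.mul_apply]
    have h1 := sum_dMomentum hB (hβ x hx) p (curve (twoPointTensors d π₁ π₂) q (x q))
    rw [dMomentum_curve (hβ x hx)] at h1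
    have h2 : ∑ a, momentumMatrix β B x p a * momentumInverse β B x a q =
        -(pairing x (β : Tensor (Slot d)) / denom π₁ π₂ q x) *
        ∑ a, dMomentum (twoPointTensors d π₁ π₂) β p (B (some a)) x
          * B.repr (curve (twoPointTensors d π₁ π₂) q (x q)) (some a) := by
      rw [Finset.mul_sum]
      refine Finset.sum_congr rfl fun a _ => ?_
      simp only [momentumMatrix, momentumInverse, Matrix.of_apply]
      ring
    rw [h2, h1, Matrix.one_apply]
    have h3 := hβ x hx
    have h4 := hden x hx q
    split_ifs
    · field_simp
    · ring
  · have h0 := hβ x hx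
    have h1 : pderiv p (fun z : Slot d → ℝ => A q (z q)) x =
        if p = q then A q (x q) * y q (x q) else 0 := pderiv_comp_coord q (hA x hx q)
    have h2 : (fun x => profile (twoPointTensors d π₁ π₂) β A x q) =
        fun x => A q (x q) * pairing x (β : Tensor (Slot d)) / denom π₁ π₂ q x := rfl
    have h3 := hden x hx q
    rw [congr_fun h2 x, h2, pderiv_fun_div (hPnum x hx q) (differentiable_denom π₁ π₂ q x) h3,
      pderiv_fun_mul (hAx x hx q) (differentiable_pairing _ x), h1, profileLogDeriv,
      logPairingDeriv]
    by_cases hqp : q = p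
    · subst hqp
      rw [if_pos rfl, if_pos rfl, pderiv_denom_self π₁ π₂ q ((hreg x hx).2 q).1 (hℓ x hx q)]
      field_simp
      ring
    · rw [if_neg (Ne.symm hqp), if_neg hqp,
        pderiv_denom π₁ π₂ hqp ((hreg x hx).2 q).1 (hℓ x hx p)]
      field_simp
      ring
  -- Both the numerator ⟨μ,B_a⟩ and the denominator ⟨μ,β⟩ obey `mixed_pderiv` with the same
  -- coefficients; the quotient rule only shifts these by b_p and b_q.
  · have h0 := hβ x hx
    rw [hpD x hx, hD x hx, hD x hx,
      mixed_pderiv π₁ π₂ _ (Ne.symm hqp) (fun h => hne x hx p q h.symm hqp) (hℓ x hx),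
      mixed_pderiv π₁ π₂ _ (Ne.symm hqp) (fun h => hne x hx p q h.symm hqp) (hℓ x hx),
      profileLogDeriv, profileLogDeriv, if_neg hqp, if_neg (Ne.symm hqp), logPairingDeriv,
      logPairingDeriv]
    field_simp
    ring
  · have h0 := hβ x hx
    rw [hpD x hx, hD x hx, pderiv_pderiv_pairing_self, pderiv_pderiv_pairing_self,
      logPairingDeriv]
    field_simp
    ring
  · have h1 : profileLogDeriv β y q p =
        fun x => logPairingDeriv β p x + -crossDeriv π₁ π₂ q p x := by
      funext x
      rw [profileLogDeriv, if_neg hqp]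
    have h2 := differentiableAt_crossDeriv π₁ π₂ (fun h' => hne x hx p q h' hqp) (hℓ x hx p)
    rw [h1, pderiv_fun_add (differentiableAt_logPairingDeriv (hβ x hx) p) h2.fun_neg,
      pderiv_fun_neg, pderiv_logPairingDeriv (hβ x hx),
      pderiv_crossDeriv π₁ π₂ hqp (fun h' => hne x hx p q h' hqp) (hℓ x hx p)]
    ring

end Separable

end SegreVeronese

/-! ### Scalar curvature of the separable geometry. -/

namespace SegreVeronese

open Chart

section ScalarCurvature

variable {n : ℕ} {d : Fin (n + 3) → ℕ} {π₁ π₂ : ℝ}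

theorem metric_eq_blockMetric (β : structureSpace (twoPointTensors d π₁ π₂))
    (B : Module.Basis (Option (Slot d)) ℝ (structureSpace (twoPointTensors d π₁ π₂)))
    (A : Slot d → ℝ → ℝ) :
    metric (twoPointTensors d π₁ π₂) β B A =
      blockMetric (fun q x => (profile (twoPointTensors d π₁ π₂) β A x q)⁻¹)
        (fibreMetric (fun q x => profile (twoPointTensors d π₁ π₂) β A x q)
          (momentumMatrix β B)) := by
  funext z
  rw [metric, blockMetric]
  congr 1
  · congr 1
    funext p
    rw [profile, inv_div]
  · ext a b
    rw [fibreMetric, Matrix.mul_apply, Matrix.of_apply]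
    refine Finset.sum_congr rfl fun p _ => ?_
    rw [Matrix.mul_diagonal, Matrix.transpose_apply]
    simp only [momentumMatrix, Matrix.of_apply]
    ring

/-- The factor `(π₁ + π₂ s)^{d_k}` of the volume density, for a slot of the first group. -/
def weight (d : Fin (n + 3) → ℕ) (π₁ π₂ : ℝ) (p : Slot d) (s : ℝ) : ℝ :=
  if p.1 = 0 then (π₁ + π₂ * s) ^ d (Fin.last (n + 2)) else 1

theorem isOpen_coordRange {k : ℕ} {d : Fin k → ℕ} {U : Set (Slot d → ℝ)} (hU : IsOpen U)
    (p : Slot d) : IsOpen (coordRange U p) :=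
  isOpenMap_eval p U hU

theorem hasDerivAt_weight (p : Slot d) {s : ℝ} (hs : p.1 = 0 → π₁ + π₂ * s ≠ 0) :
    HasDerivAt (weight d π₁ π₂ p) (weight d π₁ π₂ p s *
      if p.1 = 0 then d (Fin.last (n + 2)) * (π₂ / (π₁ + π₂ * s)) else 0) s := by
  unfold weight
  by_cases hp : p.1 = 0
  · have h0 := hs hp
    simp only [hp, if_true]
    have h1 : HasDerivAt (fun s => π₁ + π₂ * s) π₂ s := by
      simpa using ((hasDerivAt_id s).const_mul π₂).const_add π₁
    refine (h1.fun_pow (d (Fin.last (n + 2)))).congr_deriv ?_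
    rcases Nat.eq_zero_or_pos (d (Fin.last (n + 2))) with h | h
    · simp [h]
    · obtain ⟨m, hm⟩ := Nat.exists_eq_succ_of_ne_zero h.ne'
      rw [hm, Nat.succ_sub_one, pow_succ]
      field_simp
  · simp only [hp, if_false, mul_zero]
    exact hasDerivAt_const _ _

variable {β : structureSpace (twoPointTensors d π₁ π₂)}
  {B : Module.Basis (Option (Slot d)) ℝ (structureSpace (twoPointTensors d π₁ π₂))}
  {A : Slot d → ℝ → ℝ} {U : Set (Slot d → ℝ)} {W W1 W2 : Slot d → ℝ → ℝ}

/-- The logarithmic derivative of `A = W / weight`. -/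
def coeffLogDeriv (d : Fin (n + 3) → ℕ) (π₁ π₂ : ℝ) (W W1 : Slot d → ℝ → ℝ) (p : Slot d)
    (s : ℝ) : ℝ :=
  W1 p s / W p s - if p.1 = 0 then d (Fin.last (n + 2)) * (π₂ / (π₁ + π₂ * s)) else 0

theorem isSeparable_of_weight (hB : B none = β) (hU : IsOpen U)
    (hreg : IsRegularOn (twoPointTensors d π₁ π₂) β A U)
    (hℓ : ∀ x ∈ U, ∀ r : Slot d, r.1 = 0 → π₁ + π₂ * x r ≠ 0)
    (hAW : ∀ p, ∀ s ∈ coordRange U p, A p s * weight d π₁ π₂ p s = W p s)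
    (hW : ∀ p, ∀ s ∈ coordRange U p, HasDerivAt (W p) (W1 p s) s)
    (hW1 : ∀ p, ∀ s ∈ coordRange U p, HasDerivAt (W1 p) (W2 p s) s) :
    IsSeparable U (fun q x => profile (twoPointTensors d π₁ π₂) β A x q) (momentumMatrix β B)
      (momentumInverse β B) (profileLogDeriv β (coeffLogDeriv d π₁ π₂ W W1))
      (logPairingDeriv β) := by
  have hw : ∀ p, ∀ s ∈ coordRange U p, weight d π₁ π₂ p s ≠ 0 := by
    rintro p _ ⟨x, hx, rfl⟩
    unfold weight
    split_ifs with hp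
    · exact pow_ne_zero _ (hℓ x hx p hp)
    · exact one_ne_zero
  have hW0 : ∀ p, ∀ s ∈ coordRange U p, W p s ≠ 0 := by
    rintro p s hs
    rw [← hAW p s hs]
    refine mul_ne_zero ?_ (hw p s hs)
    obtain ⟨x, hx, rfl⟩ := hs
    exact ((hreg x hx).2 p).2.2
  refine isSeparable hB hU hreg hℓ (fun x hx p => ?_) (fun x hx p => ?_)
  · have hs : x p ∈ coordRange U p := ⟨x, hx, rfl⟩
    have h1 := (hW p _ hs).fun_div (hasDerivAt_weight p (hℓ x hx p)) (hw p _ hs)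
    have h2 : HasDerivAt (A p) _ (x p) := h1.congr_of_eventuallyEq (by
      filter_upwards [(isOpen_coordRange hU p).mem_nhds hs] with s hs
      rw [← hAW p s hs, mul_div_cancel_right₀ _ (hw p s hs)])
    refine h2.congr_deriv ?_
    have h3 := hw p _ hs
    have h4 := hW0 p _ hs
    have h5 : A p (x p) = W p (x p) / weight d π₁ π₂ p (x p) := by
      rw [← hAW p _ hs, mul_div_cancel_right₀ _ h3]
    rw [h5, coeffLogDeriv]
    field_simp
  · have hs : x p ∈ coordRange U p := ⟨x, hx, rfl⟩
    unfold coeffLogDeriv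
    refine ((hW1 p _ hs).differentiableAt.fun_div (hW p _ hs).differentiableAt
      (hW0 p _ hs)).fun_sub ?_
    split_ifs with hp
    · have h0 := hℓ x hx p hp
      fun_prop (disch := assumption)
    · fun_prop

/-- The Vandermonde terms cancel between `selfDeriv` and `sum_crossDeriv`, and the remaining term
with ℓ is absorbed by passing from A to W. The coefficient of b_p is 1 - (m - 1) - 4 = -(m + 2),
with m the number of slots. -/
theorem logDetDeriv_eq (p : Slot d) (x : Slot d → ℝ) :
    logDetDeriv (profileLogDeriv β (coeffLogDeriv d π₁ π₂ W W1)) (logPairingDeriv β) p x =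
      W1 p (x p) / W p (x p) - (Fintype.card (Slot d) + 2) * logPairingDeriv β p x := by
  have h1 := sum_crossDeriv π₁ π₂ p x
  have h2 : ∑ q ∈ Finset.univ.erase p,
      profileLogDeriv β (coeffLogDeriv d π₁ π₂ W W1) q p x =
      ∑ q ∈ Finset.univ.erase p, (logPairingDeriv β p x - crossDeriv π₁ π₂ q p x) := by
    refine Finset.sum_congr rfl fun q hq => ?_
    rw [profileLogDeriv, if_neg (Finset.ne_of_mem_erase hq), sub_eq_add_neg]
  have h3 : ((Finset.univ.erase p).card : ℝ) = Fintype.card (Slot d) - 1 := by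
    rw [Finset.card_erase_of_mem (Finset.mem_univ p), Finset.card_univ,
      Nat.cast_sub (Fintype.card_pos_iff.2 ⟨p⟩), Nat.cast_one]
  rw [logDetDeriv, ← Finset.add_sum_erase _ _ (Finset.mem_univ p), h2, Finset.sum_sub_distrib, h1,
    Finset.sum_const, nsmul_eq_mul, h3, profileLogDeriv, if_pos rfl, coeffLogDeriv]
  ring

/-- The scalar curvature of the separable geometry. -/
theorem scalarCurvature_metric (hB : B none = β) (hU : IsOpen U)
    (hreg : IsRegularOn (twoPointTensors d π₁ π₂) β A U)
    (hℓ : ∀ x ∈ U, ∀ r : Slot d, r.1 = 0 → π₁ + π₂ * x r ≠ 0)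
    (hAW : ∀ p, ∀ s ∈ coordRange U p, A p s * weight d π₁ π₂ p s = W p s)
    (hW : ∀ p, ∀ s ∈ coordRange U p, HasDerivAt (W p) (W1 p s) s)
    (hW1 : ∀ p, ∀ s ∈ coordRange U p, HasDerivAt (W1 p) (W2 p s) s)
    {z : Slot d ⊕ Slot d → ℝ} {x : Slot d → ℝ} (hz : (fun p => z (Sum.inl p)) = x) (hx : x ∈ U) :
    scalarCurvature (metric (twoPointTensors d π₁ π₂) β B A) z =
      -∑ p, pairing x (β : Tensor (Slot d)) / (denom π₁ π₂ p x * weight d π₁ π₂ p (x p)) *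
        (W2 p (x p) - 2 * (Fintype.card (Slot d) + 1) * logPairingDeriv β p x * W1 p (x p)
        + (Fintype.card (Slot d) + 1) * (Fintype.card (Slot d) + 2) * logPairingDeriv β p x ^ 2
          * W p (x p)) := by
  have H := isSeparable_of_weight (B := B) hB hU hreg hℓ hAW hW hW1
  rw [metric_eq_blockMetric, H.scalarCurvature_eq hz hx, neg_inj]
  refine Finset.sum_congr rfl fun p _ => ?_
  have hs : x p ∈ coordRange U p := ⟨x, hx, rfl⟩
  have hA0 : A p (x p) ≠ 0 := ((hreg x hx).2 p).2.2
  have hw : weight d π₁ π₂ p (x p) ≠ 0 := by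
    unfold weight
    split_ifs with hp
    · exact pow_ne_zero _ (hℓ x hx p hp)
    · exact one_ne_zero
  have hW0 : W p (x p) ≠ 0 := by
    rw [← hAW p _ hs]
    exact mul_ne_zero hA0 hw
  have hden : denom π₁ π₂ p x ≠ 0 := mul_ne_zero ((hreg x hx).2 p).1 ((hreg x hx).2 p).2.1
  have hβ := (hreg x hx).1
  have h1 : pderiv p (logDetDeriv (profileLogDeriv β (coeffLogDeriv d π₁ π₂ W W1))
      (logPairingDeriv β) p) x = (W2 p (x p) * W p (x p) - W1 p (x p) * W1 p (x p)) / W p (x p) ^ 2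
      + (Fintype.card (Slot d) + 2) * logPairingDeriv β p x ^ 2 := by
    have e : logDetDeriv (profileLogDeriv β (coeffLogDeriv d π₁ π₂ W W1)) (logPairingDeriv β) p =
        fun x => W1 p (x p) / W p (x p) - (Fintype.card (Slot d) + 2) * logPairingDeriv β p x :=
      funext fun x => logDetDeriv_eq p x
    have h2 := (hW1 p _ hs).fun_div (hW p _ hs) hW0
    have h3 : DifferentiableAt ℝ (fun z : Slot d → ℝ => W1 p (z p) / W p (z p)) x :=
      DifferentiableAt.comp (g := fun s => W1 p s / W p s) (f := fun z : Slot d → ℝ => z p) x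
        h2.differentiableAt (differentiableAt_apply p x)
    have h4 := differentiableAt_logPairingDeriv hβ p
    rw [e, pderiv_fun_sub h3 (h4.const_mul _), pderiv_fun_const_mul _ h4,
      pderiv_logPairingDeriv hβ, pderiv_comp_coord (f := fun s => W1 p s / W p s) p h2, if_pos rfl]
    ring
  rw [h1, logDetDeriv_eq]
  have h5 : profile (twoPointTensors d π₁ π₂) β A x p =
      W p (x p) * pairing x (β : Tensor (Slot d)) / (denom π₁ π₂ p x * weight d π₁ π₂ p (x p)) := by
    rw [← hAW p _ hs, profile, denom]
    rw [denom] at hden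
    field_simp
  rw [h5]
  field_simp
  ring

end ScalarCurvature

end SegreVeronese

/-! ### Momenta as Killing potentials. -/

namespace SegreVeronese

open Chart

section Extremality

variable {n : ℕ} {d : Fin (n + 3) → ℕ} {π₁ π₂ : ℝ}
  {β : structureSpace (twoPointTensors d π₁ π₂)}
  {B : Module.Basis (Option (Slot d)) ℝ (structureSpace (twoPointTensors d π₁ π₂))}
  {A : Slot d → ℝ → ℝ} {U : Set (Slot d → ℝ)} {u : Slot d → Slot d → (Slot d → ℝ) → ℝ}
  {b : Slot d → (Slot d → ℝ) → ℝ}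

theorem sum_momentumInverse (hB : B none = β)
    (H : IsSeparable U (fun q x => profile (twoPointTensors d π₁ π₂) β A x q) (momentumMatrix β B)
      (momentumInverse β B) u b)
    {x : Slot d → ℝ} (hx : x ∈ U) (hβ : pairing x (β : Tensor (Slot d)) ≠ 0) (a : Slot d)
    (v : structureSpace (twoPointTensors d π₁ π₂)) :
    ∑ p, momentumInverse β B x a p * dMomentum (twoPointTensors d π₁ π₂) β p v x =
      B.repr v (some a) := by
  have h1 : momentumInverse β B x * momentumMatrix β B x = 1 :=
    mul_eq_one_comm.1 (H.mul_eq_one x hx)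
  have h2 : (momentumMatrix β B x).mulVec (fun a => B.repr v (some a)) =
      fun p => dMomentum (twoPointTensors d π₁ π₂) β p v x :=
    funext fun p => sum_dMomentum hB hβ p v
  have h3 := congr_fun (congr_arg (fun w => (momentumInverse β B x).mulVec w) h2) a
  simp only [Matrix.mulVec_mulVec, h1, Matrix.one_mulVec] at h3
  exact h3.symm

/-- The Hamiltonian vector field of `⟨μ, v⟩ / ⟨μ, β⟩` is the constant vector field
`v mod β`. -/
theorem complexStructure_gradient (hB : B none = β)
    (hreg : IsRegularOn (twoPointTensors d π₁ π₂) β A U)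
    (H : IsSeparable U (fun q x => profile (twoPointTensors d π₁ π₂) β A x q) (momentumMatrix β B)
      (momentumInverse β B) u b) (v : structureSpace (twoPointTensors d π₁ π₂))
    {f : (Slot d ⊕ Slot d → ℝ) → ℝ}
    (hf : ∀ w : Slot d ⊕ Slot d → ℝ, (fun p => w (Sum.inl p)) ∈ U →
      f w = pairing (fun p => w (Sum.inl p)) (v : Tensor (Slot d))
        / pairing (fun p => w (Sum.inl p)) (β : Tensor (Slot d)))
    {z : Slot d ⊕ Slot d → ℝ} (hz : (fun p => z (Sum.inl p)) ∈ U) :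
    (complexStructure (twoPointTensors d π₁ π₂) β B A z).mulVec
      (gradient (metric (twoPointTensors d π₁ π₂) β B A) f z) =
      Sum.elim (fun _ : Slot d => (0 : ℝ)) (fun a => B.repr v (some a)) := by
  set x : Slot d → ℝ := fun p => z (Sum.inl p) with hx
  have hP := H.ne_zero x hz
  have hinv : (metric (twoPointTensors d π₁ π₂) β B A z)⁻¹ = Matrix.fromBlocks
      (Matrix.diagonal fun p => ((profile (twoPointTensors d π₁ π₂) β A x p)⁻¹)⁻¹) 0 0
      (fibreInverse (fun q x => profile (twoPointTensors d π₁ π₂) β A x q)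
        (momentumInverse β B) x) := by
    rw [metric_eq_blockMetric]
    exact blockMetric_inv _ _ (fun p => inv_ne_zero (hP p)) (H.fibreMetric_mul_fibreInverse hz)
  have hl : ∀ p, pderiv (Sum.inl p) f z = dMomentum (twoPointTensors d π₁ π₂) β p v x :=
    fun p => pderiv_inl_congr H.isOpen (F := fun y => pairing y (v : Tensor (Slot d))
      / pairing y (β : Tensor (Slot d))) hf hz p
  have hr : ∀ p, pderiv (Sum.inr p) f z = 0 :=
    fun p => pderiv_inr_congr H.isOpen (F := fun y => pairing y (v : Tensor (Slot d))
      / pairing y (β : Tensor (Slot d))) hf hz p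
  have hgrad : gradient (metric (twoPointTensors d π₁ π₂) β B A) f z =
      Sum.elim (fun p => profile (twoPointTensors d π₁ π₂) β A x p *
        dMomentum (twoPointTensors d π₁ π₂) β p v x) 0 := by
    have h1 : (fun j => pderiv j f z) =
        Sum.elim (fun p => dMomentum (twoPointTensors d π₁ π₂) β p v x) 0 := by
      funext j
      rcases j with p | p
      · exact hl p
      · exact hr p
    rw [Chart.gradient, hinv, h1, Matrix.fromBlocks_mulVec]
    congr 1
    · funext p
      simp [Matrix.mulVec_diagonal]
    · simp
  rw [hgrad, complexStructure, Matrix.fromBlocks_mulVec]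
  congr 1
  · funext p
    simp
  · funext a
    simp only [Sum.elim_comp_inl, Sum.elim_comp_inr, Matrix.mulVec_zero, add_zero, Matrix.mulVec,
      dotProduct, Matrix.of_apply]
    rw [← sum_momentumInverse hB H hz (hreg x hz).1 a v]
    refine Finset.sum_congr rfl fun p _ => ?_
    have hA := ((hreg x hz).2 p).2.2
    rw [momentumInverse, Matrix.of_apply, profile, denom]
    simp only [hx] at hA ⊢
    field_simp

/-- J grad s is a constant combination of the ∂_t, and the metric coefficients do not depend on t,
so its flow consists of isometries. -/
theorem isExtremalGeometry_of_pairing (hB : B none = β)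
    (hreg : IsRegularOn (twoPointTensors d π₁ π₂) β A U)
    (H : IsSeparable U (fun q x => profile (twoPointTensors d π₁ π₂) β A x q) (momentumMatrix β B)
      (momentumInverse β B) u b) (v : structureSpace (twoPointTensors d π₁ π₂))
    (hf : ∀ w : Slot d ⊕ Slot d → ℝ, (fun p => w (Sum.inl p)) ∈ U →
      scalarCurvature (metric (twoPointTensors d π₁ π₂) β B A) w =
        pairing (fun p => w (Sum.inl p)) (v : Tensor (Slot d))
          / pairing (fun p => w (Sum.inl p)) (β : Tensor (Slot d))) :
    IsExtremalGeometry (twoPointTensors d π₁ π₂) β B A U := by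
  have hΩ := isOpen_preimage_base H.isOpen
  refine ⟨?_, fun z hz i j => ?_⟩
  · have hproj : ContDiff ℝ ∞ fun w : Slot d ⊕ Slot d → ℝ => fun p => w (Sum.inl p) := by
      rw [contDiff_pi]
      exact fun p => contDiff_apply ℝ ℝ (Sum.inl p)
    refine ContDiffOn.congr (f := fun w : Slot d ⊕ Slot d → ℝ =>
      pairing (fun p => w (Sum.inl p)) (v : Tensor (Slot d))
          / pairing (fun p => w (Sum.inl p)) (β : Tensor (Slot d))) ?_ hf
    exact ((contDiff_pairing _).comp hproj).contDiffOn.div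
      ((contDiff_pairing _).comp hproj).contDiffOn fun w hw => (hreg _ hw).1
  · have hX : ∀ w ∈ {z : Slot d ⊕ Slot d → ℝ | (fun q => z (Sum.inl q)) ∈ U}, _ :=
      fun w hw => complexStructure_gradient hB hreg H v hf hw
    have hd : ∀ i k, pderiv i (fun w => (complexStructure (twoPointTensors d π₁ π₂) β B A w).mulVec
        (gradient (metric (twoPointTensors d π₁ π₂) β B A)
          (scalarCurvature (metric (twoPointTensors d π₁ π₂) β B A)) w) k) z = 0 := by
      intro i k
      rw [pderiv_congr_on hΩ hz (g := fun _ => Sum.elim (fun _ : Slot d => (0 : ℝ)) (fun a => B.repr v (some a)) k)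
        (fun w hw => congr_fun (hX w hw) k)]
      exact pderiv_fun_const _ _ _
    rw [lieDerivMetric]
    refine Finset.sum_eq_zero fun k _ => ?_
    rw [hd, hd, hX z hz, mul_zero, mul_zero, add_zero, add_zero]
    rcases k with p | p
    · simp
    · rw [metric_eq_blockMetric]
      have h : pderiv (Sum.inr p) (fun w => blockMetric
          (fun q x => (profile (twoPointTensors d π₁ π₂) β A x q)⁻¹)
          (fibreMetric (fun q x => profile (twoPointTensors d π₁ π₂) β A x q)
          (momentumMatrix β B)) w i j) z = 0 :=
        pderiv_inr p (fun x => Matrix.fromBlocks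
          (Matrix.diagonal fun p => (profile (twoPointTensors d π₁ π₂) β A x p)⁻¹) 0 0
          (fibreMetric (fun q x => profile (twoPointTensors d π₁ π₂) β A x q)
          (momentumMatrix β B) x) i j) z
      rw [h, mul_zero]

end Extremality

end SegreVeronese

/-! ### Interpolation and partial fraction identities. -/

namespace Lagrange

open Polynomial

variable {ι : Type} [DecidableEq ι] {s : Finset ι} {x : ι → ℝ}

theorem sum_eval_div (hx : Set.InjOn x s) (hs : s.Nonempty) {R : ℝ[X]}
    (hR : R.natDegree ≤ s.card - 1) :
    ∑ r ∈ s, R.eval (x r) / ∏ j ∈ s.erase r, (x r - x j) = R.coeff (s.card - 1) := by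
  refine (coeff_eq_sum hx ?_).symm
  have h : s.card - 1 < s.card := Nat.sub_lt hs.card_pos one_pos
  exact (degree_lt_iff_coeff_zero _ _).2 fun m hm =>
    coeff_eq_zero_of_natDegree_lt ((hR.trans_lt h).trans_le hm)

/-- Subtracting a multiple of the nodal polynomial lowers the degree without changing the values at
the nodes. Its subleading coefficient -∑ x_r produces the linear term. -/
theorem sum_eval_div_of_natDegree_le_card (hx : Set.InjOn x s) (hs : s.Nonempty) {R : ℝ[X]}
    (hR : R.natDegree ≤ s.card) :
    ∑ r ∈ s, R.eval (x r) / ∏ j ∈ s.erase r, (x r - x j) =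
      R.coeff s.card * ∑ r ∈ s, x r + R.coeff (s.card - 1) := by
  set Q : ℝ[X] := R - C (R.coeff s.card) * nodal s x with hQ
  have hN : (nodal s x).coeff s.card = 1 := by
    have h := (nodal_monic (s := s) (v := x)).coeff_natDegree
    rwa [natDegree_nodal] at h
  have hN1 : (nodal s x).coeff (s.card - 1) = -∑ r ∈ s, x r :=
    prod_X_sub_C_coeff_card_pred s x hs.card_pos
  have hQd : Q.natDegree ≤ s.card - 1 := by
    rw [natDegree_le_iff_coeff_eq_zero]
    intro N hN'
    have hN2 : s.card ≤ N := Nat.le_of_pred_lt hN'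
    rcases hN2.eq_or_lt with h | h
    · rw [hQ, coeff_sub, coeff_C_mul, ← h, hN]
      ring
    · rw [hQ, coeff_sub, coeff_C_mul, coeff_eq_zero_of_natDegree_lt (hR.trans_lt h),
        coeff_eq_zero_of_natDegree_lt (p := nodal s x) (by rwa [natDegree_nodal])]
      ring
  have h1 : ∀ r ∈ s, R.eval (x r) = Q.eval (x r) := by
    intro r hr
    rw [hQ, eval_sub, eval_mul, eval_nodal_at_node hr]
    ring
  rw [Finset.sum_congr rfl fun r hr => by rw [h1 r hr], sum_eval_div hx hs hQd, hQ, coeff_sub,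
    coeff_C_mul, hN1]
  ring

/-- Partial fractions of `1 / (a + b t)`. -/
theorem sum_inv_linear (hx : Set.InjOn x s) (hs : s.Nonempty) {a b : ℝ} (hb : b ≠ 0)
    (h0 : ∀ r ∈ s, a + b * x r ≠ 0) :
    ∑ r ∈ s, 1 / ((a + b * x r) * ∏ j ∈ s.erase r, (x r - x j)) =
      (-b) ^ (s.card - 1) / ∏ r ∈ s, (a + b * x r) := by
  -- The Lagrange basis sums to 1; the identity is its evaluation at the zero of a + b t.
  have h1 := congr_arg (eval (-a / b)) (sum_basis hx hs)
  rw [eval_finsetSum, eval_one] at h1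
  have h2 : ∀ r ∈ s, eval (-a / b) (Lagrange.basis s x r) * (-b) ^ (s.card - 1) =
      (∏ r ∈ s, (a + b * x r)) * (1 / ((a + b * x r) * ∏ j ∈ s.erase r, (x r - x j))) := by
    intro r hr
    have h3 : ∏ j ∈ s.erase r, (x r - x j) ≠ 0 := Finset.prod_ne_zero_iff.2 fun j hj =>
      sub_ne_zero.2 fun h => Finset.ne_of_mem_erase hj
        (hx (Finset.mem_of_mem_erase hj) hr h.symm)
    have h4 := h0 r hr
    rw [← Finset.mul_prod_erase s _ hr, Lagrange.basis, eval_prod, ← Finset.card_erase_of_mem hr,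
      ← Finset.prod_const, ← Finset.prod_mul_distrib]
    have h5 : ∏ j ∈ s.erase r, eval (-a / b) (basisDivisor (x r) (x j)) * -b =
        ∏ j ∈ s.erase r, ((a + b * x j) / (x r - x j)) := by
      refine Finset.prod_congr rfl fun j _ => ?_
      rw [basisDivisor, eval_mul, eval_C, eval_sub, eval_X, eval_C]
      field_simp
      ring
    rw [h5, Finset.prod_div_distrib]
    field_simp
  have h6 : ∏ r ∈ s, (a + b * x r) ≠ 0 := Finset.prod_ne_zero_iff.2 h0
  rw [eq_div_iff h6, mul_comm, Finset.mul_sum, ← Finset.sum_congr rfl h2, ← Finset.sum_mul, h1,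
    one_mul]

/-- Partial fractions of `1 / (a + b t) ^ 2`. -/
theorem sum_inv_linear_sq (hx : Set.InjOn x s) (hs : s.Nonempty) {a b : ℝ} (hb : b ≠ 0)
    (h0 : ∀ r ∈ s, a + b * x r ≠ 0) :
    ∑ r ∈ s, 1 / ((a + b * x r) ^ 2 * ∏ j ∈ s.erase r, (x r - x j)) =
      (-b) ^ (s.card - 1) * (∑ r ∈ s, ∏ j ∈ s.erase r, (a + b * x j))
        / (∏ r ∈ s, (a + b * x r)) ^ 2 := by
  have hlin : ∀ r, HasDerivAt (fun a => a + b * x r) 1 a := fun r =>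
    (hasDerivAt_id a).add_const (b * x r)
  -- The formula follows by differentiating `sum_inv_linear` with respect to `a`, which is
  -- legitimate because that identity holds for all nearby values of `a`.
  have h1 : HasDerivAt
      (fun a => ∑ r ∈ s, 1 / ((a + b * x r) * ∏ j ∈ s.erase r, (x r - x j)))
      (∑ r ∈ s, -(1 / ((a + b * x r) ^ 2 * ∏ j ∈ s.erase r, (x r - x j)))) a := by
    refine HasDerivAt.fun_sum fun r hr => ?_
    have h2 := ((hlin r).fun_inv (h0 r hr)).mul_const (∏ j ∈ s.erase r, (x r - x j))⁻¹
    refine (h2.congr_of_eventuallyEq (Filter.Eventually.of_forall fun a => ?_)).congr_deriv ?_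
    · simp only [one_div, mul_inv]
    · rw [one_div, mul_inv]
      ring
  have hprod : HasDerivAt (fun a => ∏ r ∈ s, (a + b * x r))
      (∑ r ∈ s, ∏ j ∈ s.erase r, (a + b * x j)) a := by
    refine (HasDerivAt.fun_finsetProd fun r _ => hlin r).congr_deriv ?_
    simp
  have h6 : ∏ r ∈ s, (a + b * x r) ≠ 0 := Finset.prod_ne_zero_iff.2 h0
  have h3 := (hasDerivAt_const a ((-b) ^ (s.card - 1))).fun_div hprod h6
  have hev : ∀ᶠ a in nhds a, ∀ r ∈ s, a + b * x r ≠ 0 :=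
    (Finset.eventually_all s).2 fun r hr => (hlin r).continuousAt.eventually_ne (h0 r hr)
  have h4 := h1.unique (h3.congr_of_eventuallyEq (hev.mono fun a ha => sum_inv_linear hx hs hb ha))
  rw [Finset.sum_neg_distrib, neg_eq_iff_eq_neg] at h4
  rw [h4]
  ring

theorem exists_eq_linear_mul_add (a : ℝ) {b : ℝ} (hb : b ≠ 0) {m : ℕ} {T : ℝ[X]}
    (hT : T.natDegree ≤ m + 1) :
    ∃ Q : ℝ[X], T = (C a + C b * X) * Q + C (T.eval (-a / b)) ∧ Q.natDegree ≤ m ∧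
      Q.coeff m = T.coeff (m + 1) / b := by
  have h1 : T = (C a + C b * X) * (C b⁻¹ * (T /ₘ (X - C (-a / b)))) + C (T.eval (-a / b)) := by
    have h2 := modByMonic_add_div T (X - C (-a / b))
    rw [modByMonic_X_sub_C_eq_C_eval] at h2
    have h3 : (C a + C b * X) * C b⁻¹ = X - C (-a / b) := by
      have h4 : C b * C b⁻¹ = (1 : ℝ[X]) := by rw [← C_mul, mul_inv_cancel₀ hb, C_1]
      rw [neg_div, C_neg, div_eq_mul_inv, C_mul]
      linear_combination X * h4
    rw [← mul_assoc, h3, add_comm]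
    exact h2.symm
  have hd : (C b⁻¹ * (T /ₘ (X - C (-a / b)))).natDegree ≤ m := by
    refine (natDegree_C_mul_le _ _).trans ?_
    rw [natDegree_divByMonic _ (monic_X_sub_C _), natDegree_X_sub_C]
    omega
  generalize C b⁻¹ * (T /ₘ (X - C (-a / b))) = Q at h1 hd
  refine ⟨Q, h1, hd, ?_⟩
  conv_rhs => rw [h1]
  rw [coeff_add, coeff_C_succ, add_zero, add_mul, coeff_add, coeff_C_mul, mul_assoc, coeff_C_mul,
    coeff_X_mul, coeff_eq_zero_of_natDegree_lt (Nat.lt_succ_of_le hd), mul_zero, zero_add,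
    mul_div_cancel_left₀ _ hb]

end Lagrange

/-! ### Elements of 𝔥, and reduction of the curvature to a rational sum. -/

namespace SegreVeronese

open Chart

theorem sum_tprod_update_mem_symTensor {ι : Type} [Fintype ι] [DecidableEq ι] (g h : Fin 2 → ℝ) :
    ∑ r : ι, PiTensorProduct.tprod ℝ (Function.update (fun _ : ι => h) r g) ∈ symTensor ι := by
  simp only [symTensor, Submodule.mem_iInf, LinearMap.mem_eqLocus]
  intro σ
  simp only [map_sum, LinearMap.id_apply, LinearEquiv.coe_coe]
  rw [← Equiv.sum_comp σ fun r => PiTensorProduct.tprod ℝ (Function.update (fun _ : ι => h) r g)]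
  refine Finset.sum_congr rfl fun r _ => ?_
  refine (PiTensorProduct.reindex_tprod (R := ℝ) (s := fun _ : ι => Fin 2 → ℝ) σ _).trans ?_
  congr 1
  funext j
  by_cases hj : j = σ r
  · subst hj
    simp
  · have hj' : σ.symm j ≠ r := fun h' => hj (by rw [← h', Equiv.apply_symm_apply])
    rw [Function.update_of_ne hj, Function.update_of_ne hj']

section Elements

variable {n : ℕ} {d : Fin (n + 3) → ℕ} {π₁ π₂ : ℝ}

/-- A group other than the last one contributes the polarized products to `𝔥`. -/
theorem exists_pairing_eq_sum_prod (π₁ π₂ : ℝ) {i : Fin (n + 3)} (hi : i ≠ Fin.last (n + 2))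
    (g h : Fin 2 → ℝ) :
    ∃ v : structureSpace (twoPointTensors d π₁ π₂), ∀ x : Slot d → ℝ,
      pairing x (v : Tensor (Slot d)) = ∑ r : Slot d with r.1 = i, (g 0 + x r * g 1) *
        ∏ s ∈ (Finset.univ.filter fun s : Slot d => s.1 = i).erase r, (h 0 + x s * h 1) := by
  refine ⟨⟨ins i (twoPointTensors d π₁ π₂ i) (∑ r : {q : Slot d // q.1 = i},
    PiTensorProduct.tprod ℝ (Function.update (fun _ => h) r g)),
    Submodule.mem_iSup_of_mem i
      (Submodule.mem_map_of_mem (sum_tprod_update_mem_symTensor g h))⟩, fun x => ?_⟩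
  have hhat := hatPairing_of_ne π₁ π₂ x hi
  rw [hatPairing] at hhat
  rw [pairing_ins, hhat, mul_one, map_sum, Finset.sum_subtype
    (Finset.univ.filter fun r : Slot d => r.1 = i) (p := fun r => r.1 = i) (by simp)]
  refine Finset.sum_congr rfl fun r _ => ?_
  rw [pairing_tprod, ← Finset.mul_prod_erase _ _ (Finset.mem_univ r), Function.update_self]
  congr 1
  refine Finset.prod_nbij (fun s => (s : Slot d)) ?_ ?_ ?_ ?_
  · intro s hs
    exact Finset.mem_erase.2 ⟨fun h' => Finset.ne_of_mem_erase hs (Subtype.ext h'),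
      Finset.mem_filter.2 ⟨Finset.mem_univ _, s.2⟩⟩
  · exact fun s _ t _ h' => Subtype.ext h'
  · intro s hs
    obtain ⟨h1, h2⟩ := Finset.mem_erase.1 (Finset.mem_coe.1 hs)
    exact ⟨⟨s, (Finset.mem_filter.1 h2).2⟩,
      Finset.mem_coe.2 (Finset.mem_erase.2 ⟨fun h' => h1 (congr_arg Subtype.val h'),
        Finset.mem_univ _⟩), rfl⟩
  · intro s hs
    rw [Function.update_of_ne (Finset.ne_of_mem_erase hs)]

theorem pairing_firstGroupTensor (a b : ℝ) (x : Slot d → ℝ) :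
    pairing x (firstGroupTensor d a b) = ∏ r : Slot d with r.1 = 0, (a + b * x r) := by
  rw [firstGroupTensor, pairing_tprod, Finset.prod_filter]
  refine Finset.prod_congr rfl fun q _ => ?_
  split_ifs <;> simp [mul_comm]

end Elements

section Curvature

variable {n : ℕ} {d : Fin (n + 3) → ℕ} {π₁ π₂ a b c : ℝ}
  {β : structureSpace (twoPointTensors d π₁ π₂)}
  {B : Module.Basis (Option (Slot d)) ℝ (structureSpace (twoPointTensors d π₁ π₂))}
  {A : Slot d → ℝ → ℝ} {U : Set (Slot d → ℝ)} {Υ : Fin (n + 3) → Polynomial ℝ}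

theorem logPairingDeriv_of_pairing_eq
    (hβ : ∀ x : Slot d → ℝ, pairing x (β : Tensor (Slot d)) =
      c * ∏ r : Slot d with r.1 = 0, (a + b * x r)) {x : Slot d → ℝ}
    (hx : pairing x (β : Tensor (Slot d)) ≠ 0) (p : Slot d) :
    logPairingDeriv β p x = if p.1 = 0 then b / (a + b * x p) else 0 := by
  have h1 : ∀ r ∈ Finset.univ.filter (fun r : Slot d => r.1 = 0), a + b * x r ≠ 0 := by
    have h := hx
    rw [hβ] at h
    exact Finset.prod_ne_zero_iff.1 (right_ne_zero_of_mul h)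
  have hlin : ∀ r : Slot d, DifferentiableAt ℝ (fun y : Slot d → ℝ => a + b * y r) x :=
    fun r => by fun_prop
  have h2 : pderiv p (fun y => pairing y (β : Tensor (Slot d))) x =
      pairing x (β : Tensor (Slot d)) *
        ∑ r : Slot d with r.1 = 0, if p = r then b / (a + b * x r) else 0 := by
    simp only [hβ]
    rw [pderiv_fun_const_mul _ (differentiableAt_fun_prod _ fun r _ => hlin r),
      pderiv_fun_prod _ (fun r _ => hlin r), mul_assoc]
    intro r hr
    have h3 := h1 r hr
    have h4 : pderiv p (fun y : Slot d → ℝ => a + b * y r) x = if p = r then b else 0 := by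
      rw [pderiv_fun_add (by fun_prop) (by fun_prop), pderiv_fun_const,
        pderiv_fun_const_mul _ (by fun_prop), pderiv_coord]
      split_ifs <;> ring
    rw [h4]
    split_ifs
    · field_simp
    · ring
  rw [logPairingDeriv, h2, mul_div_cancel_left₀ _ hx, Finset.sum_ite_eq]
  simp

/-- The contribution of the slot `p` to `-s / ⟨μ, β⟩`. -/
def curvatureTerm (Υ : Fin (n + 3) → Polynomial ℝ) (π₁ π₂ a b : ℝ) (x : Slot d → ℝ) (p : Slot d) :
    ℝ :=
  if p.1 = 0 then (Υ 0).eval (x p) / ((π₁ + π₂ * x p) * (a + b * x p) ^ 2 * vandermonde x p)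
  else (Υ p.1).eval (x p) / denom π₁ π₂ p x

/-- On the first group take W = λ^{m+1} F with λ = a + bs. The operator W'' - 2(m+1)(b/λ)W' +
(m+1)(m+2)(b/λ)²W then reduces to λ^{m+1} F'': the F' terms cancel, and so do the F terms because m
- 2(m+1) + (m+2) = 0. The prescribed F'' yields w Υ/(ℓ λ²). On the other groups b_p = 0 and W = A.
-/
theorem exists_weighted_antiderivatives (hd : ∀ i, 1 ≤ d i)
    (hℓ : ∀ x ∈ U, ∀ r : Slot d, r.1 = 0 → π₁ + π₂ * x r ≠ 0)
    (hlam : ∀ x ∈ U, ∀ r : Slot d, r.1 = 0 → a + b * x r ≠ 0)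
    (hA : ∀ p : Fin (n + 3), p ≠ 0 → ∀ q : Fin (d p),
      IsDoubleIntegralOn (A ⟨p, q⟩) (fun s => (Υ p).eval s) (coordRange U ⟨p, q⟩))
    (hA0 : ∀ q : Fin (d 0), ∃ F : ℝ → ℝ,
      IsDoubleIntegralOn F
        (fun s => (Υ 0).eval s *
          ((π₁ + π₂ * s) ^ (d (Fin.last (n + 2)) - 1) / (a + b * s) ^ ((∑ i, d i) + 3)))
        (coordRange U ⟨0, q⟩) ∧
      ∀ s ∈ coordRange U ⟨0, q⟩,
        A ⟨0, q⟩ s = (a + b * s) ^ ((∑ i, d i) + 1) / (π₁ + π₂ * s) ^ d (Fin.last (n + 2)) * F s)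
    (p : Slot d) :
    ∃ W W1 W2 : ℝ → ℝ, ∀ s ∈ coordRange U p,
      A p s * weight d π₁ π₂ p s = W s ∧ HasDerivAt W (W1 s) s ∧ HasDerivAt W1 (W2 s) s ∧
      W2 s - 2 * (Fintype.card (Slot d) + 1) * (if p.1 = 0 then b / (a + b * s) else 0) * W1 s
        + (Fintype.card (Slot d) + 1) * (Fintype.card (Slot d) + 2)
          * (if p.1 = 0 then b / (a + b * s) else 0) ^ 2 * W s =
      weight d π₁ π₂ p s * if p.1 = 0 then
        (Υ 0).eval s / ((π₁ + π₂ * s) * (a + b * s) ^ 2) else (Υ p.1).eval s := by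
  obtain ⟨i, q⟩ := p
  by_cases hi : i = 0
  · subst hi
    obtain ⟨F, ⟨G, hF⟩, hAF⟩ := hA0 q
    set M := ∑ i, d i with hM
    have hcard : (Fintype.card (Slot d) : ℝ) = M := by simp [hM]
    simp only [weight, if_true, hcard]
    refine ⟨fun s => (a + b * s) ^ (M + 1) * F s,
      fun s => (M + 1) * (a + b * s) ^ M * b * F s + (a + b * s) ^ (M + 1) * G s,
      fun s => (M + 1) * M * (a + b * s) ^ (M - 1) * b ^ 2 * F s
        + 2 * (M + 1) * (a + b * s) ^ M * b * G s
        + (a + b * s) ^ (M + 1) * ((Υ 0).eval s *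
          ((π₁ + π₂ * s) ^ (d (Fin.last (n + 2)) - 1) / (a + b * s) ^ (M + 3))), fun s hs => ?_⟩
    have h1 : a + b * s ≠ 0 := by
      obtain ⟨x, hx, rfl⟩ := hs
      exact hlam x hx _ rfl
    have h2 : π₁ + π₂ * s ≠ 0 := by
      obtain ⟨x, hx, rfl⟩ := hs
      exact hℓ x hx _ rfl
    obtain ⟨hF1, hG1⟩ := hF s hs
    have hlin : HasDerivAt (fun s => a + b * s) b s := by
      simpa using ((hasDerivAt_id s).const_mul b).const_add a
    have hpow : ∀ N : ℕ, HasDerivAt (fun s => (a + b * s) ^ N) (N * (a + b * s) ^ (N - 1) * b) s :=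
      fun N => hlin.fun_pow N
    have hpos : 1 ≤ M := (hd 0).trans (Finset.single_le_sum (fun _ _ => Nat.zero_le _)
      (Finset.mem_univ 0))
    refine ⟨?_, ?_, ?_, ?_⟩
    · rw [hAF s hs]
      generalize π₁ + π₂ * s = u at h2 ⊢
      field_simp
    · refine ((hpow (M + 1)).fun_mul hF1).congr_deriv ?_
      rw [Nat.add_sub_cancel, Nat.cast_add, Nat.cast_one]
    · refine (((((hpow M).const_mul ((M : ℝ) + 1)).mul_const b).fun_mul hF1).fun_add
        ((hpow (M + 1)).fun_mul hG1)).congr_deriv ?_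
      rw [Nat.add_sub_cancel, Nat.cast_add, Nat.cast_one]
      ring
    -- Both m and d_k are positive, so the truncated exponents m - 1 and d_k - 1 are genuine.
    · obtain ⟨N, hN⟩ := Nat.exists_eq_add_of_le hpos
      obtain ⟨e, he⟩ := Nat.exists_eq_add_of_le (hd (Fin.last (n + 2)))
      rw [hN, he, Nat.add_sub_cancel_left, Nat.add_sub_cancel_left]
      push_cast
      generalize π₁ + π₂ * s = u at h2 ⊢
      generalize a + b * s = w at h1 ⊢
      field_simp
      ring
  · obtain ⟨G, hG⟩ := hA i hi q
    simp only [weight, hi, if_false]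
    exact ⟨A ⟨i, q⟩, G, fun s => (Υ i).eval s, fun s hs =>
      ⟨mul_one _, (hG s hs).1, (hG s hs).2, by ring⟩⟩

/-- The geometry given by the ansatz of the classification is extremal as soon as its scalar
curvature is of the form `⟨μ, v⟩ / ⟨μ, β⟩`. -/
theorem isExtremalGeometry_of_sum_curvatureTerm (hd : ∀ i, 1 ≤ d i) (hB : B none = β)
    (hU : IsOpen U) (hreg : IsRegularOn (twoPointTensors d π₁ π₂) β A U)
    (hβ : ∀ x : Slot d → ℝ, pairing x (β : Tensor (Slot d)) =
      c * ∏ r : Slot d with r.1 = 0, (a + b * x r))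
    (hℓ : ∀ x ∈ U, ∀ r : Slot d, r.1 = 0 → π₁ + π₂ * x r ≠ 0)
    (hlam : ∀ x ∈ U, ∀ r : Slot d, r.1 = 0 → a + b * x r ≠ 0)
    (hA : ∀ p : Fin (n + 3), p ≠ 0 → ∀ q : Fin (d p),
      IsDoubleIntegralOn (A ⟨p, q⟩) (fun s => (Υ p).eval s) (coordRange U ⟨p, q⟩))
    (hA0 : ∀ q : Fin (d 0), ∃ F : ℝ → ℝ,
      IsDoubleIntegralOn F
        (fun s => (Υ 0).eval s *
          ((π₁ + π₂ * s) ^ (d (Fin.last (n + 2)) - 1) / (a + b * s) ^ ((∑ i, d i) + 3)))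
        (coordRange U ⟨0, q⟩) ∧
      ∀ s ∈ coordRange U ⟨0, q⟩,
        A ⟨0, q⟩ s = (a + b * s) ^ ((∑ i, d i) + 1) / (π₁ + π₂ * s) ^ d (Fin.last (n + 2)) * F s)
    (v : structureSpace (twoPointTensors d π₁ π₂))
    (hv : ∀ x ∈ U, -(pairing x (β : Tensor (Slot d)) ^ 2 * ∑ p, curvatureTerm Υ π₁ π₂ a b x p) =
      pairing x (v : Tensor (Slot d))) :
    IsExtremalGeometry (twoPointTensors d π₁ π₂) β B A U := by
  choose W W1 W2 hW using exists_weighted_antiderivatives hd hℓ hlam hA hA0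
  have hAW := fun p s hs => (hW p s hs).1
  have hW1 := fun p s hs => (hW p s hs).2.1
  have hW2 := fun p s hs => (hW p s hs).2.2.1
  refine isExtremalGeometry_of_pairing hB hreg (isSeparable_of_weight hB hU hreg hℓ hAW hW1 hW2) v
    fun w hw => ?_
  obtain ⟨x, hx⟩ : ∃ x : Slot d → ℝ, (fun p => w (Sum.inl p)) = x := ⟨_, rfl⟩
  rw [hx] at hw ⊢
  rw [scalarCurvature_metric hB hU hreg hℓ hAW hW1 hW2 hx hw, ← hv _ hw]
  have h0 := (hreg x hw).1
  rw [eq_div_iff h0, neg_mul, neg_inj, Finset.sum_mul, Finset.mul_sum]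
  refine Finset.sum_congr rfl fun p _ => ?_
  have hs : x p ∈ coordRange U p := ⟨x, hw, rfl⟩
  rw [logPairingDeriv_of_pairing_eq hβ h0, (hW p _ hs).2.2.2, curvatureTerm]
  have hw : weight d π₁ π₂ p (x p) ≠ 0 := by
    unfold weight
    split_ifs with hp
    · exact pow_ne_zero _ (hℓ x hw p hp)
    · exact one_ne_zero
  by_cases hp : p.1 = 0
  · have hden : denom π₁ π₂ p x = vandermonde x p := by
      rw [denom, hatPairing_of_ne π₁ π₂ x (fun h => last_ne_zero' (h.symm.trans hp)), mul_one]
    rw [if_pos hp, if_pos hp, hden]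
    field_simp
  · rw [if_neg hp, if_neg hp]
    field_simp

end Curvature

end SegreVeronese

/-! ### Summation over the groups. -/

namespace SegreVeronese

open Chart Polynomial

section Groups

variable {k : ℕ} {d : Fin k → ℕ}

/-- The slots of the group `i`. -/
def group (d : Fin k → ℕ) (i : Fin k) : Finset (Slot d) := Finset.univ.filter fun p => p.1 = i

theorem mem_group {i : Fin k} {p : Slot d} : p ∈ group d i ↔ p.1 = i := by simp [group]

theorem card_group (i : Fin k) : (group d i).card = d i := by
  have h : group d i = Finset.univ.map (Function.Embedding.sigmaMk i) := by
    ext ⟨j, q⟩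
    rw [mem_group, Finset.mem_map]
    constructor
    · rintro rfl
      exact ⟨q, Finset.mem_univ _, rfl⟩
    · rintro ⟨r, _, hr⟩
      exact (congr_arg Sigma.fst hr).symm
  rw [h, Finset.card_map, Finset.card_univ, Fintype.card_fin]

theorem vandermonde_eq_prod_erase (x : Slot d → ℝ) {i : Fin k} {p : Slot d} (hp : p ∈ group d i) :
    vandermonde x p = ∏ s ∈ (group d i).erase p, (x p - x s) := by
  rw [mem_group] at hp
  subst hp
  rw [vandermonde]
  refine Finset.prod_congr ?_ fun _ _ => rfl
  ext s
  simp [group, and_comm]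

theorem injOn_group {x : Slot d → ℝ} (hx : ∀ p, vandermonde x p ≠ 0) (i : Fin k) :
    Set.InjOn x (group d i) := by
  intro p hp q hq hpq
  by_contra h
  have h1 := mem_group.1 (Finset.mem_coe.1 hp)
  have h2 := mem_group.1 (Finset.mem_coe.1 hq)
  exact vandermonde_ne_zero_iff.1 (hx p) q (h2.trans h1.symm) (Ne.symm h) hpq

end Groups

section Sums

variable {n : ℕ} {d : Fin (n + 3) → ℕ} {π₁ π₂ a b c : ℝ} {Υ : Fin (n + 3) → Polynomial ℝ}

theorem sum_eq_sum_groups (f : Slot d → ℝ) :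
    ∑ p, f p = (∑ p ∈ group d 0, f p + ∑ p ∈ group d (Fin.last (n + 2)), f p) +
      ∑ i : Fin (n + 3) with i ≠ 0 ∧ i ≠ Fin.last (n + 2), ∑ p ∈ group d i, f p := by
  have h1 : ∑ p, f p = ∑ i : Fin (n + 3), ∑ p ∈ group d i, f p :=
    (Finset.sum_fiberwise Finset.univ (fun p : Slot d => p.1) f).symm
  have h2 : (Finset.univ.filter fun i : Fin (n + 3) => i ≠ 0 ∧ i ≠ Fin.last (n + 2)) =
      (Finset.univ.erase 0).erase (Fin.last (n + 2)) := by
    ext i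
    simp [and_comm]
  rw [h1, h2, ← Finset.add_sum_erase _ _ (Finset.mem_univ (0 : Fin (n + 3))),
    ← Finset.add_sum_erase _ _ (Finset.mem_erase.2
      ⟨last_ne_zero', Finset.mem_univ (Fin.last (n + 2))⟩)]
  exact (add_assoc _ _ _).symm

theorem group_nonempty (hd : ∀ i, 1 ≤ d i) (i : Fin (n + 3)) : (group d i).Nonempty :=
  Finset.card_pos.1 (by rw [card_group]; exact hd i)

theorem curvatureTerm_middle (Υ : Fin (n + 3) → Polynomial ℝ) (x : Slot d → ℝ) {i : Fin (n + 3)}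
    (h0 : i ≠ 0) (h1 : i ≠ Fin.last (n + 2)) :
    ∑ p ∈ group d i, curvatureTerm Υ π₁ π₂ a b x p =
      ∑ p ∈ group d i, (Υ i).eval (x p) / ∏ s ∈ (group d i).erase p, (x p - x s) := by
  refine Finset.sum_congr rfl fun p hp => ?_
  have hp' := mem_group.1 hp
  rw [curvatureTerm, if_neg (hp' ▸ h0), denom, hatPairing_of_ne π₁ π₂ x (hp' ▸ h1), mul_one,
    vandermonde_eq_prod_erase x hp, hp']

/-- The factor ⟨x̂,Γ_k⟩ = ∏ ℓ(x_{1r}) is common to all slots of the last group, and what remains is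
a Lagrange sum equal to the top coefficient. -/
theorem sum_curvatureTerm_last (hd : ∀ i, 1 ≤ d i) {x : Slot d → ℝ}
    (hx : ∀ p, vandermonde x p ≠ 0)
    (hdeg : (Υ (Fin.last (n + 2))).natDegree ≤ d (Fin.last (n + 2)) - 1) :
    ∑ p ∈ group d (Fin.last (n + 2)), curvatureTerm Υ π₁ π₂ a b x p =
      (Υ (Fin.last (n + 2))).coeff (d (Fin.last (n + 2)) - 1)
        / ∏ r ∈ group d 0, (π₁ + π₂ * x r) := by
  have h := Lagrange.sum_eval_div (injOn_group hx (Fin.last (n + 2))) (group_nonempty hd _)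
    (R := Υ (Fin.last (n + 2))) (by rwa [card_group])
  rw [card_group] at h
  rw [← h, Finset.sum_div]
  refine Finset.sum_congr rfl fun p hp => ?_
  have hp' := mem_group.1 hp
  rw [curvatureTerm, if_neg (hp' ▸ last_ne_zero'), denom, vandermonde_eq_prod_erase x hp, hp',
    hatPairing_last, div_div]
  rfl

/-- The terms of the first and the last group combine to a polynomial expression. -/
theorem exists_sum_curvatureTerm_first_add_last (hd : ∀ i, 1 ≤ d i) (hπ : π₂ ≠ 0) {m : ℕ} {ρ : ℝ}
    (hdeg : (Υ (Fin.last (n + 2))).natDegree ≤ d (Fin.last (n + 2)) - 1)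
    (h0 : (Υ 0 - C ρ * (C a + C b * X) ^ 2).natDegree ≤ m + 1)
    (hρ : (Υ 0).eval (-π₁ / π₂) = ρ * (a + b * (-π₁ / π₂)) ^ 2)
    (hγ : (Υ (Fin.last (n + 2))).coeff (d (Fin.last (n + 2)) - 1) = -((-π₂) ^ (d 0 - 1) * ρ)) :
    ∃ T : ℝ[X], T.natDegree ≤ m ∧
      T.coeff m = (Υ 0 - C ρ * (C a + C b * X) ^ 2).coeff (m + 1) / π₂ ∧
      ∀ x : Slot d → ℝ, (∀ p, vandermonde x p ≠ 0) →
        (∀ r : Slot d, r.1 = 0 → π₁ + π₂ * x r ≠ 0) →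
        (∀ r : Slot d, r.1 = 0 → a + b * x r ≠ 0) →
        ∑ p ∈ group d 0, curvatureTerm Υ π₁ π₂ a b x p
          + ∑ p ∈ group d (Fin.last (n + 2)), curvatureTerm Υ π₁ π₂ a b x p =
        ∑ p ∈ group d 0, T.eval (x p) /
          ((a + b * x p) ^ 2 * ∏ s ∈ (group d 0).erase p, (x p - x s)) := by
  obtain ⟨T, hT, hTd, hTc⟩ := Lagrange.exists_eq_linear_mul_add π₁ hπ h0
  refine ⟨T, hTd, hTc, fun x hx hℓ hlam => ?_⟩
  -- By the condition on γ_k and partial fractions, the last group contributes -ρ ∑ 1/(ℓΔ), that is,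
  -- it subtracts ρλ² from the numerator Υ_1 over ℓλ²Δ. The choice of ρ makes the new numerator
  -- divisible by ℓ.
  have hroot : (Υ 0 - C ρ * (C a + C b * X) ^ 2).eval (-π₁ / π₂) = 0 := by
    simp [hρ]
  rw [hroot, C_0, add_zero] at hT
  have h1 := Lagrange.sum_inv_linear (injOn_group hx 0) (group_nonempty hd 0) hπ
    (a := π₁) fun r hr => hℓ r (mem_group.1 hr)
  rw [card_group] at h1
  have h2 : (Υ (Fin.last (n + 2))).coeff (d (Fin.last (n + 2)) - 1)
      / ∏ r ∈ group d 0, (π₁ + π₂ * x r) = -ρ * ∑ r ∈ group d 0,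
        1 / ((π₁ + π₂ * x r) * ∏ s ∈ (group d 0).erase r, (x r - x s)) := by
    rw [h1, hγ]
    ring
  rw [sum_curvatureTerm_last hd hx hdeg, h2, Finset.mul_sum, ← Finset.sum_add_distrib]
  refine Finset.sum_congr rfl fun p hp => ?_
  have hp' := mem_group.1 hp
  have h3 := hℓ p hp'
  have h4 := hlam p hp'
  have h5 := hx p
  rw [vandermonde_eq_prod_erase x hp] at h5
  have h6 := congr_arg (eval (x p)) hT
  simp only [eval_sub, eval_mul, eval_pow, eval_add, eval_C, eval_X] at h6
  rw [curvatureTerm, if_pos hp', vandermonde_eq_prod_erase x hp]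
  generalize ∏ s ∈ (group d 0).erase p, (x p - x s) = D at h5 ⊢
  generalize π₁ + π₂ * x p = u at h3 h6 ⊢
  generalize a + b * x p = w at h4 h6 ⊢
  field_simp
  linear_combination h6

end Sums

section Elements

variable {n : ℕ} {d : Fin (n + 3) → ℕ} {π₁ π₂ a b c : ℝ} {Υ : Fin (n + 3) → Polynomial ℝ}
  {β : structureSpace (twoPointTensors d π₁ π₂)}

/-- The case of constant `⟨μ, β⟩`. -/
theorem exists_pairing_eq_of_constant (hd : ∀ i, 1 ≤ d i) (hπ : π₂ ≠ 0) {ρ : ℝ}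
    (hβ : ∀ x : Slot d → ℝ, pairing x (β : Tensor (Slot d)) = c)
    (hdeg0 : (Υ 0).natDegree ≤ d 0 + 1)
    (hdeg : ∀ p, p ≠ 0 → p ≠ Fin.last (n + 2) → (Υ p).natDegree ≤ d p)
    (hdegl : (Υ (Fin.last (n + 2))).natDegree ≤ d (Fin.last (n + 2)) - 1)
    (hρ : (Υ 0).eval (-π₁ / π₂) = ρ)
    (hγ : (Υ (Fin.last (n + 2))).coeff (d (Fin.last (n + 2)) - 1) = -((-π₂) ^ (d 0 - 1) * ρ)) :
    ∃ v : structureSpace (twoPointTensors d π₁ π₂), ∀ x : Slot d → ℝ,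
      (∀ p, vandermonde x p ≠ 0) → (∀ r : Slot d, r.1 = 0 → π₁ + π₂ * x r ≠ 0) →
      -(pairing x (β : Tensor (Slot d)) ^ 2 * ∑ p, curvatureTerm Υ π₁ π₂ 1 0 x p) =
        pairing x (v : Tensor (Slot d)) := by
  have hdeg0' : (Υ 0 - C ρ * (C 1 + C 0 * X) ^ 2).natDegree ≤ d 0 + 1 := by
    refine (natDegree_sub_le _ _).trans (max_le hdeg0 ?_)
    simp
  obtain ⟨T, hTd, -, hT⟩ := exists_sum_curvatureTerm_first_add_last hd hπ hdegl hdeg0'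
    (by simpa using hρ) hγ
  have hv : ∀ i : Fin (n + 3), ∃ v : structureSpace (twoPointTensors d π₁ π₂),
      i ≠ Fin.last (n + 2) → ∀ x : Slot d → ℝ,
        pairing x (v : Tensor (Slot d)) = ∑ r ∈ group d i, x r := by
    intro i
    by_cases hi : i = Fin.last (n + 2)
    · exact ⟨0, fun h => absurd hi h⟩
    -- (0,1) pairs to x_r and (1,0) to 1, so the polarized product is the sum of the coordinates of
    -- the group.
    · obtain ⟨v, hv⟩ := exists_pairing_eq_sum_prod (d := d) π₁ π₂ hi ![0, 1] ![1, 0]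
      refine ⟨v, fun _ x => ?_⟩
      rw [hv]
      simp [group]
  choose v hv using hv
  -- The coordinate sums come from the `v i`; a constant c²K is c K ⟨μ,β⟩, which gives the multiple
  -- of `β`.
  refine ⟨-c ^ 2 • (T.coeff (d 0) • v 0 + ∑ i : Fin (n + 3) with i ≠ 0 ∧ i ≠ Fin.last (n + 2),
    (Υ i).coeff (d i) • v i) - (c * (T.coeff (d 0 - 1) + ∑ i : Fin (n + 3) with
      i ≠ 0 ∧ i ≠ Fin.last (n + 2), (Υ i).coeff (d i - 1))) • β, fun x hx hℓ => ?_⟩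
  have h1 : ∑ p ∈ group d 0, T.eval (x p) /
      ((1 + 0 * x p) ^ 2 * ∏ s ∈ (group d 0).erase p, (x p - x s)) =
      T.coeff (d 0) * ∑ r ∈ group d 0, x r + T.coeff (d 0 - 1) := by
    have h := Lagrange.sum_eval_div_of_natDegree_le_card (injOn_group hx 0) (group_nonempty hd 0)
      (R := T) (by rwa [card_group])
    rw [card_group] at h
    rw [← h]
    refine Finset.sum_congr rfl fun p _ => ?_
    rw [zero_mul, add_zero, one_pow, one_mul]
  have h2 : ∑ i : Fin (n + 3) with i ≠ 0 ∧ i ≠ Fin.last (n + 2), ∑ p ∈ group d i,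
      curvatureTerm Υ π₁ π₂ 1 0 x p = ∑ i : Fin (n + 3) with i ≠ 0 ∧ i ≠ Fin.last (n + 2),
      ((Υ i).coeff (d i) * pairing x (v i : Tensor (Slot d)) + (Υ i).coeff (d i - 1)) := by
    refine Finset.sum_congr rfl fun i hi => ?_
    obtain ⟨hi0, hil⟩ := (Finset.mem_filter.1 hi).2
    have h := Lagrange.sum_eval_div_of_natDegree_le_card (injOn_group hx i) (group_nonempty hd i)
      (R := Υ i) (by rw [card_group]; exact hdeg i hi0 hil)
    rw [card_group] at h
    rw [curvatureTerm_middle Υ x hi0 hil, h, hv i hil]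
  rw [sum_eq_sum_groups, hT x hx hℓ (by simp), h1, h2, ← hv 0 (Ne.symm last_ne_zero'),
    Finset.sum_add_distrib]
  simp only [Submodule.coe_sub, Submodule.coe_add, Submodule.coe_smul, Submodule.coe_sum, map_sub,
    map_add, map_smul, map_sum, smul_eq_mul, hβ]
  ring

/-- The case where `⟨μ, β⟩` is a multiple of `∏ (a + b x_{1r})` with `b ≠ 0`. -/
theorem exists_pairing_eq_of_product (hd : ∀ i, 1 ≤ d i) (hπ : π₂ ≠ 0) (hb : b ≠ 0) {ρ : ℝ}
    (hβ : ∀ x : Slot d → ℝ, pairing x (β : Tensor (Slot d)) =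
      c * ∏ r : Slot d with r.1 = 0, (a + b * x r))
    (hdeg0 : (Υ 0).natDegree ≤ d 0 + 2)
    (hdeg : ∀ p, p ≠ 0 → (Υ p).natDegree ≤ d p - 1)
    (hρ : (Υ 0).eval (-π₁ / π₂) = ρ * (a + b * (-π₁ / π₂)) ^ 2)
    (hγ : (Υ (Fin.last (n + 2))).coeff (d (Fin.last (n + 2)) - 1) = -((-π₂) ^ (d 0 - 1) * ρ))
    (hsum : (Υ 0).coeff (d 0 + 2) / (π₂ * b ^ 2) +
      ∑ i : Fin (n + 3) with i ≠ 0 ∧ i ≠ Fin.last (n + 2), (Υ i).coeff (d i - 1) = 0) :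
    ∃ v : structureSpace (twoPointTensors d π₁ π₂), ∀ x : Slot d → ℝ,
      (∀ p, vandermonde x p ≠ 0) → (∀ r : Slot d, r.1 = 0 → π₁ + π₂ * x r ≠ 0) →
      (∀ r : Slot d, r.1 = 0 → a + b * x r ≠ 0) →
      -(pairing x (β : Tensor (Slot d)) ^ 2 * ∑ p, curvatureTerm Υ π₁ π₂ a b x p) =
        pairing x (v : Tensor (Slot d)) := by
  obtain ⟨N, hN⟩ := Nat.exists_eq_add_of_le' (hd 0)
  have hsq : (C ρ * (C a + C b * X) ^ 2).natDegree ≤ 2 := by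
    refine (natDegree_C_mul_le _ _).trans ((natDegree_pow_le_of_le (m := 1) 2 ?_).trans (by norm_num))
    rw [add_comm]
    exact natDegree_linear_le
  have hdeg0' : (Υ 0 - C ρ * (C a + C b * X) ^ 2).natDegree ≤ d 0 + 1 + 1 :=
    (natDegree_sub_le _ _).trans (max_le hdeg0 (hsq.trans (Nat.le_add_left 2 _)))
  obtain ⟨T, hTd, hTc, hT⟩ := exists_sum_curvatureTerm_first_add_last hd hπ
    (hdeg _ last_ne_zero') hdeg0' hρ hγ
  -- Two divisions by λ = a + bX give T = λ²R + αλ + δ with deg R ≤ N = d_1 - 1, so the R part sums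
  -- to the coefficient of degree N.
  obtain ⟨Q, hQ, hQd, hQc⟩ := Lagrange.exists_eq_linear_mul_add a hb hTd
  obtain ⟨R, hR, hRd, hRc⟩ := Lagrange.exists_eq_linear_mul_add a hb (hN ▸ hQd)
  set δ := T.eval (-a / b) with hδ
  set α := Q.eval (-a / b) with hα
  -- One division by ℓ and two by λ divide the top coefficient by π₂b². The correction ρλ² has
  -- degree at most 2 < d_1 + 2 and does not affect it.
  have hcoeff : R.coeff N = (Υ 0).coeff (d 0 + 2) / (π₂ * b ^ 2) := by
    have h1 : (C ρ * (C a + C b * X) ^ 2).coeff (d 0 + 1 + 1) = 0 :=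
      coeff_eq_zero_of_natDegree_lt (hsq.trans_lt (by have := hd 0; omega))
    rw [hRc, ← hN, hQc, hTc, coeff_sub, h1]
    field_simp
    ring
  obtain ⟨v, hv⟩ := exists_pairing_eq_sum_prod (d := d) π₁ π₂
    (Ne.symm (last_ne_zero' (n := n))) ![1, 0] ![a, b]
  -- After multiplication by h² = c²(∏λ)², the α part is a multiple of ⟨μ,β⟩ and the δ part a
  -- multiple of ∑_r ∏_{s≠r} λ(x_{1s}) = ⟨μ,v⟩. The R part cancels against the middle groups.
  refine ⟨-(c * α * (-b) ^ N) • β - (c ^ 2 * δ * (-b) ^ N) • v, fun x hx hℓ hlam => ?_⟩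
  have hinj := injOn_group hx 0
  have hne := group_nonempty hd 0
  have hlam' : ∀ r ∈ group d 0, a + b * x r ≠ 0 := fun r hr => hlam r (mem_group.1 hr)
  have hcard : (group d 0).card - 1 = N := by rw [card_group, hN, Nat.add_sub_cancel]
  have h1 : ∑ p ∈ group d 0, T.eval (x p) /
      ((a + b * x p) ^ 2 * ∏ s ∈ (group d 0).erase p, (x p - x s)) =
      R.coeff N + α * ((-b) ^ N / ∏ r ∈ group d 0, (a + b * x r)) +
      δ * ((-b) ^ N * (∑ r ∈ group d 0, ∏ s ∈ (group d 0).erase r, (a + b * x s))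
        / (∏ r ∈ group d 0, (a + b * x r)) ^ 2) := by
    have h2 := Lagrange.sum_eval_div hinj hne (R := R) (by rwa [hcard])
    have h3 := Lagrange.sum_inv_linear hinj hne hb hlam'
    have h4 := Lagrange.sum_inv_linear_sq hinj hne hb hlam'
    rw [hcard] at h2 h3 h4
    rw [← h2, ← h3, ← h4, Finset.mul_sum, Finset.mul_sum, ← Finset.sum_add_distrib,
      ← Finset.sum_add_distrib]
    refine Finset.sum_congr rfl fun p hp => ?_
    have h5 := hlam' p hp
    have h6 := hx p
    rw [vandermonde_eq_prod_erase x hp] at h6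
    have h7 := congr_arg (eval (x p)) hQ
    have h8 := congr_arg (eval (x p)) hR
    simp only [eval_mul, eval_add, eval_C, eval_X] at h7 h8
    rw [h7, h8]
    generalize ∏ s ∈ (group d 0).erase p, (x p - x s) = D at h6 ⊢
    generalize a + b * x p = w at h5 ⊢
    field_simp
  have h2 : ∑ i : Fin (n + 3) with i ≠ 0 ∧ i ≠ Fin.last (n + 2), ∑ p ∈ group d i,
      curvatureTerm Υ π₁ π₂ a b x p = -R.coeff N := by
    rw [hcoeff, ← eq_neg_of_add_eq_zero_right hsum]
    refine Finset.sum_congr rfl fun i hi => ?_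
    obtain ⟨hi0, hil⟩ := (Finset.mem_filter.1 hi).2
    have h := Lagrange.sum_eval_div (injOn_group hx i) (group_nonempty hd i)
      (R := Υ i) (by rw [card_group]; exact hdeg i hi0)
    rw [card_group] at h
    rw [curvatureTerm_middle Υ x hi0 hil, h]
  have h3 : pairing x (v : Tensor (Slot d)) =
      ∑ r ∈ group d 0, ∏ s ∈ (group d 0).erase r, (a + b * x s) := by
    rw [hv]
    refine Finset.sum_congr rfl fun r _ => ?_
    simp [group, mul_comm]
  have hβ' : pairing x (β : Tensor (Slot d)) = c * ∏ r ∈ group d 0, (a + b * x r) := hβ x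
  have h4 : ∏ r ∈ group d 0, (a + b * x r) ≠ 0 := Finset.prod_ne_zero_iff.2 hlam'
  rw [sum_eq_sum_groups, hT x hx hℓ hlam, h1, h2]
  simp only [Submodule.coe_sub, Submodule.coe_smul, map_sub, map_smul, smul_eq_mul, h3, hβ']
  generalize ∏ r ∈ group d 0, (a + b * x r) = w at h4 ⊢
  field_simp
  ring

end Elements

end SegreVeronese

end

/-! ### The three cases. -/

theorem mainTheorem10 (n : ℕ) (d : Fin (n + 3) → ℕ) (hd : ∀ i, 1 ≤ d i)
    (π₁ π₂ : ℝ) (hπ : π₂ ≠ 0)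
    (β : structureSpace (twoPointTensors d π₁ π₂))
    (B : Module.Basis (Option (Slot d)) ℝ (structureSpace (twoPointTensors d π₁ π₂)))
    (hB : B none = β)
    (A : Slot d → ℝ → ℝ) (U : Set (Slot d → ℝ)) (hU : IsOpen U)
    (hreg : IsRegularOn (twoPointTensors d π₁ π₂) β A U)
    (Υ : Fin (n + 3) → Polynomial ℝ)
    (hA : ∀ p : Fin (n + 3), p ≠ 0 → ∀ q : Fin (d p),
      IsDoubleIntegralOn (A ⟨p, q⟩) (fun s => (Υ p).eval s) (coordRange U ⟨p, q⟩))
    (hcases :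
      -- case 1
      ((β : Tensor (Slot d)) ∈ Submodule.span ℝ {PiTensorProduct.tprod ℝ fun _ => ![1, 0]} ∧
        (∀ q : Fin (d 0), ∃ F : ℝ → ℝ,
          IsDoubleIntegralOn F
            (fun s => (Υ 0).eval s * (π₁ + π₂ * s) ^ (d (Fin.last (n + 2)) - 1))
            (coordRange U ⟨0, q⟩) ∧
          ∀ s ∈ coordRange U ⟨0, q⟩,
            A ⟨0, q⟩ s = 1 / (π₁ + π₂ * s) ^ d (Fin.last (n + 2)) * F s) ∧
        (Υ 0).natDegree ≤ d 0 + 1 ∧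
        (∀ p, p ≠ 0 → p ≠ Fin.last (n + 2) → (Υ p).natDegree ≤ d p) ∧
        (Υ (Fin.last (n + 2))).natDegree ≤ d (Fin.last (n + 2)) - 1 ∧
        (Υ (Fin.last (n + 2))).coeff (d (Fin.last (n + 2)) - 1) =
          -((-π₂) ^ (d 0 - 1) * (Υ 0).eval (-π₁ / π₂))) ∨
      -- case 2
      ((β : Tensor (Slot d)) ∈ Submodule.span ℝ {firstGroupTensor d π₁ π₂} ∧
        (∀ q : Fin (d 0), ∃ F : ℝ → ℝ,
          IsDoubleIntegralOn F
            (fun s => (Υ 0).eval s *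
              (π₁ + π₂ * s) ^ (-((∑ i, d i : ℕ) : ℤ) + (d (Fin.last (n + 2)) : ℤ) - 4))
            (coordRange U ⟨0, q⟩) ∧
          ∀ s ∈ coordRange U ⟨0, q⟩,
            A ⟨0, q⟩ s =
              (π₁ + π₂ * s) ^ (((∑ i, d i : ℕ) : ℤ) + 1 - (d (Fin.last (n + 2)) : ℤ)) * F s) ∧
        (Υ 0).natDegree ≤ d 0 + 2 ∧
        (∀ p, p ≠ 0 → (Υ p).natDegree ≤ d p - 1) ∧
        (Υ 0).eval (-π₁ / π₂) = 0 ∧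
        (Υ 0).coeff (d 0 + 2) / π₂ ^ 3 +
          ∑ i : Fin (n + 3) with i ≠ 0 ∧ i ≠ Fin.last (n + 2), (Υ i).coeff (d i - 1) = 0) ∨
      -- case 3
      (∃ a b : ℝ, b ≠ 0 ∧
        Submodule.span ℝ {(![a, b] : Fin 2 → ℝ)} ≠ Submodule.span ℝ {![π₁, π₂]} ∧
        (β : Tensor (Slot d)) ∈ Submodule.span ℝ {firstGroupTensor d a b} ∧
        (∀ q : Fin (d 0), ∃ F : ℝ → ℝ,
          IsDoubleIntegralOn F
            (fun s => (Υ 0).eval s *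
              ((π₁ + π₂ * s) ^ (d (Fin.last (n + 2)) - 1) / (a + b * s) ^ ((∑ i, d i) + 3)))
            (coordRange U ⟨0, q⟩) ∧
          ∀ s ∈ coordRange U ⟨0, q⟩,
            A ⟨0, q⟩ s =
              (a + b * s) ^ ((∑ i, d i) + 1) / (π₁ + π₂ * s) ^ d (Fin.last (n + 2)) * F s) ∧
        (Υ 0).natDegree ≤ d 0 + 2 ∧
        (∀ p, p ≠ 0 → (Υ p).natDegree ≤ d p - 1) ∧
        (Υ (Fin.last (n + 2))).coeff (d (Fin.last (n + 2)) - 1) * (a - b * π₁ / π₂) ^ 2 =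
          -((-π₂) ^ (d 0 - 1) * (Υ 0).eval (-π₁ / π₂)) ∧
        (Υ 0).coeff (d 0 + 2) / (π₂ * b ^ 2) +
          ∑ i : Fin (n + 3) with i ≠ 0 ∧ i ≠ Fin.last (n + 2), (Υ i).coeff (d i - 1) = 0)) :
    IsExtremalGeometry (twoPointTensors d π₁ π₂) β B A U := by
  have hlast : ∀ x ∈ U, ∀ r : Slot d, r.1 = 0 → π₁ + π₂ * x r ≠ 0 := by
    intro x hx r hr
    -- The last group is nonempty, so regularity includes ⟨x̂,Γ_k⟩ = ∏ ℓ(x_{1r}) ≠ 0.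
    have h := ((hreg x hx).2 ⟨Fin.last (n + 2), ⟨0, hd _⟩⟩).2.1
    rw [hatPairing_last] at h
    exact Finset.prod_ne_zero_iff.1 h r (Finset.mem_filter.2 ⟨Finset.mem_univ _, hr⟩)
  have hfactor : ∀ a b c : ℝ, (∀ x : Slot d → ℝ, pairing x (β : Tensor (Slot d)) =
      c * ∏ r : Slot d with r.1 = 0, (a + b * x r)) →
      ∀ x ∈ U, ∀ r : Slot d, r.1 = 0 → a + b * x r ≠ 0 := by
    intro a b c hβ x hx r hr
    have h := (hreg x hx).1
    rw [hβ] at h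
    exact Finset.prod_ne_zero_iff.1 (right_ne_zero_of_mul h) r
      (Finset.mem_filter.2 ⟨Finset.mem_univ _, hr⟩)
  have hspan : ∀ a b : ℝ, (β : Tensor (Slot d)) ∈ Submodule.span ℝ {firstGroupTensor d a b} →
      ∃ c, ∀ x : Slot d → ℝ, pairing x (β : Tensor (Slot d)) =
        c * ∏ r : Slot d with r.1 = 0, (a + b * x r) := by
    intro a b h
    obtain ⟨c, hc⟩ := Submodule.mem_span_singleton.1 h
    refine ⟨c, fun x => ?_⟩
    rw [← hc, map_smul, pairing_firstGroupTensor, smul_eq_mul]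
  have hπ' : (-π₂) ^ (d 0 - 1) ≠ 0 := pow_ne_zero _ (neg_ne_zero.2 hπ)
  rcases hcases with ⟨hβ, hA0, h0, hm, hl, hγ⟩ | ⟨hβ, hA0, h0, hm, hroot, hsum⟩ |
    ⟨a, b, hb, hab, hβ, hA0, h0, hm, hγ, hsum⟩
  · obtain ⟨c, hc⟩ := Submodule.mem_span_singleton.1 hβ
    have hβc : ∀ x : Slot d → ℝ, pairing x (β : Tensor (Slot d)) = c := by
      intro x
      rw [← hc, map_smul, pairing_tprod]
      simp
    -- Case 1 is the product form with a = 1, b = 0.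
    have hβp : ∀ x : Slot d → ℝ, pairing x (β : Tensor (Slot d)) =
        c * ∏ r : Slot d with r.1 = 0, (1 + 0 * x r) := by
      intro x
      rw [hβc]
      simp
    obtain ⟨v, hv⟩ := exists_pairing_eq_of_constant hd hπ hβc h0 hm hl rfl hγ
    exact isExtremalGeometry_of_sum_curvatureTerm hd hB hU hreg hβp hlast (hfactor 1 0 c hβp) hA
      (by simpa using hA0) v fun x hx => hv x (fun p => ((hreg x hx).2 p).1) (hlast x hx)
  · obtain ⟨c, hc⟩ := hspan _ _ hβ
    -- In case 2 λ = ℓ vanishes at -π₁/π₂, and so does Υ_1, so the condition there holds for every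
    -- ρ. The value of ρ is free to be fixed by γ_k, which is why no relation between γ_k and Υ_1 is
    -- needed.
    obtain ⟨v, hv⟩ := exists_pairing_eq_of_product (b := π₂)
      (ρ := -((Υ (Fin.last (n + 2))).coeff (d (Fin.last (n + 2)) - 1) / (-π₂) ^ (d 0 - 1)))
      hd hπ hπ hc h0 hm
      (by
        rw [hroot, mul_div_cancel₀ _ hπ]
        ring)
      (by field_simp)
      (by rw [← hsum, ← pow_succ'])
    refine isExtremalGeometry_of_sum_curvatureTerm hd hB hU hreg hc hlast hlast hA
      (fun q => ?_) v fun x hx => hv x (fun p => ((hreg x hx).2 p).1) (hlast x hx) (hlast x hx)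
    obtain ⟨F, ⟨G, hF⟩, hAF⟩ := hA0 q
    have hne : ∀ s ∈ coordRange U (⟨0, q⟩ : Slot d), π₁ + π₂ * s ≠ 0 := by
      rintro _ ⟨x, hx, rfl⟩
      exact hlast x hx _ rfl
    -- With λ = ℓ the exponents combine: (d_k - 1) - (m + 3) = -m + d_k - 4 and (m + 1) - d_k.
    refine ⟨F, ⟨G, fun s hs => ⟨(hF s hs).1, (hF s hs).2.congr_deriv ?_⟩⟩, fun s hs => ?_⟩
    · have h := hne s hs
      obtain ⟨e, he⟩ := Nat.exists_eq_add_of_le (hd (Fin.last (n + 2)))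
      beta_reduce
      rw [← zpow_natCast, ← zpow_natCast, ← zpow_sub₀ h, he, Nat.add_sub_cancel_left]
      congr 2
      push_cast
      ring
    · have h := hne s hs
      rw [hAF s hs, ← zpow_natCast, ← zpow_natCast (_ + _) (d _), ← zpow_sub₀ h]
      congr 2
  · obtain ⟨c, hc⟩ := hspan _ _ hβ
    -- λ vanishes at the zero of ℓ only if (a, b) is proportional to (π₁, π₂), which is excluded in
    -- case 3; hence ρ can be obtained by division.
    have hroot : a + b * (-π₁ / π₂) ≠ 0 := by
      intro h
      refine hab ?_
      have h1 : a * π₂ = b * π₁ := by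
        field_simp at h
        linear_combination h
      have h2 : (![a, b] : Fin 2 → ℝ) = (b / π₂) • ![π₁, π₂] := by
        ext i
        fin_cases i
        · simp
          field_simp
          exact h1
        · simp
          field_simp
      rw [h2]
      exact Submodule.span_singleton_smul_eq (div_ne_zero hb hπ).isUnit _
    obtain ⟨v, hv⟩ := exists_pairing_eq_of_product (b := b)
      (ρ := (Υ 0).eval (-π₁ / π₂) / (a + b * (-π₁ / π₂)) ^ 2) hd hπ hb hc h0 hm
      (by rw [div_mul_cancel₀ _ (pow_ne_zero 2 hroot)])
      (by
        rw [← mul_div_assoc, ← neg_div, ← hγ, eq_div_iff (pow_ne_zero 2 hroot)]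
        ring)
      hsum
    exact isExtremalGeometry_of_sum_curvatureTerm hd hB hU hreg hc hlast (hfactor a b c hc) hA hA0 v
      fun x hx => hv x (fun p => ((hreg x hx).2 p).1) (hlast x hx) (hfactor a b c hc x hx)
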